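/- Let $(M,g,J)$ be a Kähler manifold (that is, $J$ is an integrable $g$-orthogonal almost complex structure and the 2-form $g(J\cdot,\cdot)$ is symplectic) whose Ricci tensor $\mathrm{Ric}$ has exactly two eigenvalues $\lambda<\mu$ at every point, where $\lambda,\mu$ are constants. For $x\in M$ let $E_\lambda(x),E_\mu(x)\subset T_xM$ be the corresponding eigenspaces of $\mathrm{Ric}$ (with respect to $g$). Then $E_\lambda$ and $E_\mu$ are $J$-invariant, and there is a unique field $\bar J$ of endomorphisms of $TM$ with $$\bar J|_{E_\lambda}=J|_{E_\lambda},\qquad \bar J|_{E_\mu}=-J|_{E_\mu}.$$ The field $\bar J$ is a smooth $g$-orthogonal almost complex structure, it commutes with $J$, and $(g,\bar J)$ is an almost Kähler structure, i.e. the fundamental form $\bar\Omega(\cdot,\cdot)=g(\bar J\cdot,\cdot)$ is symplectic. Moreover, $(g,\bar J)$ is Kähler (equivalently, $\bar J$ is integrable, i.e. its Nijenhuis tensor vanishes) if and only if $(M,g)$ is locally a product of two Kähler–Einstein manifolds with Einstein constants $\lambda$ and $\mu$, i.e. every point of $M$ has an open neighbourhood isometric to an open subset of a Riemannian product $(M_1,g_1)\times(M_2,g_2)$,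 where $(M_1,g_1)$ and $(M_2,g_2)$ carry Kähler structures, $\mathrm{Ric}_{g_1}=\lambda g_1$ and $\mathrm{Ric}_{g_2}=\mu g_2$. -/

import Mathlib

set_option maxSynthPendingDepth 3

open scoped Manifold ContDiff Topology

noncomputable section

namespace KahlerGeometry

/-! ### Riemannian geometry on an open subset of a vector space

`G y v w` is the value at the point `y` of a metric on constant vector fields `v`, `w`. -/

section LocalGeometry

variable {F : Type*} [NormedAddCommGroup F] [NormedSpace ℝ F]

/-- The Christoffel symbols of the first kind, in terms of the derivative `D` of the metric:
`(v, w, z) ↦ (D v w z + D w v z - D z v w) / 2`. -/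
def christoffelLower (D : F →L[ℝ] F →L[ℝ] F →L[ℝ] ℝ) : F →L[ℝ] F →L[ℝ] F →L[ℝ] ℝ :=
  (1 / 2 : ℝ) • (D + D.flip -
    ((ContinuousLinearMap.flipₗᵢ ℝ F F ℝ).toContinuousLinearEquiv :
      (F →L[ℝ] F →L[ℝ] ℝ) →L[ℝ] (F →L[ℝ] F →L[ℝ] ℝ)).comp D.flip)

theorem christoffelLower_apply (D : F →L[ℝ] F →L[ℝ] F →L[ℝ] ℝ) (v w z : F) :
    christoffelLower D v w z = (1 / 2 : ℝ) * (D v w z + D w v z - D z v w) := rfl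

/-- The Christoffel symbols `Γ y v w` of the metric `G`, i.e. the value at `y` of `∇_v w` for the
Levi-Civita connection and constant vector fields `v`, `w`. The index is raised by the inverse of
the isomorphism `v ↦ G y v` from vectors to covectors. -/
def christoffel (G : F → F →L[ℝ] F →L[ℝ] ℝ) (y : F) : F →L[ℝ] F →L[ℝ] F :=
  (ContinuousLinearMap.compL ℝ F (F →L[ℝ] ℝ) F (G y).inverse).comp
    (christoffelLower (fderiv ℝ G y))

/-- The curvature `R(u, v) = [∇_u, ∇_v] - ∇_[u, v]` of the metric `G` at `y`. -/
def curvature (G : F → F →L[ℝ] F →L[ℝ] ℝ) (y u v : F) : F →L[ℝ] F :=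
  fderiv ℝ (christoffel G) y u v - fderiv ℝ (christoffel G) y v u
    + (christoffel G y u).comp (christoffel G y v)
    - (christoffel G y v).comp (christoffel G y u)

/-- The linear map `u ↦ R(u, v) w`. -/
def curvatureLeft (G : F → F →L[ℝ] F →L[ℝ] ℝ) (y v w : F) : F →ₗ[ℝ] F where
  toFun u := curvature G y u v w
  map_add' a b := by simp [curvature]; abel
  map_smul' c a := by simp [curvature, smul_sub, smul_add]

/-- The Ricci tensor `Ric(v, w) = tr (u ↦ R(u, v) w)` of the metric `G` at `y`. -/
def localRicci (G : F → F →L[ℝ] F →L[ℝ] ℝ) (y : F) : F →ₗ[ℝ] F →ₗ[ℝ] ℝ :=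
  LinearMap.mk₂ ℝ (fun v w => LinearMap.trace ℝ F (curvatureLeft G y v w))
    (fun v v' w => by
      rw [← map_add]; congr 1; ext u; simp [curvatureLeft, curvature]; abel)
    (fun c v w => by
      rw [← map_smul]; congr 1; ext u; simp [curvatureLeft, curvature, smul_sub, smul_add])
    (fun v w w' => by
      rw [← map_add]; congr 1; ext u; simp [curvatureLeft])
    (fun c v w => by
      rw [← map_smul]; congr 1; ext u; simp [curvatureLeft])

/-- The exterior derivative `dW(u, v, w)` at `y` of a 2-form `W`, on constant vector fields. -/
def localExtDeriv (W : F → F →L[ℝ] F →L[ℝ] ℝ) (y u v w : F) : ℝ :=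
  fderiv ℝ W y u v w - fderiv ℝ W y v u w + fderiv ℝ W y w u v

/-- The Nijenhuis tensor `N(v, w) = [Jv, Jw] - J[Jv, w] - J[v, Jw] - [v, w]` at `y` of a field of
endomorphisms `J`, on constant vector fields `v`, `w`. -/
def localNijenhuis (J : F → F →L[ℝ] F) (y v w : F) : F :=
  fderiv ℝ J y (J y v) w - fderiv ℝ J y (J y w) v
    + J y (fderiv ℝ J y w v) - J y (fderiv ℝ J y v w)

end LocalGeometry

/-! ### Manifolds -/

section Manifold

variable {E : Type*} [NormedAddCommGroup E] [NormedSpace ℝ E]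
  {M : Type*} [TopologicalSpace M] [ChartedSpace E M]

/-- A bilinear form on each tangent space. -/
abbrev BilinField (E : Type*) [NormedAddCommGroup E] [NormedSpace ℝ E]
    (M : Type*) [TopologicalSpace M] [ChartedSpace E M] :=
  ∀ x : M, TangentSpace 𝓘(ℝ, E) x →L[ℝ] TangentSpace 𝓘(ℝ, E) x →L[ℝ] ℝ

/-- An endomorphism of each tangent space. -/
abbrev EndoField (E : Type*) [NormedAddCommGroup E] [NormedSpace ℝ E]
    (M : Type*) [TopologicalSpace M] [ChartedSpace E M] :=
  ∀ x : M, TangentSpace 𝓘(ℝ, E) x →L[ℝ] TangentSpace 𝓘(ℝ, E) x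

/-- The derivative at `x` of the chart around `x₀`. -/
def chartDeriv (x₀ x : M) : E →L[ℝ] E :=
  mfderiv 𝓘(ℝ, E) 𝓘(ℝ, E) (extChartAt 𝓘(ℝ, E) x₀) x

/-- The derivative at `y` of the inverse of the chart around `x₀`. -/
def chartSymmDeriv (x₀ : M) (y : E) : E →L[ℝ] E :=
  mfderiv 𝓘(ℝ, E) 𝓘(ℝ, E) (extChartAt 𝓘(ℝ, E) x₀).symm y

/-- The expression of a field of bilinear forms in the chart around `x₀`. -/
def chartBilin (B : BilinField E M) (x₀ : M) (y : E) : E →L[ℝ] E →L[ℝ] ℝ :=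
  ContinuousLinearMap.bilinearComp
    (show E →L[ℝ] E →L[ℝ] ℝ from B ((extChartAt 𝓘(ℝ, E) x₀).symm y))
    (chartSymmDeriv x₀ y) (chartSymmDeriv x₀ y)

/-- The expression of a field of endomorphisms in the chart around `x₀`. -/
def chartEndo (J : EndoField E M) (x₀ : M) (y : E) : E →L[ℝ] E :=
  (chartDeriv x₀ ((extChartAt 𝓘(ℝ, E) x₀).symm y)).comp
    ((show E →L[ℝ] E from J ((extChartAt 𝓘(ℝ, E) x₀).symm y)).comp (chartSymmDeriv x₀ y))

variable [IsManifold 𝓘(ℝ, E) ∞ M]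

/-- A smooth Riemannian metric on `M`. -/
abbrev RiemMetric (E : Type*) [NormedAddCommGroup E] [NormedSpace ℝ E]
    (M : Type*) [TopologicalSpace M] [ChartedSpace E M] [IsManifold 𝓘(ℝ, E) ∞ M] :=
  Bundle.ContMDiffRiemannianMetric 𝓘(ℝ, E) ∞ E (fun x : M => TangentSpace 𝓘(ℝ, E) x)

/-- The field of endomorphisms `J` is smooth. -/
def IsSmoothEndo (J : EndoField E M) : Prop :=
  ContMDiff 𝓘(ℝ, E) (𝓘(ℝ, E).prod 𝓘(ℝ, E →L[ℝ] E)) ∞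
    (fun x : M => Bundle.TotalSpace.mk' (E →L[ℝ] E)
      (E := fun x : M => TangentSpace 𝓘(ℝ, E) x →L[ℝ] TangentSpace 𝓘(ℝ, E) x) x (J x))

/-- The field of bilinear forms `B` is smooth. -/
def IsSmoothBilin (B : BilinField E M) : Prop :=
  ContMDiff 𝓘(ℝ, E) (𝓘(ℝ, E).prod 𝓘(ℝ, E →L[ℝ] E →L[ℝ] ℝ)) ∞
    (fun x : M => Bundle.TotalSpace.mk' (E →L[ℝ] E →L[ℝ] ℝ)
      (E := fun x : M => TangentSpace 𝓘(ℝ, E) x →L[ℝ] TangentSpace 𝓘(ℝ, E) x →L[ℝ] ℝ) x (B x))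

/-- The Ricci tensor of `g` at `x`, computed in the chart around `x`. -/
def ricci (g : RiemMetric E M) (x : M) :
    TangentSpace 𝓘(ℝ, E) x →ₗ[ℝ] TangentSpace 𝓘(ℝ, E) x →ₗ[ℝ] ℝ :=
  (localRicci (chartBilin g.inner x) (extChartAt 𝓘(ℝ, E) x x)).compl₁₂
    (show TangentSpace 𝓘(ℝ, E) x →ₗ[ℝ] E from (chartDeriv (E := E) x x).toLinearMap)
    (show TangentSpace 𝓘(ℝ, E) x →ₗ[ℝ] E from (chartDeriv (E := E) x x).toLinearMap)

/-- The eigenspace at `x` of the Ricci tensor of `g` for the value `r`: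
all `v` with `Ric(v, w) = r g(v, w)` for all `w`. -/
def ricciEigenspace (g : RiemMetric E M) (r : ℝ) (x : M) : Submodule ℝ (TangentSpace 𝓘(ℝ, E) x) where
  carrier := {v | ∀ w, ricci g x v w = r * g.inner x v w}
  add_mem' := by
    intro a b ha hb w
    simp [ha w, hb w, mul_add]
  zero_mem' := by simp
  smul_mem' := by
    intro c a ha w
    simp [ha w, mul_left_comm]

/-- `r` is an eigenvalue of the Ricci tensor of `g` at `x`. -/
def IsRicciEigenvalue (g : RiemMetric E M) (r : ℝ) (x : M) : Prop :=
  ricciEigenspace g r x ≠ ⊥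

/-- `Ric = c g`, with a constant `c`. -/
def IsEinstein (g : RiemMetric E M) (c : ℝ) : Prop :=
  ∀ (x : M) (v w : TangentSpace 𝓘(ℝ, E) x), ricci g x v w = c * g.inner x v w

/-- `J` is a `g`-orthogonal (smooth) almost complex structure. -/
structure IsOrthogonalAlmostComplex (g : RiemMetric E M) (J : EndoField E M) : Prop where
  smooth : IsSmoothEndo J
  sq : ∀ (x : M) (v : TangentSpace 𝓘(ℝ, E) x), J x (J x v) = -v
  orthogonal : ∀ (x : M) (v w : TangentSpace 𝓘(ℝ, E) x),
    g.inner x (J x v) (J x w) = g.inner x v w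

/-- A symplectic form: a smooth 2-form that is nondegenerate, and closed (in all charts). -/
structure IsSymplectic (W : BilinField E M) : Prop where
  smooth : IsSmoothBilin W
  alternating : ∀ (x : M) (v : TangentSpace 𝓘(ℝ, E) x), W x v v = 0
  nondegenerate : ∀ (x : M) (v : TangentSpace 𝓘(ℝ, E) x), (∀ w, W x v w = 0) → v = 0
  closed : ∀ x₀ : M, ∀ y ∈ (extChartAt 𝓘(ℝ, E) x₀).target, ∀ u v w : E,
    localExtDeriv (chartBilin W x₀) y u v w = 0

/-- The fundamental form `Ω(v, w) = g(Jv, w)`. -/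
def fundamentalForm (g : RiemMetric E M) (J : EndoField E M) : BilinField E M :=
  fun x => (g.inner x).comp (J x)

/-- `(g, J)` is an almost Kähler structure. -/
structure IsAlmostKahler (g : RiemMetric E M) (J : EndoField E M) : Prop where
  almostComplex : IsOrthogonalAlmostComplex g J
  symplectic : IsSymplectic (fundamentalForm g J)

/-- `J` is integrable: its Nijenhuis tensor vanishes (in all charts). -/
def IsIntegrable (J : EndoField E M) : Prop :=
  ∀ x₀ : M, ∀ y ∈ (extChartAt 𝓘(ℝ, E) x₀).target, ∀ v w : E,
    localNijenhuis (chartEndo J x₀) y v w = 0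

/-- `(g, J)` is a Kähler structure: almost Kähler, with `J` integrable. -/
structure IsKahler (g : RiemMetric E M) (J : EndoField E M) : Prop where
  almostKahler : IsAlmostKahler g J
  integrable : IsIntegrable J

/-- `Φ` is an isometry of an open subset of `(M, g)` onto an open subset of the Riemannian product
of `(M₁, g₁)` and `(M₂, g₂)`. -/
structure IsLocalProductIsometry
    {E₁ : Type*} [NormedAddCommGroup E₁] [NormedSpace ℝ E₁]
    {M₁ : Type*} [TopologicalSpace M₁] [ChartedSpace E₁ M₁] [IsManifold 𝓘(ℝ, E₁) ∞ M₁]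
    {E₂ : Type*} [NormedAddCommGroup E₂] [NormedSpace ℝ E₂]
    {M₂ : Type*} [TopologicalSpace M₂] [ChartedSpace E₂ M₂] [IsManifold 𝓘(ℝ, E₂) ∞ M₂]
    (g : RiemMetric E M) (g₁ : RiemMetric E₁ M₁) (g₂ : RiemMetric E₂ M₂)
    (Φ : OpenPartialHomeomorph M (M₁ × M₂)) : Prop where
  smooth : ContMDiffOn 𝓘(ℝ, E) (𝓘(ℝ, E₁).prod 𝓘(ℝ, E₂)) ∞ Φ Φ.source
  smooth_symm : ContMDiffOn (𝓘(ℝ, E₁).prod 𝓘(ℝ, E₂)) 𝓘(ℝ, E) ∞ Φ.symm Φ.target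
  isometry : ∀ y ∈ Φ.source, ∀ v w : TangentSpace 𝓘(ℝ, E) y,
    g.inner y v w =
      g₁.inner (Φ y).1 (mfderiv 𝓘(ℝ, E) 𝓘(ℝ, E₁) (fun z => (Φ z).1) y v)
        (mfderiv 𝓘(ℝ, E) 𝓘(ℝ, E₁) (fun z => (Φ z).1) y w)
      + g₂.inner (Φ y).2 (mfderiv 𝓘(ℝ, E) 𝓘(ℝ, E₂) (fun z => (Φ z).2) y v)
        (mfderiv 𝓘(ℝ, E) 𝓘(ℝ, E₂) (fun z => (Φ z).2) y w)

/-- `(M, g)` is locally a product of two Kähler–Einstein manifolds with Einstein constants `a` and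
`b`: each point has an open neighbourhood which is isometric to an open subset of the Riemannian
product of a Kähler manifold with `Ric₁ = a g₁` and a Kähler manifold with `Ric₂ = b g₂`. -/
def IsLocallyProductKahlerEinstein (g : RiemMetric E M) (a b : ℝ) : Prop :=
  ∀ x : M, ∃ (p q : ℕ)
    (M₁ : Type) (_ : TopologicalSpace M₁) (_ : T2Space M₁) (_ : SecondCountableTopology M₁)
    (_ : ChartedSpace (EuclideanSpace ℝ (Fin p)) M₁)
    (_ : IsManifold 𝓘(ℝ, EuclideanSpace ℝ (Fin p)) ∞ M₁)
    (M₂ : Type) (_ : TopologicalSpace M₂) (_ : T2Space M₂) (_ : SecondCountableTopology M₂)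
    (_ : ChartedSpace (EuclideanSpace ℝ (Fin q)) M₂)
    (_ : IsManifold 𝓘(ℝ, EuclideanSpace ℝ (Fin q)) ∞ M₂)
    (g₁ : RiemMetric (EuclideanSpace ℝ (Fin p)) M₁) (J₁ : EndoField (EuclideanSpace ℝ (Fin p)) M₁)
    (g₂ : RiemMetric (EuclideanSpace ℝ (Fin q)) M₂) (J₂ : EndoField (EuclideanSpace ℝ (Fin q)) M₂)
    (Φ : OpenPartialHomeomorph M (M₁ × M₂)),
    IsKahler g₁ J₁ ∧ IsEinstein g₁ a ∧ IsKahler g₂ J₂ ∧ IsEinstein g₂ b ∧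
    x ∈ Φ.source ∧ IsLocalProductIsometry g g₁ g₂ Φ

/-- `J'` is the field of endomorphisms which equals `J` on the `a`-eigenspaces of the Ricci tensor
of `g` and `-J` on its `b`-eigenspaces. -/
def IsFlip (g : RiemMetric E M) (J : EndoField E M) (a b : ℝ) (J' : EndoField E M) : Prop :=
  ∀ x : M, (∀ v ∈ ricciEigenspace g a x, J' x v = J x v) ∧
    (∀ v ∈ ricciEigenspace g b x, J' x v = -(J x v))

end Manifold

end KahlerGeometry

end

/-! A Kähler structure is parallel (`covDeriv_eq_zero_of_kahler`), so the curvature commutes with J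
and Ric is J-invariant (`localRicci_invariant`); hence J preserves the eigenspaces. The spectral
theorem gives the orthogonal splitting TM = E_λ ⊕ E_μ, which produces J̄ and its algebraic
properties.

Write Ω = g(J·,·) and ρ = Ric(J·,·). The form (λ+μ)Ω − 2ρ equals (μ−λ)Ω on E_λ and −(μ−λ)Ω on E_μ,
so (μ−λ)Ω̄ = (λ+μ)Ω − 2ρ (`IsFlip.inner_apply`). This one identity makes J̄ smooth and, as λ and μ
are constants, makes Ω̄ closed once dΩ = 0 and dρ = 0. The latter (`localExtDeriv_ricciForm`) comes
from 2ρ(v,w) = tr(J R(v,w)): since J is parallel, dρ is half the trace of J composed with the cyclic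
sum in the second Bianchi identity.

If J̄ is integrable, it is parallel too. Then T = J̄J, which is −1 on E_λ and 1 on E_μ, is parallel,
and Q = (1−T)/2 is a parallel field of projections onto E_λ. A projection that is parallel for a
torsion-free connection has involutive range and kernel, and `exists_straightening` gives
coordinates in which it is constant. There the metric is block diagonal and each block depends on
its own variables only (`eq_prodMetric`, the local de Rham splitting). J preserves both blocks and
Ric splits, so the factors are Kähler–Einstein (`exists_kahlerEinstein_factors`). The Frobenius step
rests on commuting flows, obtained from the implicit function theorem in the Banach space of paths
(`exists_commuting_flow_of_contDiff`).

Conversely, in a product of Einstein manifolds with constants λ and μ the Ricci tensor forces T to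
be the constant field (−1, 1), which is parallel for a product metric. Hence T, and with J also J̄,
is parallel, and the Nijenhuis tensor of J̄ vanishes (`IsFlip.covDeriv_eq_zero_of_product`).

Tensors are handled in charts; `IsLocalIsometryOn` carries Christoffel symbols, curvature and Ricci
through coordinate changes and through the product isometry. -/

namespace KahlerGeometry

/-! ### Levi-Civita connection and curvature symmetries on an open set. -/

section LocalRiemannian

variable {F : Type*} [NormedAddCommGroup F] [NormedSpace ℝ F]

/-- `G` is a smooth (pseudo-)Riemannian metric on the open set `U`. -/
structure IsMetricOn (G : F → F →L[ℝ] F →L[ℝ] ℝ) (U : Set F) : Prop where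
  isOpen : IsOpen U
  contDiffOn : ContDiffOn ℝ ∞ G U
  symm : ∀ y ∈ U, ∀ v w, G y v w = G y w v
  nondeg : ∀ y ∈ U, ∀ v, (∀ w, G y v w = 0) → v = 0

theorem exists_equiv_of_nondegenerate [FiniteDimensional ℝ F] (B : F →L[ℝ] F →L[ℝ] ℝ)
    (h : ∀ v, (∀ w, B v w = 0) → v = 0) :
    ∃ e : F ≃L[ℝ] (F →L[ℝ] ℝ), (e : F →L[ℝ] F →L[ℝ] ℝ) = B := by
  have hinj : Function.Injective (B : F →ₗ[ℝ] F →L[ℝ] ℝ) := by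
    rw [injective_iff_map_eq_zero]
    intro v hv
    refine h v fun w => ?_
    have : B v = 0 := hv
    simp [this]
  have hdim : Module.finrank ℝ F = Module.finrank ℝ (F →L[ℝ] ℝ) := by
    rw [← (LinearMap.toContinuousLinearMap (𝕜 := ℝ) (E := F) (F' := ℝ)).finrank_eq]
    exact (Subspace.dual_finrank_eq (K := ℝ) (V := F)).symm
  refine ⟨(LinearEquiv.ofInjectiveOfFinrankEq (B : F →ₗ[ℝ] F →L[ℝ] ℝ) hinj hdim
    ).toContinuousLinearEquiv, ?_⟩
  ext v w
  rfl

/-- `ContinuousLinearMap.inverse` is zero on non-invertible maps. Nondegeneracy in finite dimension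
excludes this case, so that raising an index in `christoffel` has its intended meaning. -/
theorem apply_inverse_of_nondegenerate [FiniteDimensional ℝ F] (B : F →L[ℝ] F →L[ℝ] ℝ)
    (h : ∀ v, (∀ w, B v w = 0) → v = 0) (l : F →L[ℝ] ℝ) : B (B.inverse l) = l := by
  obtain ⟨e, rfl⟩ := exists_equiv_of_nondegenerate B h
  simp

theorem fderiv_clm_apply_const {A B : Type*} [NormedAddCommGroup A] [NormedSpace ℝ A]
    [NormedAddCommGroup B] [NormedSpace ℝ B] {X : F → A →L[ℝ] B} {y : F}
    (h : DifferentiableAt ℝ X y) (a : A) (u : F) :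
    fderiv ℝ (fun z => X z a) y u = fderiv ℝ X y u a := by
  simpa using congrArg (fun L => L u) (h.hasFDerivAt.clm_apply (hasFDerivAt_const a y)).fderiv

theorem contDiffAt_christoffelLower {D : F → F →L[ℝ] F →L[ℝ] F →L[ℝ] ℝ} {y : F}
    (h : ContDiffAt ℝ ∞ D y) : ContDiffAt ℝ ∞ (fun z => christoffelLower (D z)) y := by
  unfold christoffelLower
  have hf : ContDiffAt ℝ ∞ (fun z => (D z).flip) y :=
    ((ContinuousLinearMap.flipₗᵢ ℝ F F (F →L[ℝ] ℝ)).contDiff.contDiffAt).comp y h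
  exact ((h.add hf).sub (contDiffAt_const.clm_comp hf)).const_smul _

theorem sndFDeriv_symm {A : Type*} [NormedAddCommGroup A] [NormedSpace ℝ A] {X : F → A} {y : F}
    (h : ContDiffAt ℝ ∞ X y) (u v : F) :
    fderiv ℝ (fderiv ℝ X) y u v = fderiv ℝ (fderiv ℝ X) y v u :=
  (h.isSymmSndFDerivAt (by
    rw [minSmoothness_of_isRCLikeNormedField]
    exact WithTop.coe_le_coe.2 (le_top : (2 : ℕ∞) ≤ ⊤))) u v

theorem contDiffAt_fderiv {A : Type*} [NormedAddCommGroup A] [NormedSpace ℝ A] {X : F → A} {y : F}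
    (h : ContDiffAt ℝ ∞ X y) : ContDiffAt ℝ ∞ (fderiv ℝ X) y :=
  h.fderiv_right (by norm_num)

theorem curvature_swap (G : F → F →L[ℝ] F →L[ℝ] ℝ) (u v : F) (y : F) :
    curvature G y u v = -curvature G y v u := by
  simp only [curvature]
  abel

theorem localRicci_apply (G : F → F →L[ℝ] F →L[ℝ] ℝ) (y v w : F) :
    localRicci G y v w = LinearMap.trace ℝ F (curvatureLeft G y v w) := rfl

namespace IsMetricOn

variable {G : F → F →L[ℝ] F →L[ℝ] ℝ} {U : Set F}

theorem mono (hG : IsMetricOn G U) {V : Set F} (hV : IsOpen V) (h : V ⊆ U) : IsMetricOn G V :=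
  ⟨hV, hG.contDiffOn.mono h, fun y hy => hG.symm y (h hy), fun y hy => hG.nondeg y (h hy)⟩

theorem contDiffAt (hG : IsMetricOn G U) {y : F} (hy : y ∈ U) : ContDiffAt ℝ ∞ G y :=
  hG.contDiffOn.contDiffAt (hG.isOpen.mem_nhds hy)

theorem differentiableAt (hG : IsMetricOn G U) {y : F} (hy : y ∈ U) : DifferentiableAt ℝ G y :=
  (hG.contDiffAt hy).differentiableAt (by simp)

theorem ext (hG : IsMetricOn G U) {y : F} (hy : y ∈ U) {v v' : F}
    (h : ∀ w, G y v w = G y v' w) : v = v' :=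
  sub_eq_zero.1 (hG.nondeg y hy _ fun w => by simp [h w])

theorem fderiv_symm (hG : IsMetricOn G U) {y : F} (hy : y ∈ U) (u v w : F) :
    fderiv ℝ G y u v w = fderiv ℝ G y u w v := by
  have hd := hG.differentiableAt hy
  have h1 : ∀ a b, fderiv ℝ (fun z => G z a b) y u = fderiv ℝ G y u a b := fun a b => by
    rw [fderiv_clm_apply_const (hd.clm_apply (differentiableAt_const a)),
      fderiv_clm_apply_const hd]
  rw [← h1, ← h1]
  congr 1
  refine Filter.EventuallyEq.fderiv_eq ?_
  filter_upwards [hG.isOpen.mem_nhds hy] with z hz using hG.symm z hz v w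

variable [FiniteDimensional ℝ F]

theorem contDiffAt_inverse (hG : IsMetricOn G U) {y : F} (hy : y ∈ U) :
    ContDiffAt ℝ ∞ (fun z => (G z).inverse) y := by
  obtain ⟨e, he⟩ := exists_equiv_of_nondegenerate (G y) (hG.nondeg y hy)
  have := contDiffAt_map_inverse (n := ∞) e
  rw [he] at this
  exact this.comp y (hG.contDiffAt hy)

theorem contDiffAt_christoffel (hG : IsMetricOn G U) {y : F} (hy : y ∈ U) :
    ContDiffAt ℝ ∞ (christoffel G) y := by
  unfold christoffel
  exact ((ContinuousLinearMap.contDiff _).contDiffAt.comp y (hG.contDiffAt_inverse hy)).clm_comp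
    (contDiffAt_christoffelLower (contDiffAt_fderiv (hG.contDiffAt hy)))

theorem differentiableAt_christoffel (hG : IsMetricOn G U) {y : F} (hy : y ∈ U) :
    DifferentiableAt ℝ (christoffel G) y :=
  (hG.contDiffAt_christoffel hy).differentiableAt (by simp)

theorem christoffel_spec (hG : IsMetricOn G U) {y : F} (hy : y ∈ U) (u v w : F) :
    G y (christoffel G y u v) w =
      (1 / 2 : ℝ) * (fderiv ℝ G y u v w + fderiv ℝ G y v u w - fderiv ℝ G y w u v) := by
  have := apply_inverse_of_nondegenerate (G y) (hG.nondeg y hy)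
    (christoffelLower (fderiv ℝ G y) u v)
  rw [← christoffelLower_apply, ← this]
  rfl

theorem christoffel_symm (hG : IsMetricOn G U) {y : F} (hy : y ∈ U) (u v : F) :
    christoffel G y u v = christoffel G y v u := by
  refine hG.ext hy fun w => ?_
  rw [hG.christoffel_spec hy, hG.christoffel_spec hy, hG.fderiv_symm hy w u v]
  ring

/-- ∇G = 0: adding two instances of the Koszul formula cancels all but one derivative of G. -/
theorem compat (hG : IsMetricOn G U) {y : F} (hy : y ∈ U) (u v w : F) :
    fderiv ℝ G y u v w = G y (christoffel G y u v) w + G y v (christoffel G y u w) := by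
  rw [hG.symm y hy v, hG.christoffel_spec hy, hG.christoffel_spec hy]
  linarith [hG.fderiv_symm hy v u w, hG.fderiv_symm hy u w v, hG.fderiv_symm hy w v u]

/-- The Levi-Civita connection is the only torsion-free metric connection. -/
theorem eq_christoffel (hG : IsMetricOn G U) {y : F} (hy : y ∈ U) (K : F → F → F)
    (hs : ∀ u v, K u v = K v u)
    (hc : ∀ u v w, fderiv ℝ G y u v w = G y (K u v) w + G y v (K u w)) (u v : F) :
    christoffel G y u v = K u v := by
  refine hG.ext hy fun w => ?_
  rw [hG.christoffel_spec hy, hc u v w, hc v u w, hc w u v, hs v u, hs w u, hs w v,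
    hG.symm y hy u (K v w), hG.symm y hy v (K u w)]
  ring

theorem fderiv_curvature (hG : IsMetricOn G U) {y : F} (hy : y ∈ U) (u v w : F) :
    fderiv ℝ (fun z => curvature G z v w) y u =
      fderiv ℝ (fderiv ℝ (christoffel G)) y u v w - fderiv ℝ (fderiv ℝ (christoffel G)) y u w v
      + (fderiv ℝ (christoffel G) y u v).comp (christoffel G y w)
      + (christoffel G y v).comp (fderiv ℝ (christoffel G) y u w)
      - (fderiv ℝ (christoffel G) y u w).comp (christoffel G y v)
      - (christoffel G y w).comp (fderiv ℝ (christoffel G) y u v) := by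
  have h1 := (hG.differentiableAt_christoffel hy).hasFDerivAt
  have h2 := ((contDiffAt_fderiv (hG.contDiffAt_christoffel hy)).differentiableAt
    (by simp)).hasFDerivAt
  have e := fun a => h1.clm_apply (hasFDerivAt_const a y)
  have e2 := fun a b => (h2.clm_apply (hasFDerivAt_const a y)).clm_apply (hasFDerivAt_const b y)
  have h3 := (((e2 v w).sub (e2 w v)).add ((e v).clm_comp (e w))).sub ((e w).clm_comp (e v))
  have h4 := congrArg (fun L => L u) h3.fderiv
  unfold curvature
  refine h4.trans ?_
  ext a
  simp
  abel

theorem differentiableAt_curvature (hG : IsMetricOn G U) {y : F} (hy : y ∈ U) (v w : F) :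
    DifferentiableAt ℝ (fun z => curvature G z v w) y := by
  have h1 := hG.differentiableAt_christoffel hy
  have h2 := ((contDiffAt_fderiv (hG.contDiffAt_christoffel hy)).differentiableAt (by simp))
  have e := fun a => h1.clm_apply (differentiableAt_const a)
  have e2 := fun a b => (h2.clm_apply (differentiableAt_const a)).clm_apply
    (differentiableAt_const b)
  exact (((e2 v w).sub (e2 w v)).add ((e v).clm_comp (e w))).sub ((e w).clm_comp (e v))

/-- The second Bianchi identity. -/
theorem bianchi_two (hG : IsMetricOn G U) {y : F} (hy : y ∈ U) (u v w a : F) :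
    let D := fun u v w => fderiv ℝ (fun z => curvature G z v w) y u a
      + christoffel G y u (curvature G y v w a) - curvature G y v w (christoffel G y u a)
    D u v w + D v w u + D w u v = 0 := by
  -- The terms R(Γ(u,v), w) of ∇R cancel in the cyclic sum by symmetry of Γ, so D keeps only the
  -- commutator with Γ. What remains uses only that second derivatives of Γ are symmetric.
  intro D
  have hs := sndFDeriv_symm (hG.contDiffAt_christoffel hy)
  simp only [D]
  rw [hG.fderiv_curvature hy, hG.fderiv_curvature hy, hG.fderiv_curvature hy]
  simp only [hs v u, hs w u, hs w v, curvature]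
  simp
  abel

/-- The first Bianchi identity. -/
theorem bianchi_one (hG : IsMetricOn G U) {y : F} (hy : y ∈ U) (u v w : F) :
    curvature G y u v w + curvature G y v w u + curvature G y w u v = 0 := by
  have hs : ∀ a b c, fderiv ℝ (christoffel G) y a b c = fderiv ℝ (christoffel G) y a c b := by
    intro a b c
    have hd := hG.differentiableAt_christoffel hy
    have h1 : ∀ b c, fderiv ℝ (fun z => christoffel G z b c) y a
        = fderiv ℝ (christoffel G) y a b c := fun b c => by
      rw [fderiv_clm_apply_const (hd.clm_apply (differentiableAt_const b)),
        fderiv_clm_apply_const hd]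
    rw [← h1, ← h1]
    congr 1
    refine Filter.EventuallyEq.fderiv_eq ?_
    filter_upwards [hG.isOpen.mem_nhds hy] with z hz using hG.christoffel_symm hz b c
  simp only [curvature, hs v u w, hs w u v, hs u w v, add_apply,
    sub_apply, ContinuousLinearMap.comp_apply, hG.christoffel_symm hy v u,
    hG.christoffel_symm hy w u, hG.christoffel_symm hy w v]
  abel

/-- Differentiating `compat` once more and antisymmetrizing in u, v, the second derivatives of G
drop out and the action of R(u, v) on G remains. -/
theorem curvature_skew (hG : IsMetricOn G U) {y : F} (hy : y ∈ U) (u v a b : F) :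
    G y (curvature G y u v a) b = -G y a (curvature G y u v b) := by
  have hd := (hG.differentiableAt hy).hasFDerivAt
  have hc := (hG.differentiableAt_christoffel hy).hasFDerivAt
  have hd2 := ((contDiffAt_fderiv (hG.contDiffAt hy)).differentiableAt (by simp)).hasFDerivAt
  have key : ∀ u v, fderiv ℝ (fderiv ℝ G) y u v a b =
      fderiv ℝ G y u (christoffel G y v a) b + G y (fderiv ℝ (christoffel G) y u v a) b +
      (fderiv ℝ G y u a (christoffel G y v b) + G y a (fderiv ℝ (christoffel G) y u v b)) := by
    intro u v
    have e := fun a => (hc.clm_apply (hasFDerivAt_const v y)).clm_apply (hasFDerivAt_const a y)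
    have h1 := ((hd2.clm_apply (hasFDerivAt_const v y)).clm_apply
      (hasFDerivAt_const a y)).clm_apply (hasFDerivAt_const b y)
    have h2 := ((hd.clm_apply (e a)).clm_apply (hasFDerivAt_const b y)).add
      ((hd.clm_apply (hasFDerivAt_const a y)).clm_apply (e b))
    have h3 := h1.congr_of_eventuallyEq (f₁ := fun z => G z (christoffel G z v a) b
        + G z a (christoffel G z v b)) (by
      filter_upwards [hG.isOpen.mem_nhds hy] with z hz using (hG.compat hz v a b).symm)
    have h4 := congrArg (fun L => L u) (h3.unique h2)
    simp at h4
    linarith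
  have h := key u v
  have h' := key v u
  rw [sndFDeriv_symm (hG.contDiffAt hy) v u] at h'
  simp only [hG.compat hy] at h h'
  simp [curvature]
  linarith

/-- The octahedron argument: four instances of the first Bianchi identity, combined by skewness in
both pairs of slots. -/
theorem curvature_pair (hG : IsMetricOn G U) {y : F} (hy : y ∈ U) (u v w z : F) :
    G y (curvature G y u v w) z = G y (curvature G y w z u) v := by
  have sk := fun u v a b => (hG.curvature_skew hy u v a b).trans
    (congrArg Neg.neg (hG.symm y hy a (curvature G y u v b)))
  have sw : ∀ u v a b, G y (curvature G y u v a) b = -G y (curvature G y v u a) b := by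
    intro u v a b
    rw [curvature_swap]
    simp
  have b1 : ∀ u v w z, G y (curvature G y u v w) z + G y (curvature G y v w u) z
      + G y (curvature G y w u v) z = 0 := by
    intro u v w z
    have := congrArg (fun a => G y a z) (hG.bianchi_one hy u v w)
    simpa using this
  linarith [b1 u v w z, b1 v w z u, b1 w z u v, b1 z u v w, sk u v w z, sk v w u z, sk w u v z,
    sk w z v u, sk z v w u, sk z u w v, sk u w z v, sk u v z w, sk v z u w, sk z u v w,
    sw u v w z, sw v w u z, sw w u v z, sw w z v u, sw z v w u, sw z u w v, sw u w z v, sw v w z u,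
    sw u v z w, sw v z u w, sw z u v w, sw w z u v, sw u w v z, sk v w z u, sk w z u v]

/-- The isomorphism v ↦ B v conjugates T into the transpose of S, and the trace is unchanged by
transposition and conjugation. -/
theorem trace_eq_of_adjoint (B : F →L[ℝ] F →L[ℝ] ℝ) (h : ∀ v, (∀ w, B v w = 0) → v = 0)
    (S T : F →ₗ[ℝ] F) (hST : ∀ u z, B (S u) z = B u (T z)) (hB : ∀ u z, B u z = B z u) :
    LinearMap.trace ℝ F S = LinearMap.trace ℝ F T := by
  obtain ⟨e, rfl⟩ := exists_equiv_of_nondegenerate B h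
  let f : F ≃ₗ[ℝ] Module.Dual ℝ F := e.toLinearEquiv.trans
    (LinearMap.toContinuousLinearMap (𝕜 := ℝ) (E := F) (F' := ℝ)).symm
  have h1 : Module.Dual.transpose (R := ℝ) S = f.conj T := by
    apply LinearMap.ext
    intro l
    obtain ⟨z, rfl⟩ := f.surjective l
    ext u
    simp only [LinearEquiv.conj_apply_apply, LinearEquiv.symm_apply_apply]
    change e z (S u) = e (T z) u
    have h1 := hST u z
    have h2 := hB (S u) z
    have h3 := hB u (T z)
    simp only [ContinuousLinearEquiv.coe_coe] at h1 h2 h3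
    rw [← h2, h1, h3]
  rw [← LinearMap.trace_transpose', h1, LinearMap.trace_conj']

/-- By the curvature symmetries, u ↦ R(u, v)w and z ↦ R(z, w)v are adjoint to each other for G. -/
theorem localRicci_symm (hG : IsMetricOn G U) {y : F} (hy : y ∈ U) (v w : F) :
    localRicci G y v w = localRicci G y w v := by
  refine trace_eq_of_adjoint (G y) (hG.nondeg y hy) _ _ (fun u z => ?_) (hG.symm y hy)
  change G y (curvature G y u v w) z = G y u (curvature G y z w v)
  rw [hG.curvature_pair hy, hG.curvature_skew hy, curvature_swap]
  simp

end IsMetricOn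

end LocalRiemannian

/-! ### Parallel complex structures and the closed Ricci form. -/

section LocalKahler

variable {F : Type*} [NormedAddCommGroup F] [NormedSpace ℝ F]

theorem contDiffAt_of_clm_apply {A B D : Type*} [NormedAddCommGroup A] [NormedSpace ℝ A]
    [NormedAddCommGroup B] [NormedSpace ℝ B] [NormedAddCommGroup D] [NormedSpace ℝ D]
    [FiniteDimensional ℝ A] {n : ℕ∞ω} {f : D → A →L[ℝ] B} {x : D}
    (h : ∀ a, ContDiffAt ℝ n (fun y => f y a) x) : ContDiffAt ℝ n f x := by
  let d := Module.finrank ℝ A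
  have hd : d = Module.finrank ℝ (Fin d → ℝ) := (Module.finrank_fin_fun ℝ).symm
  let e₁ := ContinuousLinearEquiv.ofFinrankEq hd
  let e₂ := (e₁.arrowCongr (1 : B ≃L[ℝ] B)).trans (ContinuousLinearEquiv.piRing (Fin d))
  rw [← Function.id_comp f, ← e₂.symm_comp_self]
  exact e₂.symm.contDiff.contDiffAt.comp x (contDiffAt_pi.mpr fun i => h _)

/-- The covariant derivative `∇_u T` at `y` of a field of endomorphisms `T`. -/
noncomputable def covDeriv (G : F → F →L[ℝ] F →L[ℝ] ℝ) (T : F → F →L[ℝ] F) (y u : F) : F →L[ℝ] F :=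
  fderiv ℝ T y u + (christoffel G y u).comp (T y) - (T y).comp (christoffel G y u)

/-- `J` is a smooth `G`-orthogonal almost complex structure on `U`. -/
structure IsHermitianOn (G : F → F →L[ℝ] F →L[ℝ] ℝ) (J : F → F →L[ℝ] F) (U : Set F) : Prop where
  contDiffOn : ContDiffOn ℝ ∞ J U
  sq : ∀ y ∈ U, ∀ v, J y (J y v) = -v
  orthogonal : ∀ y ∈ U, ∀ v w, G y (J y v) (J y w) = G y v w

/-- The trace of a continuous endomorphism, as a continuous linear form. -/
noncomputable def traceCLM (F : Type*) [NormedAddCommGroup F] [NormedSpace ℝ F]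
    [FiniteDimensional ℝ F] : (F →L[ℝ] F) →L[ℝ] ℝ :=
  LinearMap.toContinuousLinearMap ((LinearMap.trace ℝ F).comp (ContinuousLinearMap.coeLM ℝ))

theorem traceCLM_apply [FiniteDimensional ℝ F] (T : F →L[ℝ] F) :
    traceCLM F T = LinearMap.trace ℝ F (T : F →ₗ[ℝ] F) := rfl

theorem traceCLM_comm [FiniteDimensional ℝ F] (S T : F →L[ℝ] F) :
    traceCLM F (S.comp T) = traceCLM F (T.comp S) := by
  rw [traceCLM_apply, traceCLM_apply]
  exact LinearMap.trace_mul_comm ℝ (S : F →ₗ[ℝ] F) (T : F →ₗ[ℝ] F)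

variable {G : F → F →L[ℝ] F →L[ℝ] ℝ} {J : F → F →L[ℝ] F} {U : Set F}

namespace IsHermitianOn

theorem differentiableAt (hJ : IsHermitianOn G J U) (hG : IsMetricOn G U) {y : F} (hy : y ∈ U) :
    DifferentiableAt ℝ J y :=
  (hJ.contDiffOn.contDiffAt (hG.isOpen.mem_nhds hy)).differentiableAt (by simp)

theorem skew (hJ : IsHermitianOn G J U) {y : F} (hy : y ∈ U) (v w : F) :
    G y (J y v) w = -G y v (J y w) := by
  rw [← hJ.orthogonal y hy v, hJ.sq y hy]
  simp

end IsHermitianOn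

/-- The derivative of J² = −1; the Christoffel terms cancel. -/
theorem covDeriv_anticomm (hG : IsMetricOn G U) (hJ : IsHermitianOn G J U) {y : F}
    (hy : y ∈ U) (u v : F) :
    covDeriv G J y u (J y v) = -J y (covDeriv G J y u v) := by
  have hd := (hJ.differentiableAt hG hy).hasFDerivAt
  have h1 := hd.clm_apply (hd.clm_apply (hasFDerivAt_const v y))
  have h2 := (hasFDerivAt_const (𝕜 := ℝ) (-v) y).congr_of_eventuallyEq
    (f₁ := fun z => J z (J z v)) (by
    filter_upwards [hG.isOpen.mem_nhds hy] with z hz using hJ.sq z hz v)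
  have h3 := congrArg (fun L => L u) (h1.unique h2)
  simp at h3
  simp only [covDeriv]
  simp [hJ.sq y hy]
  rw [← sub_eq_zero, ← h3]
  abel

variable [FiniteDimensional ℝ F]

/-- Partial derivatives may be replaced by covariant ones because Γ is symmetric. In particular a
parallel field has vanishing Nijenhuis tensor. -/
theorem localNijenhuis_eq (hG : IsMetricOn G U) {y : F} (hy : y ∈ U) (v w : F) :
    localNijenhuis J y v w = covDeriv G J y (J y v) w - covDeriv G J y (J y w) v
      + J y (covDeriv G J y w v) - J y (covDeriv G J y v w) := by
  simp only [localNijenhuis, covDeriv]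
  simp [hG.christoffel_symm hy (J y w) (J y v), hG.christoffel_symm hy v,
    hG.christoffel_symm hy w (J y v)]
  abel

theorem fderiv_fundamental (hG : IsMetricOn G U) {y : F} (hJ : DifferentiableAt ℝ J y)
    (hy : y ∈ U) (u v w : F) :
    fderiv ℝ (fun z => (G z).comp (J z)) y u v w = G y (covDeriv G J y u v) w
      + G y (J y (christoffel G y u v)) w + G y (J y v) (christoffel G y u w) := by
  have h := ((hG.differentiableAt hy).hasFDerivAt.clm_comp hJ.hasFDerivAt).fderiv
  have h' := congrArg (fun L => L u v w) h
  refine h'.trans ?_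
  simp [covDeriv, hG.compat hy]
  ring

/-- The Christoffel terms cancel by symmetry of Γ and skewness of J, leaving dΩ expressed through ∇J
alone. -/
theorem localExtDeriv_eq (hG : IsMetricOn G U) (hJ : IsHermitianOn G J U) {y : F}
    (hy : y ∈ U) (u v w : F) :
    localExtDeriv (fun z => (G z).comp (J z)) y u v w = G y (covDeriv G J y u v) w
      - G y (covDeriv G J y v u) w + G y (covDeriv G J y w u) v := by
  have hd := hJ.differentiableAt hG hy
  have sk : ∀ a b, G y (J y a) b = -G y (J y b) a := fun a b => by
    rw [hJ.skew hy, hG.symm y hy]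
  simp only [localExtDeriv, fderiv_fundamental hG hd hy]
  rw [sk u, sk v, sk u, hG.christoffel_symm hy u v, hG.christoffel_symm hy w u,
    hG.christoffel_symm hy w v]
  ring

theorem covDeriv_skew (hG : IsMetricOn G U) (hJ : IsHermitianOn G J U) {y : F}
    (hy : y ∈ U) (u v w : F) :
    G y (covDeriv G J y u v) w = -G y (covDeriv G J y u w) v := by
  have hd := hJ.differentiableAt hG hy
  have sk : ∀ z ∈ U, ∀ a b, G z (J z a) b = -G z (J z b) a := fun z hz a b => by
    rw [hJ.skew hz, hG.symm z hz]
  have hW : DifferentiableAt ℝ (fun z => (G z).comp (J z)) y :=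
    (hG.differentiableAt hy).clm_comp hd
  have e : ∀ a b, fderiv ℝ (fun z => (G z).comp (J z) a b) y u
      = fderiv ℝ (fun z => (G z).comp (J z)) y u a b := fun a b => by
    rw [fderiv_clm_apply_const (hW.clm_apply (differentiableAt_const a)),
      fderiv_clm_apply_const hW]
  have h1 : fderiv ℝ (fun z => (G z).comp (J z)) y u v w
      = -fderiv ℝ (fun z => (G z).comp (J z)) y u w v := by
    have h0 : (fun z => (G z).comp (J z) v w) =ᶠ[𝓝 y] fun z => -((G z).comp (J z) w v) := by
      filter_upwards [hG.isOpen.mem_nhds hy] with z hz using sk z hz v w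
    rw [← e v w, ← e w v, h0.fderiv_eq, fderiv_fun_neg]
    rfl
  rw [fderiv_fundamental hG hd hy, fderiv_fundamental hG hd hy] at h1
  linarith [sk y hy v (christoffel G y u w), sk y hy w (christoffel G y u v)]

/-- An almost Hermitian structure with closed fundamental form and vanishing Nijenhuis tensor is
parallel. -/
theorem covDeriv_eq_zero_of_kahler (hG : IsMetricOn G U) (hJ : IsHermitianOn G J U) {y : F}
    (hy : y ∈ U) (hd : ∀ u v w, localExtDeriv (fun z => (G z).comp (J z)) y u v w = 0)
    (hN : ∀ v w, localNijenhuis J y v w = 0) (u : F) : covDeriv G J y u = 0 := by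
  set α : F → F → F → ℝ := fun u v w => G y (covDeriv G J y u v) w with hα
  have sk : ∀ u v w, α u v w = -α u w v := covDeriv_skew hG hJ hy
  have jj : ∀ u v w, α u (J y v) w = α u v (J y w) := by
    intro u v w
    simp only [hα, covDeriv_anticomm hG hJ hy]
    rw [map_neg, neg_apply, hJ.skew hy, neg_neg]
  have cyc : ∀ u v w, α u v w + α v w u + α w u v = 0 := by
    intro u v w
    have := hd u v w
    rw [localExtDeriv_eq hG hJ hy] at this
    linarith [sk v u w]
  have nij : ∀ v w u, α (J y v) w u - α (J y w) v u - α w v (J y u) + α v w (J y u) = 0 := by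
    intro v w u
    have := congrArg (fun a => G y a u) (hN v w)
    rw [localNijenhuis_eq hG hy] at this
    simp [hJ.skew hy] at this
    linarith
  have n1 : ∀ u v w, α (-u) v w = -α u v w := by
    intro u v w
    simp [hα, covDeriv]
    ring
  have n3 : ∀ u v w, α u v (-w) = -α u v w := by
    intro u v w
    simp [hα]
  -- The trilinear form t(v,w,u) = α(Jv,w,u) + α(v,w,Ju) is symmetric in v, w (vanishing Nijenhuis
  -- tensor) and skew in w, u (skewness of α). Such a form is zero.
  have tz : ∀ v w u, α (J y v) w u = -α v w (J y u) := by
    have ts : ∀ v w u, α (J y v) w u + α v w (J y u) = α (J y w) v u + α w v (J y u) :=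
      fun v w u => by linarith [nij v w u]
    have ta : ∀ v w u, α (J y v) w u + α v w (J y u) = -(α (J y v) u w + α v u (J y w)) :=
      fun v w u => by linarith [sk (J y v) w u, jj v w u, sk v (J y w) u]
    intro v w u
    linarith [ts v w u, ta w v u, ts w u v, ta u w v, ts u v w, ta v u w, ta w u v, ta u v w]
  refine ContinuousLinearMap.ext fun v => hG.ext hy fun w => ?_
  -- At (u, Jv, Jw) the cyclic identity becomes −α(u,v,w) + α(v,w,u) + α(w,u,v) = 0; comparison with
  -- the one at (u, v, w) kills α(u,v,w).
  have h := cyc u (J y v) (J y w)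
  have e1 : α u (J y v) (J y w) = -α u v w := by rw [jj, hJ.sq y hy, n3]
  have e2 : α (J y v) (J y w) u = α v w u := by
    rw [tz, jj, hJ.sq y hy, n3, neg_neg]
  have e3 : α (J y w) u (J y v) = α w u v := by
    rw [tz, hJ.sq y hy, n3, neg_neg]
  have h0 : α u v w = 0 := by linarith [cyc u v w]
  simpa using h0

/-- Curvature commutes with a parallel field of endomorphisms. -/
theorem curvature_comm_of_parallel (hG : IsMetricOn G U) {T : F → F →L[ℝ] F}
    (hT : ContDiffOn ℝ ∞ T U) (hp : ∀ y ∈ U, ∀ u, covDeriv G T y u = 0) {y : F} (hy : y ∈ U)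
    (u v w : F) : curvature G y u v (T y w) = T y (curvature G y u v w) := by
  have hTs := hT.contDiffAt (hG.isOpen.mem_nhds hy)
  have hd := (hTs.differentiableAt (by simp)).hasFDerivAt
  have hd2 := ((contDiffAt_fderiv hTs).differentiableAt (by simp)).hasFDerivAt
  have hc := (hG.differentiableAt_christoffel hy).hasFDerivAt
  have e1 : ∀ z ∈ U, ∀ u, fderiv ℝ T z u = (T z).comp (christoffel G z u)
      - (christoffel G z u).comp (T z) := by
    intro z hz u
    have := hp z hz u
    rw [covDeriv] at this
    rw [← sub_eq_zero, ← this]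
    abel
  -- Differentiate ∂_v T = [T, Γ_v] along u. The left side is symmetric in u, v, and equating the
  -- two orders gives [R(u, v), T] = 0.
  have key : ∀ u v, fderiv ℝ (fderiv ℝ T) y u v w =
      fderiv ℝ T y u (christoffel G y v w) + T y (fderiv ℝ (christoffel G) y u v w)
      - (fderiv ℝ (christoffel G) y u v (T y w) + christoffel G y v (fderiv ℝ T y u w)) := by
    intro u v
    have e := hc.clm_apply (hasFDerivAt_const v y)
    have h1 := hd2.clm_apply (hasFDerivAt_const v y)
    have h2 := (hd.clm_comp e).sub (e.clm_comp hd)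
    have h3 := h1.congr_of_eventuallyEq (f₁ := fun z => (T z).comp (christoffel G z v)
      - (christoffel G z v).comp (T z)) (by
      filter_upwards [hG.isOpen.mem_nhds hy] with z hz using (e1 z hz v).symm)
    have h4 := congrArg (fun L => L u w) (h3.unique h2)
    simp at h4
    rw [h4]
    abel
  have h := key u v
  have h' := key v u
  rw [sndFDeriv_symm hTs v u, h] at h'
  simp only [e1 y hy] at h'
  simp [curvature] at h' ⊢
  rw [← sub_eq_zero] at h' ⊢
  rw [← neg_eq_zero, ← h']
  abel

/-- Pair symmetry turns G(R(Ju,Jv)w, z) into G(R(w,z)Ju, Jv), where J commutes with R(w,z) and is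
then removed by orthogonality. -/
theorem curvature_invariant (hG : IsMetricOn G U) (hJ : IsHermitianOn G J U)
    (hp : ∀ y ∈ U, ∀ u, covDeriv G J y u = 0) {y : F} (hy : y ∈ U) (u v w : F) :
    curvature G y (J y u) (J y v) w = curvature G y u v w := by
  refine hG.ext hy fun z => ?_
  rw [hG.curvature_pair hy, curvature_comm_of_parallel hG hJ.contDiffOn hp hy, hJ.orthogonal y hy,
    ← hG.curvature_pair hy]

/-- Cyclicity of the trace moves J to the left, and there J R(u,v)w = R(u,v)Jw. -/
theorem trace_curvatureLeft_comp (hG : IsMetricOn G U) (hJ : IsHermitianOn G J U)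
    (hp : ∀ y ∈ U, ∀ u, covDeriv G J y u = 0) {y : F} (hy : y ∈ U) (v w : F) :
    LinearMap.trace ℝ F ((curvatureLeft G y v w).comp (J y : F →ₗ[ℝ] F))
      = localRicci G y v (J y w) := by
  rw [localRicci_apply, ← Module.End.mul_eq_comp, LinearMap.trace_mul_comm]
  congr 1
  ext u
  exact (curvature_comm_of_parallel hG hJ.contDiffOn hp hy u v w).symm

/-- Ric(Jv, Jw) is the trace of u ↦ R(Ju, Jv)w, which is R(u, v)w. -/
theorem localRicci_invariant (hG : IsMetricOn G U) (hJ : IsHermitianOn G J U)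
    (hp : ∀ y ∈ U, ∀ u, covDeriv G J y u = 0) {y : F} (hy : y ∈ U) (v w : F) :
    localRicci G y (J y v) (J y w) = localRicci G y v w := by
  rw [← trace_curvatureLeft_comp hG hJ hp hy, localRicci_apply]
  congr 1
  ext u
  exact curvature_invariant hG hJ hp hy u v w

/-- The Ricci form of a Kähler metric is half the trace of `J ∘ R`. -/
theorem trace_comp_curvature (hG : IsMetricOn G U) (hJ : IsHermitianOn G J U)
    (hp : ∀ y ∈ U, ∀ u, covDeriv G J y u = 0) {y : F} (hy : y ∈ U) (v w : F) :
    traceCLM F ((J y).comp (curvature G y v w)) = 2 * localRicci G y (J y v) w := by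
  have h : (((J y).comp (curvature G y v w) : F →L[ℝ] F) : F →ₗ[ℝ] F)
      = (curvatureLeft G y w v).comp (J y : F →ₗ[ℝ] F)
        - (curvatureLeft G y v w).comp (J y : F →ₗ[ℝ] F) := by
    ext u
    -- The first Bianchi identity at (v, w, Ju) reads J R(v,w)u = R(Ju,w)v − R(Ju,v)w. Taking traces
    -- in u gives Ric(w,Jv) − Ric(v,Jw), and both terms equal Ric(Jv,w).
    have h1 := hG.bianchi_one hy v w (J y u)
    rw [curvature_comm_of_parallel hG hJ.contDiffOn hp hy] at h1
    change J y (curvature G y v w u) = curvature G y (J y u) w v - curvature G y (J y u) v w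
    rw [curvature_swap G w (J y u)] at h1
    rw [← sub_eq_zero, ← h1]
    simp
    abel
  have h2 := localRicci_invariant hG hJ hp hy v (J y w)
  rw [hJ.sq y hy, map_neg] at h2
  rw [traceCLM_apply, h, map_sub, trace_curvatureLeft_comp hG hJ hp hy,
    trace_curvatureLeft_comp hG hJ hp hy, hG.localRicci_symm hy w, ← h2]
  ring

theorem contDiffAt_curvature (hG : IsMetricOn G U) {y : F} (hy : y ∈ U) (u v : F) :
    ContDiffAt ℝ ∞ (fun z => curvature G z u v) y := by
  have h := hG.contDiffAt_christoffel hy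
  have h' := contDiffAt_fderiv h
  have e := fun a : F => h.clm_apply (contDiffAt_const (c := a))
  have e2 := fun a b : F => (h'.clm_apply (contDiffAt_const (c := a))).clm_apply
    (contDiffAt_const (c := b))
  exact (((e2 u v).sub (e2 v u)).add ((e u).clm_comp (e v))).sub ((e v).clm_comp (e u))

theorem contDiffAt_localRicci (hG : IsMetricOn G U) {y : F} (hy : y ∈ U) (v w : F) :
    ContDiffAt ℝ ∞ (fun z => localRicci G z v w) y := by
  have h : ContDiffAt ℝ ∞ (fun z => LinearMap.toContinuousLinearMap (curvatureLeft G z v w)) y := by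
    refine contDiffAt_of_clm_apply fun u => ?_
    exact (contDiffAt_curvature hG hy u v).clm_apply contDiffAt_const
  exact (traceCLM F).contDiff.contDiffAt.comp y h

/-- The Ricci form of a Kähler metric is closed. -/
theorem localExtDeriv_ricciForm (hG : IsMetricOn G U) (hJ : IsHermitianOn G J U)
    (hp : ∀ y ∈ U, ∀ u, covDeriv G J y u = 0) {P : F → F →L[ℝ] F →L[ℝ] ℝ} {y : F} (hy : y ∈ U)
    (hPd : DifferentiableAt ℝ P y)
    (hP : ∀ z ∈ U, ∀ v w, P z v w = localRicci G z (J z v) w) (u v w : F) :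
    localExtDeriv P y u v w = 0 := by
  have hd := hJ.differentiableAt hG hy
  -- P(v,w) = tr(J R(v,w))/2. Since ∂_u J = [J, Γ_u], cyclicity of the trace moves the derivative of
  -- J onto R and completes ∂_u R to its commutator form.
  have key : ∀ u v w, fderiv ℝ P y u v w = (1 / 2 : ℝ) * traceCLM F ((J y).comp
      (fderiv ℝ (fun z => curvature G z v w) y u + (christoffel G y u).comp (curvature G y v w)
        - (curvature G y v w).comp (christoffel G y u))) := by
    intro u v w
    have h0 : (fun z => P z v w) =ᶠ[𝓝 y]
        fun z => (1 / 2 : ℝ) * traceCLM F ((J z).comp (curvature G z v w)) := by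
      filter_upwards [hG.isOpen.mem_nhds hy] with z hz
      rw [trace_comp_curvature hG hJ hp hz, hP z hz]
      ring
    have h1 := (((traceCLM F).hasFDerivAt (x := (J y).comp (curvature G y v w))).comp y
      (hd.hasFDerivAt.clm_comp
      (hG.differentiableAt_curvature hy v w).hasFDerivAt)).const_mul (1 / 2 : ℝ)
    have h2 := congrArg (fun L => L u) (h1.congr_of_eventuallyEq h0).fderiv
    rw [← fderiv_clm_apply_const hPd, ← fderiv_clm_apply_const
      (hPd.clm_apply (differentiableAt_const v)), h2]
    have e1 : fderiv ℝ J y u = (J y).comp (christoffel G y u)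
        - (christoffel G y u).comp (J y) := by
      have := hp y hy u
      rw [covDeriv] at this
      rw [← sub_eq_zero, ← this]
      abel
    simp [e1]
    have e2 := traceCLM_comm (christoffel G y u) ((J y).comp (curvature G y v w))
    simp only [ContinuousLinearMap.comp_assoc] at e2 ⊢
    linarith
  have hb : ∀ u v w : F, (fderiv ℝ (fun z => curvature G z v w) y u
      + (christoffel G y u).comp (curvature G y v w)
        - (curvature G y v w).comp (christoffel G y u))
      + (fderiv ℝ (fun z => curvature G z w u) y v
      + (christoffel G y v).comp (curvature G y w u)
        - (curvature G y w u).comp (christoffel G y v))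
      + (fderiv ℝ (fun z => curvature G z u v) y w
      + (christoffel G y w).comp (curvature G y u v)
        - (curvature G y u v).comp (christoffel G y w)) = 0 :=
    fun u v w => ContinuousLinearMap.ext fun a => hG.bianchi_two hy u v w a
  -- Skewness of P turns the middle term of `localExtDeriv` into the missing term of the cyclic sum.
  have hs : fderiv ℝ P y v u w = -fderiv ℝ P y v w u := by
    have h0 : (fun z => P z u w) =ᶠ[𝓝 y] fun z => -P z w u := by
      filter_upwards [hG.isOpen.mem_nhds hy] with z hz
      have h1 := trace_comp_curvature hG hJ hp hz u w
      have h2 := trace_comp_curvature hG hJ hp hz w u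
      rw [curvature_swap, ContinuousLinearMap.comp_neg, map_neg] at h1
      rw [hP z hz, hP z hz]
      linarith
    have e : ∀ a b, fderiv ℝ (fun z => P z a b) y v = fderiv ℝ P y v a b := fun a b => by
      rw [fderiv_clm_apply_const (hPd.clm_apply (differentiableAt_const a)),
        fderiv_clm_apply_const hPd]
    rw [← e u w, ← e w u, h0.fderiv_eq, fderiv_fun_neg]
    rfl
  have h := congrArg (fun T => traceCLM F ((J y).comp T)) (hb u v w)
  simp only [ContinuousLinearMap.comp_add, map_add, ContinuousLinearMap.comp_zero, map_zero] at h
  rw [localExtDeriv, hs, key, key, key]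
  linarith

end LocalKahler

/-! ### Behaviour of connection, curvature and Ricci under local isometries. -/

section Naturality

variable {A : Type*} [NormedAddCommGroup A] [NormedSpace ℝ A]
  {F : Type*} [NormedAddCommGroup F] [NormedSpace ℝ F]

/-- `φ` is a smooth local isometry from `(U, G)` to `(U', G')`. -/
structure IsLocalIsometryOn (φ : A → F) (G : A → A →L[ℝ] A →L[ℝ] ℝ) (U : Set A)
    (G' : F → F →L[ℝ] F →L[ℝ] ℝ) (U' : Set F) : Prop where
  source : IsMetricOn G U
  target : IsMetricOn G' U'
  contDiffOn : ContDiffOn ℝ ∞ φ U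
  mapsTo : Set.MapsTo φ U U'
  bijective : ∀ z ∈ U, Function.Bijective (fderiv ℝ φ z)
  apply_eq : ∀ z ∈ U, ∀ v w, G z v w = G' (φ z) (fderiv ℝ φ z v) (fderiv ℝ φ z w)

/-- The pullback of a field of bilinear forms. -/
noncomputable def pullbackBilin (φ : A → F) (G' : F → F →L[ℝ] F →L[ℝ] ℝ) (z : A) :
    A →L[ℝ] A →L[ℝ] ℝ :=
  (G' (φ z)).bilinearComp (fderiv ℝ φ z) (fderiv ℝ φ z)

theorem contDiffAt_of_clm_apply₂ {B D : Type*} [NormedAddCommGroup B] [NormedSpace ℝ B]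
    [NormedAddCommGroup D] [NormedSpace ℝ D] [FiniteDimensional ℝ A] {n : ℕ∞ω}
    {f : D → A →L[ℝ] A →L[ℝ] B} {x : D}
    (h : ∀ a b, ContDiffAt ℝ n (fun y => f y a b) x) : ContDiffAt ℝ n f x :=
  contDiffAt_of_clm_apply fun a => contDiffAt_of_clm_apply fun b => h a b

theorem contDiffAt_pullbackBilin [FiniteDimensional ℝ A] {φ : A → F}
    {G' : F → F →L[ℝ] F →L[ℝ] ℝ} {z : A} (hφ : ContDiffAt ℝ ∞ φ z)
    (hG : ContDiffAt ℝ ∞ G' (φ z)) : ContDiffAt ℝ ∞ (pullbackBilin φ G') z := by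
  refine contDiffAt_of_clm_apply₂ fun a b => ?_
  have h := contDiffAt_fderiv hφ
  exact ((hG.comp z hφ).clm_apply (h.clm_apply contDiffAt_const)).clm_apply
    (h.clm_apply contDiffAt_const)

theorem IsLocalIsometryOn.pullback [FiniteDimensional ℝ A] {φ : A → F} {U : Set A}
    {G' : F → F →L[ℝ] F →L[ℝ] ℝ} {U' : Set F} (hU : IsOpen U) (hG : IsMetricOn G' U')
    (hφ : ContDiffOn ℝ ∞ φ U) (hm : Set.MapsTo φ U U')
    (hb : ∀ z ∈ U, Function.Bijective (fderiv ℝ φ z)) :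
    IsLocalIsometryOn φ (pullbackBilin φ G') U G' U' where
  source := by
    refine ⟨hU, fun z hz => ?_, fun y hy v w => hG.symm _ (hm hy) _ _, fun y hy v h => ?_⟩
    · exact (contDiffAt_pullbackBilin (hφ.contDiffAt (hU.mem_nhds hz))
        (hG.contDiffAt (hm hz))).contDiffWithinAt
    · refine (hb y hy).1 ?_
      rw [map_zero]
      refine hG.nondeg _ (hm hy) _ fun w => ?_
      obtain ⟨w', rfl⟩ := (hb y hy).2 w
      exact h w'
  target := hG
  contDiffOn := hφ
  mapsTo := hm
  bijective := hb
  apply_eq _ _ _ _ := rfl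

namespace IsLocalIsometryOn

variable {φ : A → F} {G : A → A →L[ℝ] A →L[ℝ] ℝ} {U : Set A}
  {G' : F → F →L[ℝ] F →L[ℝ] ℝ} {U' : Set F}

theorem contDiffAt (h : IsLocalIsometryOn φ G U G' U') {y : A} (hy : y ∈ U) :
    ContDiffAt ℝ ∞ φ y :=
  h.contDiffOn.contDiffAt (h.source.isOpen.mem_nhds hy)

theorem hasFDerivAt (h : IsLocalIsometryOn φ G U G' U') {y : A} (hy : y ∈ U) :
    HasFDerivAt φ (fderiv ℝ φ y) y :=
  ((h.contDiffAt hy).differentiableAt (by simp)).hasFDerivAt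

theorem hasFDerivAt_fderiv (h : IsLocalIsometryOn φ G U G' U') {y : A} (hy : y ∈ U) :
    HasFDerivAt (fderiv ℝ φ) (fderiv ℝ (fderiv ℝ φ) y) y :=
  ((contDiffAt_fderiv (h.contDiffAt hy)).differentiableAt (by simp)).hasFDerivAt

variable [FiniteDimensional ℝ A] [FiniteDimensional ℝ F]

/-- The right side, pulled back by dφ, is symmetric and compatible with G, so uniqueness of the
Levi-Civita connection identifies it. -/
theorem christoffel_apply (h : IsLocalIsometryOn φ G U G' U') {y : A} (hy : y ∈ U) (u v : A) :
    fderiv ℝ φ y (christoffel G y u v) = fderiv ℝ (fderiv ℝ φ) y u v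
      + christoffel G' (φ y) (fderiv ℝ φ y u) (fderiv ℝ φ y v) := by
  let e := LinearEquiv.ofBijective (fderiv ℝ φ y : A →ₗ[ℝ] F) (h.bijective y hy)
  have he : ∀ a, fderiv ℝ φ y (e.symm a) = a := e.apply_symm_apply
  have hy' := h.mapsTo hy
  rw [h.source.eq_christoffel hy (fun u v => e.symm (fderiv ℝ (fderiv ℝ φ) y u v
      + christoffel G' (φ y) (fderiv ℝ φ y u) (fderiv ℝ φ y v))), he]
  · intro u v
    rw [sndFDeriv_symm (h.contDiffAt hy), h.target.christoffel_symm hy']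
  · intro u v w
    have hG := (h.source.differentiableAt hy).hasFDerivAt
    have hG' := (h.target.differentiableAt hy').hasFDerivAt
    have h1 := (hG.clm_apply (hasFDerivAt_const v y)).clm_apply (hasFDerivAt_const w y)
    have e2 := fun a => (h.hasFDerivAt_fderiv hy).clm_apply (hasFDerivAt_const a y)
    have h2 := ((hG'.comp y (h.hasFDerivAt hy)).clm_apply (e2 v)).clm_apply (e2 w)
    have h3 := h2.congr_of_eventuallyEq (f₁ := fun z => G z v w) (by
      filter_upwards [h.source.isOpen.mem_nhds hy] with z hz using h.apply_eq z hz v w)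
    have h4 := congrArg (fun L => L u) (h1.unique h3)
    simp at h4
    rw [h.apply_eq y hy, h.apply_eq y hy, he, he, h4, h.target.compat hy']
    simp
    ring

/-- Differentiate the transformation law of Γ and antisymmetrize: the third derivatives of φ cancel,
and the second ones are absorbed by the law itself. -/
theorem curvature_apply (h : IsLocalIsometryOn φ G U G' U') {y : A} (hy : y ∈ U) (u v w : A) :
    fderiv ℝ φ y (curvature G y u v w)
      = curvature G' (φ y) (fderiv ℝ φ y u) (fderiv ℝ φ y v) (fderiv ℝ φ y w) := by
  have hy' := h.mapsTo hy
  have hc := (h.source.differentiableAt_christoffel hy).hasFDerivAt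
  have hc' := (h.target.differentiableAt_christoffel hy').hasFDerivAt
  have hφ := h.hasFDerivAt hy
  have hφ2 := h.hasFDerivAt_fderiv hy
  have hs := contDiffAt_fderiv (h.contDiffAt hy)
  have hφ3 := ((contDiffAt_fderiv hs).differentiableAt (by simp)).hasFDerivAt
  have key : ∀ u v, fderiv ℝ (fderiv ℝ φ) y u (christoffel G y v w)
      + fderiv ℝ φ y (fderiv ℝ (christoffel G) y u v w)
      = fderiv ℝ (fderiv ℝ (fderiv ℝ φ)) y u v w
      + (fderiv ℝ (christoffel G') (φ y) (fderiv ℝ φ y u) (fderiv ℝ φ y v) (fderiv ℝ φ y w)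
      + christoffel G' (φ y) (fderiv ℝ (fderiv ℝ φ) y u v) (fderiv ℝ φ y w)
      + christoffel G' (φ y) (fderiv ℝ φ y v) (fderiv ℝ (fderiv ℝ φ) y u w)) := by
    intro u v
    have e1 := hφ2.clm_apply ((hc.clm_apply (hasFDerivAt_const v y)).clm_apply
      (hasFDerivAt_const w y))
    have e2 := fun a => hφ2.clm_apply (hasFDerivAt_const a y)
    have e3 := ((hφ3.clm_apply (hasFDerivAt_const v y)).clm_apply (hasFDerivAt_const w y)).add
      (((hc'.comp y hφ).clm_apply (e2 v)).clm_apply (e2 w))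
    have e4 := e3.congr_of_eventuallyEq (f₁ := fun z => fderiv ℝ φ z (christoffel G z v w)) (by
      filter_upwards [h.source.isOpen.mem_nhds hy] with z hz using h.christoffel_apply hz v w)
    have e5 := congrArg (fun L => L u) (e1.unique e4)
    simp at e5
    rw [add_comm, e5]
    abel
  have k1 := key u v
  have k2 := key v u
  rw [sndFDeriv_symm hs v u, sndFDeriv_symm (h.contDiffAt hy) v u] at k2
  have k3 := congrArg₂ (· - ·) k1 k2
  simp only [curvature]
  simp only [add_apply, sub_apply, ContinuousLinearMap.comp_apply, map_add, map_sub,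
    h.christoffel_apply hy] at k3 ⊢
  rw [← sub_eq_zero] at k3 ⊢
  rw [← k3]
  abel

theorem localRicci_apply (h : IsLocalIsometryOn φ G U G' U') {y : A} (hy : y ∈ U) (v w : A) :
    localRicci G y v w = localRicci G' (φ y) (fderiv ℝ φ y v) (fderiv ℝ φ y w) := by
  let e := LinearEquiv.ofBijective (fderiv ℝ φ y : A →ₗ[ℝ] F) (h.bijective y hy)
  rw [KahlerGeometry.localRicci_apply, KahlerGeometry.localRicci_apply,
    ← LinearMap.trace_conj' (curvatureLeft G y v w) e]
  congr 1
  ext a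
  obtain ⟨u, rfl⟩ := e.surjective a
  rw [LinearEquiv.conj_apply_apply, e.symm_apply_apply]
  exact h.curvature_apply hy u v w

/-- Differentiate dφ ∘ T = T' ∘ dφ; the second derivatives of φ are those in the transformation law
of Γ. The relation is needed near y, as it is differentiated. -/
theorem covDeriv_apply (h : IsLocalIsometryOn φ G U G' U') {y : A} (hy : y ∈ U)
    {T : A → A →L[ℝ] A} {T' : F → F →L[ℝ] F} (hT : DifferentiableAt ℝ T y)
    (hT' : DifferentiableAt ℝ T' (φ y))
    (hTT' : ∀ᶠ z in 𝓝 y, ∀ v, fderiv ℝ φ z (T z v) = T' (φ z) (fderiv ℝ φ z v)) (u v : A) :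
    fderiv ℝ φ y (covDeriv G T y u v)
      = covDeriv G' T' (φ y) (fderiv ℝ φ y u) (fderiv ℝ φ y v) := by
  have hφ := h.hasFDerivAt hy
  have hφ2 := h.hasFDerivAt_fderiv hy
  have e1 := hφ2.clm_apply (hT.hasFDerivAt.clm_apply (hasFDerivAt_const v y))
  have e2 := (hT'.hasFDerivAt.comp y hφ).clm_apply (hφ2.clm_apply (hasFDerivAt_const v y))
  have e4 := e2.congr_of_eventuallyEq (f₁ := fun z => fderiv ℝ φ z (T z v)) (by
    filter_upwards [hTT'] with z hz using hz v)
  have e5 := congrArg (fun L => L u) (e1.unique e4)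
  simp at e5
  simp only [covDeriv]
  simp only [add_apply, sub_apply, ContinuousLinearMap.comp_apply, map_add, map_sub,
    h.christoffel_apply hy, hTT'.self_of_nhds] at e5 ⊢
  rw [← sub_eq_zero] at e5 ⊢
  rw [← e5]
  abel

end IsLocalIsometryOn

end Naturality

/-! ### Product metrics. -/

section Product

variable {A : Type*} [NormedAddCommGroup A] [NormedSpace ℝ A]
  {B : Type*} [NormedAddCommGroup B] [NormedSpace ℝ B]

/-- The product of two metrics. -/
noncomputable def prodMetric (G₁ : A → A →L[ℝ] A →L[ℝ] ℝ) (G₂ : B → B →L[ℝ] B →L[ℝ] ℝ)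
    (z : A × B) : (A × B) →L[ℝ] (A × B) →L[ℝ] ℝ :=
  (G₁ z.1).bilinearComp (ContinuousLinearMap.fst ℝ A B) (ContinuousLinearMap.fst ℝ A B)
    + (G₂ z.2).bilinearComp (ContinuousLinearMap.snd ℝ A B) (ContinuousLinearMap.snd ℝ A B)

variable {G₁ : A → A →L[ℝ] A →L[ℝ] ℝ} {G₂ : B → B →L[ℝ] B →L[ℝ] ℝ} {U₁ : Set A} {U₂ : Set B}

theorem prodMetric_apply (z v w : A × B) :
    prodMetric G₁ G₂ z v w = G₁ z.1 v.1 w.1 + G₂ z.2 v.2 w.2 := rfl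

variable [FiniteDimensional ℝ A] [FiniteDimensional ℝ B]

theorem IsMetricOn.prod (h₁ : IsMetricOn G₁ U₁) (h₂ : IsMetricOn G₂ U₂) :
    IsMetricOn (prodMetric G₁ G₂) (U₁ ×ˢ U₂) where
  isOpen := h₁.isOpen.prod h₂.isOpen
  contDiffOn := by
    refine fun z hz => (contDiffAt_of_clm_apply₂ fun a b => ?_).contDiffWithinAt
    have e1 := ((h₁.contDiffAt hz.1).comp z contDiffAt_fst).clm_apply
      (contDiffAt_const (c := a.1)) |>.clm_apply (contDiffAt_const (c := b.1))
    have e2 := ((h₂.contDiffAt hz.2).comp z contDiffAt_snd).clm_apply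
      (contDiffAt_const (c := a.2)) |>.clm_apply (contDiffAt_const (c := b.2))
    exact e1.add e2
  symm y hy v w := by
    rw [prodMetric_apply, prodMetric_apply, h₁.symm _ hy.1, h₂.symm _ hy.2]
  nondeg y hy v h := by
    refine Prod.ext (h₁.nondeg _ hy.1 _ fun w => ?_) (h₂.nondeg _ hy.2 _ fun w => ?_)
    · simpa [prodMetric_apply] using h (w, 0)
    · simpa [prodMetric_apply] using h (0, w)

/-- Uniqueness again: the componentwise connection is symmetric and compatible with the product
metric. -/
theorem christoffel_prod (h₁ : IsMetricOn G₁ U₁) (h₂ : IsMetricOn G₂ U₂) {z : A × B}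
    (hz : z ∈ U₁ ×ˢ U₂) (u v : A × B) :
    christoffel (prodMetric G₁ G₂) z u v
      = (christoffel G₁ z.1 u.1 v.1, christoffel G₂ z.2 u.2 v.2) := by
  refine (h₁.prod h₂).eq_christoffel hz (fun u v => (christoffel G₁ z.1 u.1 v.1,
    christoffel G₂ z.2 u.2 v.2)) (fun u v => ?_) (fun u v w => ?_) u v
  · rw [h₁.christoffel_symm hz.1, h₂.christoffel_symm hz.2]
  · have hd := ((h₁.prod h₂).differentiableAt hz).hasFDerivAt
    have e := (hd.clm_apply (hasFDerivAt_const v z)).clm_apply (hasFDerivAt_const w z)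
    have e1 := (((h₁.differentiableAt hz.1).hasFDerivAt.comp z hasFDerivAt_fst).clm_apply
      (hasFDerivAt_const v.1 z)).clm_apply (hasFDerivAt_const w.1 z)
    have e2 := (((h₂.differentiableAt hz.2).hasFDerivAt.comp z hasFDerivAt_snd).clm_apply
      (hasFDerivAt_const v.2 z)).clm_apply (hasFDerivAt_const w.2 z)
    have e3 := congrArg (fun L => L u) (e.unique (e1.add e2))
    simp at e3
    rw [e3, h₁.compat hz.1, h₂.compat hz.2]
    simp only [prodMetric_apply]
    ring

theorem curvature_prod (h₁ : IsMetricOn G₁ U₁) (h₂ : IsMetricOn G₂ U₂) {z : A × B}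
    (hz : z ∈ U₁ ×ˢ U₂) (u v w : A × B) :
    curvature (prodMetric G₁ G₂) z u v w
      = (curvature G₁ z.1 u.1 v.1 w.1, curvature G₂ z.2 u.2 v.2 w.2) := by
  have key : ∀ u v, fderiv ℝ (christoffel (prodMetric G₁ G₂)) z u v w
      = (fderiv ℝ (christoffel G₁) z.1 u.1 v.1 w.1,
        fderiv ℝ (christoffel G₂) z.2 u.2 v.2 w.2) := by
    intro u v
    have hd := ((h₁.prod h₂).differentiableAt_christoffel hz).hasFDerivAt
    have e := (hd.clm_apply (hasFDerivAt_const v z)).clm_apply (hasFDerivAt_const w z)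
    have e1 := (((h₁.differentiableAt_christoffel hz.1).hasFDerivAt.comp z
      hasFDerivAt_fst).clm_apply (hasFDerivAt_const v.1 z)).clm_apply (hasFDerivAt_const w.1 z)
    have e2 := (((h₂.differentiableAt_christoffel hz.2).hasFDerivAt.comp z
      hasFDerivAt_snd).clm_apply (hasFDerivAt_const v.2 z)).clm_apply (hasFDerivAt_const w.2 z)
    have e4 := (e1.prodMk e2).congr_of_eventuallyEq
      (f₁ := fun z => christoffel (prodMetric G₁ G₂) z v w) (by
      filter_upwards [(h₁.prod h₂).isOpen.mem_nhds hz] with z hz using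
        christoffel_prod h₁ h₂ hz v w)
    have e3 := congrArg (fun L => L u) (e.unique e4)
    simpa using e3
  simp only [curvature]
  simp only [add_apply, sub_apply, ContinuousLinearMap.comp_apply, key, christoffel_prod h₁ h₂ hz,
    Prod.mk_add_mk, Prod.mk_sub_mk]

/-- The Ricci tensor of a product metric is the sum of the Ricci tensors of the factors. -/
theorem localRicci_prod (h₁ : IsMetricOn G₁ U₁) (h₂ : IsMetricOn G₂ U₂) {z : A × B}
    (hz : z ∈ U₁ ×ˢ U₂) (v w : A × B) :
    localRicci (prodMetric G₁ G₂) z v w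
      = localRicci G₁ z.1 v.1 w.1 + localRicci G₂ z.2 v.2 w.2 := by
  simp only [localRicci_apply]
  rw [← LinearMap.trace_prodMap']
  congr 1
  refine LinearMap.ext fun u => ?_
  exact curvature_prod h₁ h₂ hz u v w

end Product

/-! ### Calculus in the Banach space of continuous paths. -/

section Superposition

universe u

variable {F : Type u} [NormedAddCommGroup F] [NormedSpace ℝ F]

/-- Pointwise evaluation of a path of linear maps on a path of vectors. -/
noncomputable def pathEval (F B : Type*) [NormedAddCommGroup F] [NormedSpace ℝ F]
    [NormedAddCommGroup B] [NormedSpace ℝ B] :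
    C(unitInterval, F →L[ℝ] B) →L[ℝ] C(unitInterval, F) →L[ℝ] C(unitInterval, B) :=
  LinearMap.mkContinuous₂
    (LinearMap.mk₂ ℝ (fun φ h => (⟨fun t => φ t (h t), by fun_prop⟩ : C(unitInterval, B)))
      (fun _ _ _ => by ext t; simp) (fun _ _ _ => by ext t; simp)
      (fun _ _ _ => by ext t; simp) (fun _ _ _ => by ext t; simp)) 1 (by
    intro φ h
    rw [ContinuousMap.norm_le _ (by positivity)]
    intro t
    refine ((φ t).le_opNorm (h t)).trans ?_
    rw [one_mul]
    exact mul_le_mul (φ.norm_coe_le_norm t) (h.norm_coe_le_norm t) (norm_nonneg _) (norm_nonneg _))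

theorem pathEval_apply {B : Type*} [NormedAddCommGroup B] [NormedSpace ℝ B]
    (φ : C(unitInterval, F →L[ℝ] B)) (h : C(unitInterval, F)) (t : unitInterval) :
    pathEval F B φ h t = φ t (h t) := rfl

theorem norm_pathEval_le {B : Type*} [NormedAddCommGroup B] [NormedSpace ℝ B]
    (φ : C(unitInterval, F →L[ℝ] B)) (h : C(unitInterval, F)) :
    ‖pathEval F B φ h‖ ≤ ‖φ‖ * ‖h‖ := by
  rw [ContinuousMap.norm_le _ (by positivity)]
  intro t
  refine ((φ t).le_opNorm (h t)).trans ?_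
  exact mul_le_mul (φ.norm_coe_le_norm t) (h.norm_coe_le_norm t) (norm_nonneg _) (norm_nonneg _)

/-- The constant path, as a continuous linear map. -/
noncomputable def constPath (F : Type*) [NormedAddCommGroup F] [NormedSpace ℝ F] :
    F →L[ℝ] C(unitInterval, F) :=
  LinearMap.mkContinuous
    { toFun := fun a => ContinuousMap.const _ a
      map_add' := fun _ _ => rfl
      map_smul' := fun _ _ => rfl } 1 (by
    intro a
    rw [ContinuousMap.norm_le _ (by positivity)]
    intro t
    exact (one_mul ‖a‖).ge)

theorem constPath_apply (a : F) (t : unitInterval) : constPath F a t = a := rfl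

theorem norm_constPath_le (a : F) : ‖constPath F a‖ ≤ ‖a‖ := by
  rw [ContinuousMap.norm_le _ (by positivity)]
  intro t
  simp [constPath_apply]

theorem intervalIntegrable_proj {F : Type*} [NormedAddCommGroup F]
    (h : C(unitInterval, F)) (a b : ℝ) :
    IntervalIntegrable (fun s => h (Set.projIcc 0 1 zero_le_one s)) MeasureTheory.volume a b :=
  (h.continuous.comp continuous_projIcc).intervalIntegrable a b

/-- The path of primitives of a path. -/
noncomputable def primitive (F : Type*) [NormedAddCommGroup F] [NormedSpace ℝ F] :
    C(unitInterval, F) →L[ℝ] C(unitInterval, F) :=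
  LinearMap.mkContinuous
    { toFun := fun h => ⟨fun t => ∫ s in (0 : ℝ)..t, h (Set.projIcc 0 1 zero_le_one s),
        (intervalIntegral.continuous_primitive (intervalIntegrable_proj h) 0).comp
          continuous_subtype_val⟩
      map_add' := fun h k => by
        ext t
        exact intervalIntegral.integral_add (intervalIntegrable_proj h 0 t)
          (intervalIntegrable_proj k 0 t)
      map_smul' := fun c h => by
        ext t
        exact intervalIntegral.integral_smul c _ } 1 (by
    intro h
    rw [ContinuousMap.norm_le _ (by positivity)]
    intro t
    refine (intervalIntegral.norm_integral_le_of_norm_le_const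
      (fun s _ => h.norm_coe_le_norm _)).trans ?_
    rw [one_mul, sub_zero, abs_of_nonneg t.2.1]
    exact mul_le_of_le_one_right (norm_nonneg _) t.2.2)

theorem primitive_apply (h : C(unitInterval, F)) (t : unitInterval) :
    primitive F h t = ∫ s in (0 : ℝ)..t, h (Set.projIcc 0 1 zero_le_one s) := rfl

theorem norm_primitive_le (h : C(unitInterval, F)) : ‖primitive F h‖ ≤ ‖h‖ := by
  have := (primitive F).le_of_opNorm_le (LinearMap.mkContinuous_norm_le _ zero_le_one _) h
  simpa using this

/-- The mean value inequality is applied at each time. The bound is uniform in time because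
postcomposition with `fderiv ℝ f` is continuous for the sup norm. -/
theorem hasFDerivAt_superposition {B : Type*} [NormedAddCommGroup B] [NormedSpace ℝ B]
    {f : F → B} (hf : ContDiff ℝ 1 f) (γ : C(unitInterval, F)) :
    HasFDerivAt (fun γ : C(unitInterval, F) =>
        (ContinuousMap.comp ⟨f, hf.continuous⟩ γ : C(unitInterval, B)))
      (pathEval F B (ContinuousMap.comp ⟨fderiv ℝ f, hf.continuous_fderiv (by simp)⟩ γ)) γ := by
  set N : C(unitInterval, F) → C(unitInterval, F →L[ℝ] B) :=
    fun γ => ContinuousMap.comp ⟨fderiv ℝ f, hf.continuous_fderiv (by simp)⟩ γ with hN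
  have hNc : Continuous N := ContinuousMap.continuous_postcomp _
  rw [hasFDerivAt_iff_isLittleO_nhds_zero, Asymptotics.isLittleO_iff]
  intro c hc
  obtain ⟨δ, hδ, h⟩ := Metric.continuousAt_iff.1 (hNc.continuousAt (x := γ)) c hc
  filter_upwards [Metric.ball_mem_nhds 0 hδ] with k hk
  rw [ContinuousMap.norm_le _ (by positivity)]
  intro t
  have hseg : ∀ x ∈ segment ℝ (γ t) (γ t + k t), ‖fderiv ℝ f x - fderiv ℝ f (γ t)‖ ≤ c := by
    intro x hx
    rw [segment_eq_image'] at hx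
    obtain ⟨s, hs, rfl⟩ := hx
    have h1 : dist (γ + s • k) γ < δ := by
      rw [dist_eq_norm, add_sub_cancel_left, norm_smul, Real.norm_of_nonneg hs.1]
      refine lt_of_le_of_lt (mul_le_of_le_one_left (norm_nonneg _) hs.2) ?_
      simpa using hk
    have h2 := (h h1).le
    rw [dist_eq_norm] at h2
    have h3 := (ContinuousMap.norm_coe_le_norm (N (γ + s • k) - N γ) t).trans h2
    simpa [hN] using h3
  have h4 := (convex_segment (γ t) (γ t + k t)).norm_image_sub_le_of_norm_hasFDerivWithin_le'
    (f := f) (f' := fderiv ℝ f) (φ := fderiv ℝ f (γ t)) (C := c)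
    (fun x _ => ((hf.differentiable (by simp)) x).hasFDerivAt.hasFDerivWithinAt) hseg
    (left_mem_segment ℝ _ _) (right_mem_segment ℝ _ _)
  rw [add_sub_cancel_left] at h4
  exact h4.trans (mul_le_mul_of_nonneg_left (k.norm_coe_le_norm t) hc.le)

/-- The superposition operator of a smooth map is smooth. -/
theorem contDiff_superposition_nat (n : ℕ) : ∀ {B : Type u} [NormedAddCommGroup B]
    [NormedSpace ℝ B] {f : F → B} (hf : ContDiff ℝ ∞ f),
    ContDiff ℝ n (fun γ : C(unitInterval, F) =>
        (ContinuousMap.comp ⟨f, hf.continuous⟩ γ : C(unitInterval, B))) := by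
  -- The induction step applies to `fderiv ℝ f`, with values in `F →L[ℝ] B`. Hence B varies in the
  -- induction, and F and B share a universe.
  induction n with
  | zero =>
    intro B _ _ f hf
    exact contDiff_zero.2 (ContinuousMap.continuous_postcomp _)
  | succ n ih =>
    intro B _ _ f hf
    have hf' : ContDiff ℝ ∞ (fderiv ℝ f) := hf.fderiv_right (by norm_num)
    refine contDiff_succ_iff_hasFDerivAt.2 ⟨_, (pathEval F B).contDiff.comp (ih hf'), fun γ => ?_⟩
    exact hasFDerivAt_superposition (hf.of_le (by
      exact WithTop.coe_le_coe.2 (le_top : (1 : ℕ∞) ≤ ⊤))) γ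

theorem contDiff_superposition {B : Type u} [NormedAddCommGroup B]
    [NormedSpace ℝ B] {f : F → B} (hf : ContDiff ℝ ∞ f) :
    ContDiff ℝ ∞ (fun γ : C(unitInterval, F) =>
        (ContinuousMap.comp ⟨f, hf.continuous⟩ γ : C(unitInterval, B))) :=
  contDiff_infty.2 fun n => contDiff_superposition_nat n hf

end Superposition

/-! ### Inverse and implicit functions that are smooth on a neighbourhood. -/

section Inverse

variable {A B C : Type*} [NormedAddCommGroup A] [NormedSpace ℝ A] [CompleteSpace A]
  [NormedAddCommGroup B] [NormedSpace ℝ B] [NormedAddCommGroup C] [NormedSpace ℝ C]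

theorem eventually_isInvertible {L : A →L[ℝ] B} (hL : L.IsInvertible) :
    ∀ᶠ L' in 𝓝 L, L'.IsInvertible := by
  obtain ⟨e, rfl⟩ := hL
  exact e.nhds

/-- The local inverse of a smooth map is smooth near the point, not just at the point. -/
theorem eventually_contDiffAt_localInverse {f : A → B} {f' : A ≃L[ℝ] B} {a : A}
    (hf : ∀ᶠ x in 𝓝 a, ContDiffAt ℝ ∞ f x) (hf' : HasFDerivAt f (f' : A →L[ℝ] B) a) :
    ∀ᶠ y in 𝓝 (f a), ContDiffAt ℝ ∞ (hf.self_of_nhds.localInverse hf' (by simp)) y := by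
  -- `ContDiffAt ℝ ∞` at one point allows the neighbourhood to shrink with the order, so smoothness
  -- at nearby points needs invertibility of the derivative at each of them.
  set e := hf.self_of_nhds.toOpenPartialHomeomorph f hf' (by simp) with he
  have hea : e a = f a := rfl
  have has : a ∈ e.source := hf.self_of_nhds.mem_toOpenPartialHomeomorph_source hf' (by simp)
  have hinv : ∀ᶠ x in 𝓝 a, (fderiv ℝ f x).IsInvertible := by
    have h1 : ContinuousAt (fderiv ℝ f) a :=
      (hf.self_of_nhds.fderiv_right (m := 0) (by simp)).continuousAt
    refine h1.eventually (eventually_isInvertible ?_)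
    rw [hf'.fderiv]
    exact ContinuousLinearMap.isInvertible_equiv
  have ht : Filter.Tendsto e.symm (𝓝 (f a)) (𝓝 a) := by
    have := e.tendsto_symm has
    rwa [hea] at this
  filter_upwards [ht.eventually hf, ht.eventually hinv, e.open_target.mem_nhds
    (e.map_source has)] with y h1 h2 h3
  obtain ⟨L, hL⟩ := h2
  refine e.contDiffAt_symm h3 (f₀' := L) ?_ h1
  rw [hL]
  exact (h1.differentiableAt (by simp)).hasFDerivAt

/-- The implicit function of a smooth map is smooth near the point, not just at the point. -/
theorem eventually_contDiffAt_implicitFunction [CompleteSpace B] [CompleteSpace C]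
    {f : A × B → C} (hf : ContDiff ℝ ∞ f) {u : A × B}
    (h : (fderiv ℝ f u ∘L .inr ℝ A B).IsInvertible) :
    ∀ᶠ x in 𝓝 u.1, ContDiffAt ℝ ∞ (hf.contDiffAt.implicitFunction (by simp) h) x := by
  set γ := hf.contDiffAt.implicitFunction (by simp) h with hγ
  have hγs : ContDiffAt ℝ ∞ γ u.1 := hf.contDiffAt.contDiffAt_implicitFunction (by simp) h
  have hγu : (u.1, γ u.1) = u :=
    Prod.ext rfl (hf.contDiffAt.implicitFunction_apply_self (by simp) h)
  have hc : ∀ᶠ x in 𝓝 u.1, ContinuousAt γ x := by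
    have := (hγs.of_le (m := 1) (WithTop.coe_le_coe.2 (le_top : (1 : ℕ∞) ≤ ⊤))).eventually
      (by simp)
    filter_upwards [this] with x hx using hx.continuousAt
  have hinv : ∀ᶠ x in 𝓝 u.1, (fderiv ℝ f (x, γ x) ∘L .inr ℝ A B).IsInvertible := by
    have h1 : ContinuousAt (fun x => fderiv ℝ f (x, γ x) ∘L .inr ℝ A B) u.1 :=
      (((hf.continuous_fderiv (by simp)).continuousAt).comp
        (continuousAt_id.prodMk hγs.continuousAt)).clm_comp continuousAt_const
    refine h1.eventually (eventually_isInvertible ?_)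
    dsimp only
    rwa [hγu]
  filter_upwards [hc.eventually_nhds, hinv,
    (hf.contDiffAt.eventually_apply_implicitFunction (by simp) h).eventually_nhds] with x h1 h2 h3
  -- By local uniqueness γ agrees near x with the implicit function based at (x, γ x), which is
  -- smooth at x.
  refine (hf.contDiffAt.contDiffAt_implicitFunction (by simp) h2).congr_of_eventuallyEq ?_
  have h4 : Filter.Tendsto (fun x' => (x', γ x')) (𝓝 x) (𝓝 (x, γ x)) :=
    continuousAt_id.prodMk h1.self_of_nhds
  filter_upwards [h3, h4.eventually
    (hf.contDiffAt.eventually_apply_eq_iff_implicitFunction (by simp) h2)] with x' h5 h6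
  exact (h6.1 (h5.trans h3.self_of_nhds.symm)).symm

end Inverse

/-! ### Joint flow of commuting vector fields. -/

section CommutingFlow

variable {F : Type*} [NormedAddCommGroup F] [NormedSpace ℝ F]

/-- The integral equation of the integral curves `γ' = S(γ) a`, `γ(0) = y`. -/
noncomputable def flowEquation (S : F → F →L[ℝ] F) (hS : Continuous S)
    (q : (F × F) × C(unitInterval, F)) : C(unitInterval, F) :=
  q.2 - constPath F q.1.2
    - primitive F (pathEval F F (ContinuousMap.comp ⟨S, hS⟩ q.2) (constPath F q.1.1))

theorem contDiff_flowEquation {S : F → F →L[ℝ] F} (hS : ContDiff ℝ ∞ S) :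
    ContDiff ℝ ∞ (flowEquation S hS.continuous) := by
  unfold flowEquation
  have h1 : ContDiff ℝ ∞ fun q : (F × F) × C(unitInterval, F) =>
      (ContinuousMap.comp ⟨S, hS.continuous⟩ q.2 : C(unitInterval, F →L[ℝ] F)) :=
    (contDiff_superposition hS).comp contDiff_snd
  have h2 : ContDiff ℝ ∞ fun q : (F × F) × C(unitInterval, F) => constPath F q.1.1 :=
    (constPath F).contDiff.comp (contDiff_fst.comp contDiff_fst)
  have h3 : ContDiff ℝ ∞ fun q : (F × F) × C(unitInterval, F) => constPath F q.1.2 :=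
    (constPath F).contDiff.comp (contDiff_snd.comp contDiff_fst)
  exact (contDiff_snd.sub h3).sub
    ((primitive F).contDiff.comp (((pathEval F F).contDiff.comp h1).clm_apply h2))

theorem fderiv_flowEquation {S : F → F →L[ℝ] F} (hS : ContDiff ℝ ∞ S)
    (q : (F × F) × C(unitInterval, F)) (q' : (F × F) × C(unitInterval, F)) :
    fderiv ℝ (flowEquation S hS.continuous) q q' = q'.2 - constPath F q'.1.2
      - primitive F (pathEval F F (pathEval F (F →L[ℝ] F) (ContinuousMap.comp ⟨fderiv ℝ S,
          hS.continuous_fderiv (by simp)⟩ q.2) q'.2) (constPath F q.1.1)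
        + pathEval F F (ContinuousMap.comp ⟨S, hS.continuous⟩ q.2) (constPath F q'.1.1)) := by
  have h1 := (hasFDerivAt_superposition (hS.of_le (by
      exact WithTop.coe_le_coe.2 (le_top : (1 : ℕ∞) ≤ ⊤))) q.2).comp q hasFDerivAt_snd
  have h2 := ((constPath F).hasFDerivAt (x := q.1.1)).comp q
    ((hasFDerivAt_fst (𝕜 := ℝ) (p := q.1)).comp q hasFDerivAt_fst)
  have h3 := ((constPath F).hasFDerivAt (x := q.1.2)).comp q
    ((hasFDerivAt_snd (𝕜 := ℝ) (p := q.1)).comp q hasFDerivAt_fst)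
  have h4 := ((pathEval F F).hasFDerivAt.comp q h1).clm_apply h2
  have h5 := (hasFDerivAt_snd (𝕜 := ℝ) (p := q)).sub h3 |>.sub
    ((primitive F).hasFDerivAt.comp q h4)
  refine (congrArg (fun L => L q') h5.fderiv).trans ?_
  simp
  abel

/-- A family of vector fields `x ↦ S x a`, linear in `a`, that commute near `x₀`, is generated
near `x₀` by an action `ψ` of the vector group. -/
theorem exists_commuting_flow_of_contDiff [CompleteSpace F] (S : F → F →L[ℝ] F)
    (hS : ContDiff ℝ ∞ S) (x₀ : F)
    (hcomm : ∀ᶠ x in 𝓝 x₀, ∀ a b, fderiv ℝ S x (S x a) b = fderiv ℝ S x (S x b) a) :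
    ∃ ψ : F × F → F, (∀ᶠ p in 𝓝 ((0 : F), x₀), ContDiffAt ℝ ∞ ψ p) ∧ (∀ᶠ y in 𝓝 x₀, ψ (0, y) = y) ∧
      ∀ᶠ p in 𝓝 ((0 : F), x₀), ∀ b, fderiv ℝ ψ p (b, 0) = S (ψ p) b := by
  set Ξ := flowEquation S hS.continuous with hΞ
  set q₀ : (F × F) × C(unitInterval, F) := ((0, x₀), constPath F x₀) with hq₀
  have hΞs : ContDiffAt ℝ ∞ Ξ q₀ := (contDiff_flowEquation hS).contDiffAt
  have hΞ0 : Ξ q₀ = 0 := by simp [hΞ, hq₀, flowEquation]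
  -- At a = 0 the integral term does not depend on the path, so the partial derivative in the path
  -- is the identity.
  have hinv : (fderiv ℝ Ξ q₀ ∘L .inr ℝ (F × F) C(unitInterval, F)).IsInvertible := by
    have : fderiv ℝ Ξ q₀ ∘L .inr ℝ (F × F) C(unitInterval, F) = ContinuousLinearMap.id ℝ _ := by
      ext1 h
      simp [hΞ, fderiv_flowEquation hS, hq₀]
    rw [this]
    exact ContinuousLinearMap.isInvertible_equiv (f := ContinuousLinearEquiv.refl ℝ _)
  set γ := hΞs.implicitFunction (by simp) hinv with hγ
  have hγE : ∀ᶠ p in 𝓝 ((0 : F), x₀), ContDiffAt ℝ ∞ γ p :=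
    eventually_contDiffAt_implicitFunction (contDiff_flowEquation hS) hinv
  have hγs : ContDiffAt ℝ ∞ γ (0, x₀) := hγE.self_of_nhds
  have hγ0 : γ (0, x₀) = constPath F x₀ := hΞs.implicitFunction_apply_self (by simp) hinv
  have hγe : ∀ᶠ p in 𝓝 ((0 : F), x₀), Ξ (p, γ p) = 0 := by
    have := hΞs.eventually_apply_implicitFunction (by simp) hinv
    rwa [hΞ0] at this
  have hγd : ∀ᶠ p in 𝓝 ((0 : F), x₀), DifferentiableAt ℝ γ p := by
    filter_upwards [hγE] with p hp using hp.differentiableAt (by simp)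
  -- ψ(a, y) is the value at time 1 of the curve with γ' = S(γ)a and γ(0) = y; small times are
  -- replaced by small a.
  let ev : C(unitInterval, F) →L[ℝ] F := ContinuousMap.evalCLM ℝ (1 : unitInterval)
  refine ⟨fun p => ev (γ p), ?_, ?_, ?_⟩
  · filter_upwards [hγE] with p hp using ev.contDiff.contDiffAt.comp _ hp
  · have hc : Filter.Tendsto (fun y : F => ((0 : F), y)) (𝓝 x₀) (𝓝 (0, x₀)) :=
      (Continuous.prodMk_right (0 : F)).continuousAt
    filter_upwards [hc.eventually hγe] with y hy
    have h1 : γ (0, y) = constPath F y := by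
      rw [← sub_eq_zero]
      simpa [hΞ, flowEquation] using hy
    change γ (0, y) 1 = y
    rw [h1, constPath_apply]
  · set N' : C(unitInterval, F) → C(unitInterval, F →L[ℝ] F →L[ℝ] F) := fun g =>
      ContinuousMap.comp ⟨fderiv ℝ S, hS.continuous_fderiv (by simp)⟩ g with hN'
    have hN'c : Continuous N' := ContinuousMap.continuous_postcomp _
    -- This makes the linearized integral equation a contraction, hence uniquely solvable.
    have hsmall : ∀ᶠ p in 𝓝 ((0 : F), x₀), ‖N' (γ p)‖ * ‖p.1‖ < 1 := by
      have hc : ContinuousAt (fun p : F × F => ‖N' (γ p)‖ * ‖p.1‖) (0, x₀) :=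
        ((hN'c.continuousAt.comp hγs.continuousAt).norm).mul continuous_fst.continuousAt.norm
      refine hc.eventually (gt_mem_nhds ?_)
      simp
    have hnear : ∀ᶠ p in 𝓝 ((0 : F), x₀), ∀ t, ∀ a b,
        fderiv ℝ S (γ p t) (S (γ p t) a) b = fderiv ℝ S (γ p t) (S (γ p t) b) a := by
      obtain ⟨δ, hδ, h⟩ := Metric.eventually_nhds_iff.1 hcomm
      have h1 : ∀ᶠ p in 𝓝 ((0 : F), x₀), dist (γ p) (γ (0, x₀)) < δ :=
        hγs.continuousAt.eventually (Metric.ball_mem_nhds _ hδ)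
      filter_upwards [h1] with p hp t
      refine h (lt_of_le_of_lt ?_ hp)
      have := ContinuousMap.dist_apply_le_dist (f := γ p) (g := γ (0, x₀)) t
      rwa [hγ0, constPath_apply, ← hγ0] at this
    filter_upwards [hγe.eventually_nhds, hγd, hsmall, hnear] with p hpe hpd hps hpn b
    have hp0 := hpe.self_of_nhds
    set z : C(unitInterval, F) := fderiv ℝ γ p (b, 0) with hz
    have hzev : fderiv ℝ (fun p => ev (γ p)) p (b, 0) = z 1 := by
      exact congrArg (fun L => L (b, 0)) (ev.hasFDerivAt.comp p hpd.hasFDerivAt).fderiv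
    -- For commuting fields, varying a in the direction b moves γ(t) by t S(γ(t))b. Both ζ and the
    -- true derivative z are shown to solve the same linearized equation, and at t = 1 the value of
    -- ζ is S(ψ)b.
    set ζ : C(unitInterval, F) := ⟨fun t => (t : ℝ) • S (γ p t) b, by
      have := hS.continuous
      fun_prop⟩ with hζ
    have hzeq : z = primitive F (pathEval F F (pathEval F (F →L[ℝ] F) (N' (γ p)) z)
        (constPath F p.1) + pathEval F F (ContinuousMap.comp ⟨S, hS.continuous⟩ (γ p))
          (constPath F b)) := by
      have h1 := ((contDiff_flowEquation hS).differentiable (by simp) (p, γ p)).hasFDerivAt.comp p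
        ((hasFDerivAt_id p).prodMk hpd.hasFDerivAt)
      have h2 := (hasFDerivAt_const (𝕜 := ℝ) (0 : C(unitInterval, F)) p).congr_of_eventuallyEq hpe
      have h3 := congrArg (fun L => L (b, 0)) (h1.unique h2)
      simp [fderiv_flowEquation hS] at h3
      rw [← sub_eq_zero, map_add]
      exact h3
    have hcurve : ∀ t : unitInterval, γ p t
        = p.2 + ∫ s in (0 : ℝ)..t, S (γ p (Set.projIcc 0 1 zero_le_one s)) p.1 := by
      intro t
      have h1 : γ p - constPath F p.2 - primitive F (pathEval F F (ContinuousMap.comp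
        ⟨S, hS.continuous⟩ (γ p)) (constPath F p.1)) = 0 := hp0
      rw [sub_sub, sub_eq_zero] at h1
      exact congrArg (fun g => g t) h1
    have hζeq : ζ = primitive F (pathEval F F (pathEval F (F →L[ℝ] F) (N' (γ p)) ζ)
        (constPath F p.1) + pathEval F F (ContinuousMap.comp ⟨S, hS.continuous⟩ (γ p))
          (constPath F b)) := by
      ext t
      rw [primitive_apply]
      have hcont : Continuous fun s => S (γ p (Set.projIcc 0 1 zero_le_one s)) p.1 := by
        have := hS.continuous
        have : Continuous (Set.projIcc (0 : ℝ) 1 zero_le_one) := continuous_projIcc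
        fun_prop
      -- A differentiable extension of γ to the real line, agreeing with it on [0, t], so that the
      -- fundamental theorem of calculus applies.
      set c : ℝ → F := fun t =>
        p.2 + ∫ s in (0 : ℝ)..t, S (γ p (Set.projIcc 0 1 zero_le_one s)) p.1 with hc
      have hcd : ∀ s, HasDerivAt c (S (γ p (Set.projIcc 0 1 zero_le_one s)) p.1) s := fun s =>
        (intervalIntegral.integral_hasDerivAt_right (hcont.intervalIntegrable _ _)
          (hcont.stronglyMeasurableAtFilter _ _) hcont.continuousAt).const_add p.2
      have hcγ : ∀ s ∈ Set.uIcc (0 : ℝ) t, c s = γ p (Set.projIcc 0 1 zero_le_one s) := by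
        intro s hs
        rw [Set.uIcc_of_le t.2.1] at hs
        have hs' : s ∈ Set.Icc (0 : ℝ) 1 := ⟨hs.1, hs.2.trans t.2.2⟩
        rw [Set.projIcc_of_mem _ hs', hcurve ⟨s, hs'⟩]
      have hk : ∀ s ∈ Set.uIcc (0 : ℝ) t, HasDerivAt (fun s : ℝ => s • S (c s) b)
          ((pathEval F F (pathEval F (F →L[ℝ] F) (N' (γ p)) ζ) (constPath F p.1)
            + pathEval F F (ContinuousMap.comp ⟨S, hS.continuous⟩ (γ p)) (constPath F b))
            (Set.projIcc 0 1 zero_le_one s)) s := by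
        intro s hs
        have hs2 := hs
        rw [Set.uIcc_of_le t.2.1] at hs2
        have hs' : s ∈ Set.Icc (0 : ℝ) 1 := ⟨hs2.1, hs2.2.trans t.2.2⟩
        have h1 := ((hS.differentiable (by simp) (c s)).hasFDerivAt.comp_hasDerivAt s
          (hcd s)).clm_apply (hasDerivAt_const s b)
        have h2 := (hasDerivAt_id s).smul h1
        convert! h2 using 1
        have e1 := hcγ s hs
        have e2 : ((Set.projIcc (0 : ℝ) 1 zero_le_one s : unitInterval) : ℝ) = s := by
          rw [Set.projIcc_of_mem _ hs']
        -- The only use of commutation: the derivative of S(γ)b along S(γ)a equals that of S(γ)a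
        -- along S(γ)b.
        have e3 := hpn (Set.projIcc 0 1 zero_le_one s) p.1 b
        simp only [ContinuousMap.add_apply, pathEval_apply, constPath_apply, hζ, hN',
          ContinuousMap.comp_apply, ContinuousMap.coe_mk, Function.comp_apply, e1, e2, map_smul,
          FunLike.coe_smul, Pi.smul_apply, id_eq, one_smul, map_zero, add_zero, e3]
      rw [intervalIntegral.integral_eq_sub_of_hasDerivAt hk]
      · have e1 := hcγ t Set.right_mem_uIcc
        have e2 : Set.projIcc (0 : ℝ) 1 zero_le_one t = t := Set.projIcc_val _ t
        rw [e1, e2]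
        simp [hζ]
      · exact intervalIntegrable_proj _ _ _
    have hdiff : z - ζ = 0 := by
      have h1 : z - ζ = primitive F (pathEval F F (pathEval F (F →L[ℝ] F) (N' (γ p)) (z - ζ))
          (constPath F p.1)) := by
        conv_lhs => rw [hzeq, hζeq]
        rw [← map_sub, add_sub_add_right_eq_sub, ← sub_apply, ← map_sub, ← map_sub]
      have h2 : ‖z - ζ‖ ≤ ‖N' (γ p)‖ * ‖p.1‖ * ‖z - ζ‖ := by
        conv_lhs => rw [h1]
        refine (norm_primitive_le _).trans ((norm_pathEval_le _ _).trans ?_)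
        refine (mul_le_mul (norm_pathEval_le _ _) (norm_constPath_le _) (norm_nonneg _)
          (by positivity)).trans (le_of_eq (by ring))
      by_contra hne
      have h3 : 0 < ‖z - ζ‖ := norm_pos_iff.2 hne
      nlinarith
    rw [hzev, sub_eq_zero.1 hdiff]
    change ((1 : unitInterval) : ℝ) • S (γ p 1) b = S (γ p 1) b
    simp

end CommutingFlow

/-! ### Frobenius theorem for a parallel field of projections. -/

section Straightening

variable {F : Type*} [NormedAddCommGroup F] [NormedSpace ℝ F] [FiniteDimensional ℝ F]

/-- A smooth map on a neighbourhood of a point agrees near that point with a globally smooth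
map. -/
theorem exists_contDiff_eventuallyEq {B : Type*} [NormedAddCommGroup B] [NormedSpace ℝ B]
    {S : F → B} {U : Set F} (hU : IsOpen U) {x₀ : F} (hx₀ : x₀ ∈ U) (hS : ContDiffOn ℝ ∞ S U) :
    ∃ S' : F → B, ContDiff ℝ ∞ S' ∧ S' =ᶠ[𝓝 x₀] S := by
  obtain ⟨r, hr, hrU⟩ := Metric.isOpen_iff.1 hU x₀ hx₀
  let χ : ContDiffBump x₀ := ⟨r / 4, r / 2, by positivity, by linarith⟩
  refine ⟨fun x => χ x • S x, contDiff_iff_contDiffAt.2 fun x => ?_, ?_⟩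
  · by_cases hx : x ∈ U
    · exact χ.contDiff.contDiffAt.smul (hS.contDiffAt (hU.mem_nhds hx))
    · have h1 : x ∉ Metric.closedBall x₀ (r / 2) := fun h =>
        hx (hrU (Metric.closedBall_subset_ball (by linarith) h))
      refine (contDiffAt_const (c := (0 : B))).congr_of_eventuallyEq ?_
      filter_upwards [Metric.isClosed_closedBall.isOpen_compl.mem_nhds h1] with y hy
      have : χ y = 0 := χ.zero_of_le_dist (le_of_lt (by simpa using hy))
      simp [this]
  · filter_upwards [χ.eventuallyEq_one] with x hx
    simp [hx]

/-- The path space argument needs S on the whole space. A cutoff supplies it, and near (0, x₀) the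
flow stays where S is unchanged. -/
theorem exists_commuting_flow (S : F → F →L[ℝ] F) {U : Set F} (hU : IsOpen U) {x₀ : F}
    (hx₀ : x₀ ∈ U) (hS : ContDiffOn ℝ ∞ S U)
    (hcomm : ∀ x ∈ U, ∀ a b, fderiv ℝ S x (S x a) b = fderiv ℝ S x (S x b) a) :
    ∃ ψ : F × F → F, (∀ᶠ p in 𝓝 ((0 : F), x₀), ContDiffAt ℝ ∞ ψ p) ∧ (∀ᶠ y in 𝓝 x₀, ψ (0, y) = y) ∧
      ∀ᶠ p in 𝓝 ((0 : F), x₀), ∀ b, fderiv ℝ ψ p (b, 0) = S (ψ p) b := by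
  obtain ⟨S', hS', hSS'⟩ := exists_contDiff_eventuallyEq hU hx₀ hS
  obtain ⟨ψ, h1, h2, h3⟩ := exists_commuting_flow_of_contDiff S' hS' x₀ (by
    filter_upwards [hSS'.eventually_nhds, hU.mem_nhds hx₀] with x hx hxU a b
    have hx : S' =ᶠ[𝓝 x] S := hx
    rw [hx.fderiv_eq, hx.self_of_nhds, hcomm x hxU])
  refine ⟨ψ, h1, h2, ?_⟩
  have h4 : Filter.Tendsto ψ (𝓝 (0, x₀)) (𝓝 x₀) := by
    have := h1.self_of_nhds.continuousAt.tendsto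
    rwa [h2.self_of_nhds] at this
  filter_upwards [h3, h4.eventually hSS'] with p hp hp' b
  rw [hp b, hp']

/-- A smooth field `Q` of projections that is parallel for a torsion-free connection `Γ` has an
involutive range: near each point there are enough functions constant along the range of `Q`. -/
theorem exists_first_integral {Q : F → F →L[ℝ] F} {Γ : F → F →L[ℝ] F →L[ℝ] F} {U : Set F}
    (hU : IsOpen U) {x₀ : F} (hx₀ : x₀ ∈ U) (hQ : ContDiffOn ℝ ∞ Q U)
    (hsq : ∀ x ∈ U, Q x * Q x = Q x) (hΓ : ∀ x ∈ U, ∀ u v, Γ x u v = Γ x v u)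
    (hp : ∀ x ∈ U, ∀ u, fderiv ℝ Q x u = Q x * Γ x u - Γ x u * Q x) :
    ∃ f : F → F, (∀ᶠ x in 𝓝 x₀, ContDiffAt ℝ ∞ f x) ∧ fderiv ℝ f x₀ = 1 - Q x₀ ∧
      (∀ᶠ x in 𝓝 x₀, fderiv ℝ f x * Q x = 0) ∧ ∀ᶠ x in 𝓝 x₀, Q x₀ * fderiv ℝ f x = 0 := by
  set q := Q x₀ with hq
  have hqq : q * q = q := hsq x₀ hx₀
  -- T x sends the range of q into that of Q x, is the identity on ker q and at x₀, and hence is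
  -- invertible near x₀.
  set T : F → F →L[ℝ] F := fun x => Q x * q + (1 - q) with hT
  have hTs : ContDiffOn ℝ ∞ T U := (hQ.mul contDiffOn_const).add contDiffOn_const
  set V : Set F := (U ∩ T ⁻¹' {t | IsUnit t}) ∩ (U ∩ (fun x => q + (1 - Q x)) ⁻¹' {t | IsUnit t})
    with hV
  have hVo : IsOpen V :=
    (hTs.continuousOn.isOpen_inter_preimage hU Units.isOpen).inter
      ((continuousOn_const.add (continuousOn_const.sub hQ.continuousOn)).isOpen_inter_preimage
        hU Units.isOpen)
  have hT₀ : T x₀ = 1 := by simp [hT, ← hq, hqq]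
  have hx₀V : x₀ ∈ V := by
    refine ⟨⟨hx₀, ?_⟩, hx₀, ?_⟩
    · simp [hT₀]
    · simp [← hq]
  have hVU : V ⊆ U := fun x hx => hx.1.1
  -- S x a is the lift of q a to the range of Q x, that is, Q S = S, q S = q and S(1 − q) = 0.
  -- Prescribing the q-component is what makes these fields commute.
  set S : F → F →L[ℝ] F := fun x => Q x * q * Ring.inverse (T x) with hS
  have hSs : ContDiffOn ℝ ∞ S V := by
    intro x hx
    obtain ⟨t, ht⟩ := hx.1.2
    have h1 : ContDiffAt ℝ ∞ (fun y => Ring.inverse (T y)) x := by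
      have h2 := contDiffAt_ringInverse ℝ (n := ∞) t
      rw [ht] at h2
      exact h2.comp x (hTs.contDiffAt (hU.mem_nhds (hVU hx)))
    exact (((hQ.contDiffAt (hU.mem_nhds (hVU hx))).mul contDiffAt_const).mul
      h1).contDiffWithinAt
  have hTinv : ∀ x ∈ V, T x * Ring.inverse (T x) = 1 := fun x hx =>
    Ring.mul_inverse_cancel _ hx.1.2
  have hTinv' : ∀ x ∈ V, Ring.inverse (T x) * T x = 1 := fun x hx =>
    Ring.inverse_mul_cancel _ hx.1.2
  have hQS : ∀ x ∈ V, Q x * S x = S x := fun x hx => by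
    simp only [hS, ← mul_assoc, hsq x (hVU hx)]
  have hqS : ∀ x ∈ V, q * S x = q := fun x hx => by
    have h1 : q * T x = q * (Q x * q) := by
      simp only [hT, mul_add, mul_sub, mul_one, hqq, sub_self, add_zero]
    simp only [hS]
    rw [← mul_assoc, ← h1, mul_assoc, hTinv x hx, mul_one]
  have hSp : ∀ x ∈ V, S x * (1 - q) = 0 := fun x hx => by
    have h1 : T x * (1 - q) = 1 - q := by
      simp only [hT, add_mul, mul_sub, sub_mul, mul_one, one_mul, mul_assoc, hqq]
      abel
    have h2 : Ring.inverse (T x) * (1 - q) = 1 - q := by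
      conv_lhs => rw [← h1, ← mul_assoc, hTinv' x hx, one_mul]
    simp only [hS]
    rw [mul_assoc, h2, mul_assoc, mul_sub, mul_one, hqq, sub_self, mul_zero]
  -- The range of Q x meets ker q only in 0, because q + (1 − Q x) is invertible on V.
  have hcancel : ∀ x ∈ V, ∀ c : F, q c = 0 → c = Q x c → c = 0 := fun x hx c h1 h2 => by
    obtain ⟨t, ht⟩ := hx.2.2
    have h3 : (t : F →L[ℝ] F) c = 0 := by
      rw [ht]
      change q c + (c - Q x c) = 0
      rw [← h2, h1, sub_self, add_zero]
    have h4 : ((↑t⁻¹ : F →L[ℝ] F) * (t : F →L[ℝ] F)) c = 0 := by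
      change (↑t⁻¹ : F →L[ℝ] F) ((t : F →L[ℝ] F) c) = 0
      rw [h3, map_zero]
    rw [Units.inv_mul] at h4
    exact h4
  have hSQ : ∀ x ∈ V, ∀ c, S x (Q x c) = Q x c := fun x hx c => by
    rw [← sub_eq_zero]
    refine hcancel x hx _ ?_ ?_
    · have h1 := congrArg (fun L => L (Q x c)) (hqS x hx)
      change q (S x (Q x c)) = q (Q x c) at h1
      rw [map_sub, h1, sub_self]
    · have h1 := congrArg (fun L => L (Q x c)) (hQS x hx)
      have h2 := congrArg (fun L => L c) (hsq x (hVU hx))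
      change Q x (S x (Q x c)) = S x (Q x c) at h1
      change Q x (Q x c) = Q x c at h2
      rw [map_sub, h1, h2]
  -- The bracket of two such fields lies in ker q (differentiate q S = q) and in the range of Q
  -- (differentiate Q S = S, using that Q is parallel and Γ symmetric), so it vanishes.
  have hcomm : ∀ x ∈ V, ∀ a b, fderiv ℝ S x (S x a) b = fderiv ℝ S x (S x b) a := by
    intro x hx a b
    have hSd := ((hSs.contDiffAt (hVo.mem_nhds hx)).differentiableAt (by simp)).hasFDerivAt
    have hQd := ((hQ.contDiffAt (hU.mem_nhds (hVU hx))).differentiableAt (by simp)).hasFDerivAt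
    have h1 : ∀ u b, q (fderiv ℝ S x u b) = 0 := by
      intro u b
      have e1 := (q.hasFDerivAt (x := S x b)).comp x (hSd.clm_apply (hasFDerivAt_const b x))
      have e2 := (hasFDerivAt_const (𝕜 := ℝ) (q b) x).congr_of_eventuallyEq
        (f₁ := fun x => q (S x b)) (by
        filter_upwards [hVo.mem_nhds hx] with y hy using congrArg (fun L => L b) (hqS y hy))
      simpa using congrArg (fun L => L u) (e1.unique e2)
    have h2 : ∀ u b, fderiv ℝ S x u b - Q x (fderiv ℝ S x u b)
        = Q x (Γ x u (S x b)) - Γ x u (S x b) := by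
      intro u b
      have e0 := hSd.clm_apply (hasFDerivAt_const b x)
      have e1 := hQd.clm_apply e0
      have e2 := e0.congr_of_eventuallyEq (f₁ := fun x => Q x (S x b)) (by
        filter_upwards [hVo.mem_nhds hx] with y hy using congrArg (fun L => L b) (hQS y hy))
      have e3 := congrArg (fun L => L u) (e1.unique e2)
      have e4 : Q x (S x b) = S x b := congrArg (fun L => L b) (hQS x hx)
      simp [hp x (hVU hx), e4] at e3
      rw [sub_eq_iff_eq_add']
      exact e3.symm
    rw [← sub_eq_zero]
    refine hcancel x hx _ ?_ ?_
    · rw [map_sub, h1, h1, sub_self]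
    · have h3 := h2 (S x a) b
      have h4 := h2 (S x b) a
      rw [hΓ x (hVU hx), ← h4] at h3
      rw [map_sub, ← sub_eq_zero]
      rw [← sub_eq_zero] at h3
      rw [← h3]
      abel
  obtain ⟨ψ, hψE, hψ0, hψ⟩ := exists_commuting_flow S hVo hx₀V hSs hcomm
  have hψs : ContDiffAt ℝ ∞ ψ (0, x₀) := hψE.self_of_nhds
  set p : F →L[ℝ] F := 1 - q with hpdef
  have hpq : ∀ c, p (q c) = 0 := fun c => by
    have : (1 - q) * q = 0 := by rw [sub_mul, one_mul, hqq, sub_self]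
    exact congrArg (fun L => L c) this
  -- Coordinates adapted to the foliation: start at x₀ + p z on the transversal and flow along z. As
  -- S kills ker q, only q z affects the flow, while p z labels the leaf; the first integral is p of
  -- the inverse map.
  set ι : F → F × F := fun z => (z, x₀ + p z) with hι
  have hιd : ∀ z, HasFDerivAt ι ((ContinuousLinearMap.id ℝ F).prod p) z := fun z =>
    (hasFDerivAt_id z).prodMk (p.hasFDerivAt.const_add x₀)
  have hι0 : ι 0 = (0, x₀) := by simp [hι]
  have hιs : ContDiff ℝ ∞ ι := contDiff_id.prodMk (contDiff_const.add p.contDiff)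
  set Θ : F → F := fun z => ψ (ι z) with hΘ
  have hΘ0 : Θ 0 = x₀ := by
    simp only [hΘ, hι0]
    exact hψ0.self_of_nhds
  have hιt : Filter.Tendsto ι (𝓝 0) (𝓝 (0, x₀)) := by
    have := hιs.continuous.continuousAt.tendsto (x := (0 : F))
    rwa [hι0] at this
  have hΘE : ∀ᶠ z in 𝓝 (0 : F), ContDiffAt ℝ ∞ Θ z := by
    filter_upwards [hιt.eventually hψE] with z hz using hz.comp z hιs.contDiffAt
  have hΘd : ∀ᶠ z in 𝓝 (0 : F), HasFDerivAt Θ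
      ((fderiv ℝ ψ (ι z)).comp ((ContinuousLinearMap.id ℝ F).prod p)) z := by
    filter_upwards [hιt.eventually hψE] with z hz
    exact (hz.differentiableAt (by simp)).hasFDerivAt.comp z (hιd z)
  have hΘq : ∀ᶠ z in 𝓝 (0 : F), ∀ c, fderiv ℝ Θ z (q c) = S (Θ z) (q c) := by
    filter_upwards [hΘd, hιt.eventually hψ] with z hz hz' c
    rw [hz.fderiv]
    simp only [ContinuousLinearMap.comp_apply, ContinuousLinearMap.prod_apply, hpq]
    exact hz' _
  have hΘid : fderiv ℝ Θ 0 = 1 := by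
    rw [hΘd.self_of_nhds.fderiv, hι0]
    ext c
    have h1 : fderiv ℝ ψ (0, x₀) (c, p c)
        = fderiv ℝ ψ (0, x₀) (c, 0) + fderiv ℝ ψ (0, x₀) (0, p c) := by
      rw [← map_add]
      simp
    have h2 : fderiv ℝ ψ (0, x₀) (0, p c) = p c := by
      have e1 := (hψs.differentiableAt (by simp)).hasFDerivAt.comp x₀
        ((hasFDerivAt_const (0 : F) x₀).prodMk (hasFDerivAt_id x₀))
      have e2 := (hasFDerivAt_id (𝕜 := ℝ) x₀).congr_of_eventuallyEq hψ0
      exact congrArg (fun L => L (p c)) (e1.unique e2)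
    have h3 : S x₀ c = q c := by
      simp [hS, hT₀, ← hq, hqq]
    change fderiv ℝ ψ (0, x₀) (c, p c) = c
    rw [h1, h2, hψ.self_of_nhds, hψ0.self_of_nhds, h3]
    simp [hpdef]
  have hΘe : HasFDerivAt Θ ((ContinuousLinearEquiv.refl ℝ F : F ≃L[ℝ] F) : F →L[ℝ] F) 0 := by
    have := (hΘE.self_of_nhds.differentiableAt (by simp)).hasFDerivAt
    rw [hΘid] at this
    exact this
  have hst := hΘE.self_of_nhds.hasStrictFDerivAt' hΘe (by simp)
  set κ := hΘE.self_of_nhds.localInverse hΘe (by simp) with hκ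
  have hκE : ∀ᶠ x in 𝓝 x₀, ContDiffAt ℝ ∞ κ x := by
    have := eventually_contDiffAt_localInverse hΘE hΘe
    rwa [hΘ0] at this
  have hκl : ∀ᶠ z in 𝓝 (0 : F), κ (Θ z) = z := hst.eventually_left_inverse
  have hκr : ∀ᶠ x in 𝓝 x₀, Θ (κ x) = x := by
    have := hst.eventually_right_inverse
    rwa [hΘ0] at this
  have hκ0 : κ x₀ = 0 := by
    rw [← hΘ0]
    exact hκl.self_of_nhds
  have hκt : Filter.Tendsto κ (𝓝 x₀) (𝓝 0) := by
    have := hκE.self_of_nhds.continuousAt.tendsto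
    rwa [hκ0] at this
  have hfd : ∀ᶠ x in 𝓝 x₀, fderiv ℝ (fun x => p (κ x)) x = p * fderiv ℝ κ x := by
    filter_upwards [hκE] with x hx
    exact (p.hasFDerivAt.comp x (hx.differentiableAt (by simp)).hasFDerivAt).fderiv
  have hinv : ∀ᶠ x in 𝓝 x₀, fderiv ℝ κ x * fderiv ℝ Θ (κ x) = 1 := by
    filter_upwards [hκt.eventually hκl.eventually_nhds, hκr, hκE,
      hκt.eventually hΘE] with x h1 h2 h3 h4
    rw [← h2] at h3
    have e1 := (h3.differentiableAt (by simp)).hasFDerivAt.comp (κ x)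
      (h4.differentiableAt (by simp)).hasFDerivAt
    rw [h2] at e1
    exact e1.unique ((hasFDerivAt_id (𝕜 := ℝ) (κ x)).congr_of_eventuallyEq h1)
  refine ⟨fun x => p (κ x), ?_, ?_, ?_, ?_⟩
  · filter_upwards [hκE] with x hx using p.contDiff.contDiffAt.comp x hx
  · have := hinv.self_of_nhds
    rw [hκ0, hΘid, mul_one] at this
    rw [hfd.self_of_nhds, this, mul_one]
  · filter_upwards [hfd, hinv, hκr, hκt.eventually hΘq, hVo.mem_nhds hx₀V] with x h1 h2 h3 h4 hx
    rw [h1]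
    ext c
    -- dΘ is S on the range of q, and S(q Q c) = S(Q c) = Q c. So dκ maps Q c into the range of q,
    -- which p kills.
    have e1 : fderiv ℝ Θ (κ x) (q (Q x c)) = Q x c := by
      rw [h4, h3]
      have e2 := congrArg (fun L => L (Q x c)) (hSp x hx)
      have e3 : S x (Q x c - q (Q x c)) = 0 := e2
      rw [map_sub, sub_eq_zero, hSQ x hx] at e3
      exact e3.symm
    have e2 := congrArg (fun L => L (q (Q x c))) h2
    have e3 : fderiv ℝ κ x (fderiv ℝ Θ (κ x) (q (Q x c))) = q (Q x c) := e2
    rw [e1] at e3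
    change p (fderiv ℝ κ x (Q x c)) = 0
    rw [e3, hpq]
  · filter_upwards [hfd] with x h1
    rw [h1, ← mul_assoc, hpdef, mul_sub, mul_one, hqq, sub_self, zero_mul]

/-- A smooth field of projections that is parallel for a torsion-free connection is constant in
suitable coordinates. -/
theorem exists_straightening {Q : F → F →L[ℝ] F} {Γ : F → F →L[ℝ] F →L[ℝ] F} {U : Set F}
    (hU : IsOpen U) {x₀ : F} (hx₀ : x₀ ∈ U) (hQ : ContDiffOn ℝ ∞ Q U)
    (hsq : ∀ x ∈ U, Q x * Q x = Q x) (hΓ : ∀ x ∈ U, ∀ u v, Γ x u v = Γ x v u)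
    (hp : ∀ x ∈ U, ∀ u, fderiv ℝ Q x u = Q x * Γ x u - Γ x u * Q x) :
    ∃ Φ : F → F, (∀ᶠ x in 𝓝 x₀, ContDiffAt ℝ ∞ Φ x) ∧ fderiv ℝ Φ x₀ = 1 ∧
      ∀ᶠ x in 𝓝 x₀, fderiv ℝ Φ x * Q x = Q x₀ * fderiv ℝ Φ x := by
  obtain ⟨f, hf, hf0, hfQ, hQf⟩ := exists_first_integral hU hx₀ hQ hsq hΓ hp
  obtain ⟨h, hh, hh0, hhP, hPh⟩ := exists_first_integral (Q := fun x => 1 - Q x) hU hx₀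
    (contDiffOn_const.sub hQ) (fun x hx => by
      simp only [mul_sub, sub_mul, mul_one, one_mul, hsq x hx]
      abel) hΓ (fun x hx u => by
      rw [fderiv_const_sub, neg_apply, hp x hx]
      simp only [mul_sub, sub_mul, mul_one, one_mul]
      abel)
  -- df kills the range of Q and takes values in the kernel of Q x₀; dh kills the kernel of Q and
  -- takes values in the range of Q x₀. Hence d(f + h)Q = dh = Q x₀ d(f + h).
  have hd : ∀ᶠ x in 𝓝 x₀, fderiv ℝ (f + h) x = fderiv ℝ f x + fderiv ℝ h x := by
    filter_upwards [hf, hh] with x h1 h2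
    exact fderiv_add (h1.differentiableAt (by simp)) (h2.differentiableAt (by simp))
  refine ⟨f + h, ?_, ?_, ?_⟩
  · filter_upwards [hf, hh] with x h1 h2 using h1.add h2
  · rw [hd.self_of_nhds, hf0, hh0]
    abel
  · filter_upwards [hd, hfQ, hQf, hhP, hPh] with x h1 h2 h3 h4 h5
    rw [mul_sub, mul_one, sub_eq_zero] at h4
    rw [sub_mul, one_mul, sub_eq_zero] at h5
    rw [h1, add_mul, mul_add, h2, h3, ← h4, ← h5]

end Straightening

/-! ### Tensors on the manifold and their chart expressions. -/

section Charts

variable {E : Type*} [NormedAddCommGroup E] [NormedSpace ℝ E]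
  {M : Type*} [TopologicalSpace M] [ChartedSpace E M]

theorem chartBilin_apply (B : BilinField E M) (x₀ : M) (y v w : E) :
    chartBilin B x₀ y v w = B ((extChartAt 𝓘(ℝ, E) x₀).symm y)
      (chartSymmDeriv x₀ y v) (chartSymmDeriv x₀ y w) := rfl

theorem chartEndo_apply (J : EndoField E M) (x₀ : M) (y v : E) :
    chartEndo J x₀ y v = chartDeriv x₀ ((extChartAt 𝓘(ℝ, E) x₀).symm y)
      (show E from J ((extChartAt 𝓘(ℝ, E) x₀).symm y) (chartSymmDeriv x₀ y v)) := rfl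

theorem isOpen_chart_target (x₀ : M) : IsOpen (extChartAt 𝓘(ℝ, E) x₀).target :=
  isOpen_extChartAt_target x₀


theorem contMDiff_iff_chart_sources {N : Type*} [TopologicalSpace N] {HN EN : Type*}
    [NormedAddCommGroup EN] [NormedSpace ℝ EN] [TopologicalSpace HN] [ChartedSpace HN N]
    {I : ModelWithCorners ℝ EN HN} {f : M → N} :
    ContMDiff 𝓘(ℝ, E) I ∞ f
      ↔ ∀ x₀ : M, ContMDiffOn 𝓘(ℝ, E) I ∞ f (extChartAt 𝓘(ℝ, E) x₀).source :=
  ⟨fun h _ => h.contMDiffOn, fun h x₀ => (h x₀).contMDiffAt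
    ((isOpen_extChartAt_source x₀).mem_nhds (mem_extChartAt_source x₀))⟩

/-- The coordinate change between the charts around `x₀` and `x₁`. -/
noncomputable def coordChange (x₀ x₁ : M) (y : E) : E :=
  extChartAt 𝓘(ℝ, E) x₁ ((extChartAt 𝓘(ℝ, E) x₀).symm y)

/-- The domain of the coordinate change between the charts around `x₀` and `x₁`. -/
def coordDomain (x₀ x₁ : M) : Set E :=
  (extChartAt 𝓘(ℝ, E) x₀).target ∩
    (extChartAt 𝓘(ℝ, E) x₀).symm ⁻¹' (extChartAt 𝓘(ℝ, E) x₁).source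

theorem isOpen_coordDomain (x₀ x₁ : M) : IsOpen (coordDomain (E := E) x₀ x₁) :=
  (continuousOn_extChartAt_symm x₀).isOpen_inter_preimage (isOpen_chart_target x₀)
    (isOpen_extChartAt_source x₁)

variable [IsManifold 𝓘(ℝ, E) ∞ M]

theorem mdifferentiableAt_chart {x₀ x : M} (hx : x ∈ (extChartAt 𝓘(ℝ, E) x₀).source) :
    MDifferentiableAt 𝓘(ℝ, E) 𝓘(ℝ, E) (extChartAt 𝓘(ℝ, E) x₀) x :=
  have : IsManifold 𝓘(ℝ, E) 1 M := IsManifold.of_le (n := ∞)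
    (WithTop.coe_le_coe.2 (le_top : (1 : ℕ∞) ≤ ⊤))
  mdifferentiableAt_extChartAt (by rwa [← extChartAt_source 𝓘(ℝ, E)])

theorem mdifferentiableAt_chart_symm {x₀ : M} {y : E} (hy : y ∈ (extChartAt 𝓘(ℝ, E) x₀).target) :
    MDifferentiableAt 𝓘(ℝ, E) 𝓘(ℝ, E) (extChartAt 𝓘(ℝ, E) x₀).symm y := by
  have : IsManifold 𝓘(ℝ, E) 1 M := IsManifold.of_le (n := ∞)
    (WithTop.coe_le_coe.2 (le_top : (1 : ℕ∞) ≤ ⊤))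
  have := mdifferentiableWithinAt_extChartAt_symm (I := 𝓘(ℝ, E)) hy
  rwa [modelWithCornersSelf_coe, Set.range_id, mdifferentiableWithinAt_univ] at this

theorem chartDeriv_chartSymmDeriv {x₀ : M} {y : E} (hy : y ∈ (extChartAt 𝓘(ℝ, E) x₀).target)
    (v : E) :
    chartDeriv x₀ ((extChartAt 𝓘(ℝ, E) x₀).symm y) (chartSymmDeriv x₀ y v) = v := by
  have : IsManifold 𝓘(ℝ, E) 1 M := IsManifold.of_le (n := ∞)
    (WithTop.coe_le_coe.2 (le_top : (1 : ℕ∞) ≤ ⊤))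
  have := mfderiv_extChartAt_comp_mfderivWithin_extChartAt_symm (I := 𝓘(ℝ, E)) hy
  simp only [modelWithCornersSelf_coe, Set.range_id, mfderivWithin_univ] at this
  exact congrArg (fun L => L v) this

theorem chartSymmDeriv_chartDeriv {x₀ : M} {y : E} (hy : y ∈ (extChartAt 𝓘(ℝ, E) x₀).target)
    (v : E) :
    chartSymmDeriv x₀ y (chartDeriv x₀ ((extChartAt 𝓘(ℝ, E) x₀).symm y) v) = v := by
  have : IsManifold 𝓘(ℝ, E) 1 M := IsManifold.of_le (n := ∞)
    (WithTop.coe_le_coe.2 (le_top : (1 : ℕ∞) ≤ ⊤))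
  have := mfderivWithin_extChartAt_symm_comp_mfderiv_extChartAt (I := 𝓘(ℝ, E)) hy
  simp only [modelWithCornersSelf_coe, Set.range_id, mfderivWithin_univ] at this
  exact congrArg (fun L => L v) this

theorem chartSymmDeriv_chartEndo (J : EndoField E M) {x₀ : M} {y : E}
    (hy : y ∈ (extChartAt 𝓘(ℝ, E) x₀).target) (v : E) :
    chartSymmDeriv x₀ y (chartEndo J x₀ y v)
      = J ((extChartAt 𝓘(ℝ, E) x₀).symm y) (chartSymmDeriv x₀ y v) := by
  rw [chartEndo_apply, chartSymmDeriv_chartDeriv hy]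

/-- A function on the domain of a chart is smooth if and only if its coordinate expression is. -/
theorem contMDiffOn_iff_chart {A : Type*} [NormedAddCommGroup A] [NormedSpace ℝ A] {x₀ : M}
    {f : M → A} {h : E → A} (hfh : ∀ y ∈ (extChartAt 𝓘(ℝ, E) x₀).target,
      f ((extChartAt 𝓘(ℝ, E) x₀).symm y) = h y) :
    ContMDiffOn 𝓘(ℝ, E) 𝓘(ℝ, A) ∞ f (extChartAt 𝓘(ℝ, E) x₀).source
      ↔ ContDiffOn ℝ ∞ h (extChartAt 𝓘(ℝ, E) x₀).target := by
  constructor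
  · intro hf
    rw [← contMDiffOn_iff_contDiffOn]
    refine (hf.comp (contMDiffOn_extChartAt_symm x₀) fun y hy =>
      (extChartAt 𝓘(ℝ, E) x₀).map_target hy).congr fun y hy => (hfh y hy).symm
  · intro hh
    rw [← contMDiffOn_iff_contDiffOn] at hh
    have h1 : ContMDiffOn 𝓘(ℝ, E) 𝓘(ℝ, E) ∞ (extChartAt 𝓘(ℝ, E) x₀)
        (extChartAt 𝓘(ℝ, E) x₀).source := by
      rw [extChartAt_source]
      exact contMDiffOn_extChartAt
    refine (hh.comp h1 fun y hy => (extChartAt 𝓘(ℝ, E) x₀).map_source hy).congr fun x hx => ?_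
    rw [Function.comp_apply, ← hfh _ ((extChartAt 𝓘(ℝ, E) x₀).map_source hx),
      (extChartAt 𝓘(ℝ, E) x₀).left_inv hx]

/-- Over the source of a chart the endomorphism bundle is trivialized by conjugating with the
tangent trivialization, which is the derivative of the chart; the resulting local expression is
`chartEndo`. -/
theorem isSmoothEndo_iff (J : EndoField E M) :
    IsSmoothEndo J ↔
      ∀ x₀ : M, ContDiffOn ℝ ∞ (chartEndo J x₀) (extChartAt 𝓘(ℝ, E) x₀).target := by
  have : IsManifold 𝓘(ℝ, E) 1 M := IsManifold.of_le (n := ∞)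
    (WithTop.coe_le_coe.2 (le_top : (1 : ℕ∞) ≤ ⊤))
  rw [IsSmoothEndo, contMDiff_iff_chart_sources]
  refine forall_congr' fun x₀ => ?_
  let e := trivializationAt (E →L[ℝ] E)
    (fun x : M => TangentSpace 𝓘(ℝ, E) x →L[ℝ] TangentSpace 𝓘(ℝ, E) x) x₀
  rw [e.contMDiffOn_iff (fun x hx => by
    rw [extChartAt_source] at hx
    exact ⟨hx, hx⟩)]
  refine (and_iff_right contMDiffOn_id).trans (contMDiffOn_iff_chart fun y hy => ?_)
  have hx : (extChartAt 𝓘(ℝ, E) x₀).symm y ∈ (chartAt E x₀).source := by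
    rw [← extChartAt_source 𝓘(ℝ, E)]
    exact (extChartAt 𝓘(ℝ, E) x₀).map_target hy
  have h1 := TangentBundle.continuousLinearMapAt_trivializationAt (I := 𝓘(ℝ, E)) hx
  have h2 := TangentBundle.symmL_trivializationAt (I := 𝓘(ℝ, E)) hx
  rw [(extChartAt 𝓘(ℝ, E) x₀).right_inv hy] at h2
  simp only [modelWithCornersSelf_coe, Set.range_id, mfderivWithin_univ] at h2
  ext v
  change (trivializationAt E (TangentSpace 𝓘(ℝ, E)) x₀).continuousLinearMapAt ℝ _
    (J _ ((trivializationAt E (TangentSpace 𝓘(ℝ, E)) x₀).symmL ℝ _ v)) = _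
  rw [h1, h2]
  rfl

theorem isSmoothBilin_iff (B : BilinField E M) :
    IsSmoothBilin B ↔
      ∀ x₀ : M, ContDiffOn ℝ ∞ (chartBilin B x₀) (extChartAt 𝓘(ℝ, E) x₀).target := by
  have : IsManifold 𝓘(ℝ, E) 1 M := IsManifold.of_le (n := ∞)
    (WithTop.coe_le_coe.2 (le_top : (1 : ℕ∞) ≤ ⊤))
  rw [IsSmoothBilin, contMDiff_iff_chart_sources]
  refine forall_congr' fun x₀ => ?_
  let e := trivializationAt (E →L[ℝ] E →L[ℝ] ℝ)
    (fun x : M => TangentSpace 𝓘(ℝ, E) x →L[ℝ] TangentSpace 𝓘(ℝ, E) x →L[ℝ] ℝ) x₀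
  rw [e.contMDiffOn_iff (fun x hx => by
    rw [extChartAt_source] at hx
    exact ⟨hx, hx, Set.mem_univ _⟩)]
  refine (and_iff_right contMDiffOn_id).trans (contMDiffOn_iff_chart fun y hy => ?_)
  have hx : (extChartAt 𝓘(ℝ, E) x₀).symm y ∈ (chartAt E x₀).source := by
    rw [← extChartAt_source 𝓘(ℝ, E)]
    exact (extChartAt 𝓘(ℝ, E) x₀).map_target hy
  have h2 := TangentBundle.symmL_trivializationAt (I := 𝓘(ℝ, E)) hx
  rw [(extChartAt 𝓘(ℝ, E) x₀).right_inv hy] at h2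
  simp only [modelWithCornersSelf_coe, Set.range_id, mfderivWithin_univ] at h2
  have h3 : ∀ v, (trivializationAt E (TangentSpace 𝓘(ℝ, E)) x₀).symm
      ((extChartAt 𝓘(ℝ, E) x₀).symm y) v = chartSymmDeriv x₀ y v := fun v => by
    rw [← Bundle.Trivialization.symmL_apply (R := ℝ) _ hx, h2]
    rfl
  ext v w
  refine (inCoordinates_apply_eq₂ (F₃ := ℝ) (E₃ := fun _ : M => ℝ) (x₀ := x₀)
    (x := (extChartAt 𝓘(ℝ, E) x₀).symm y) (ϕ := B _) hx hx (Set.mem_univ _)).trans ?_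
  rw [h3, h3, Bundle.Trivialization.coe_linearMapAt_of_mem _ (Set.mem_univ _)]
  rfl

theorem contDiffOn_coordChange (x₀ x₁ : M) :
    ContDiffOn ℝ ∞ (coordChange (E := E) x₀ x₁) (coordDomain x₀ x₁) := by
  rw [← contMDiffOn_iff_contDiffOn]
  have h1 : ContMDiffOn 𝓘(ℝ, E) 𝓘(ℝ, E) ∞ (extChartAt 𝓘(ℝ, E) x₁)
      (extChartAt 𝓘(ℝ, E) x₁).source := by
    rw [extChartAt_source]
    exact contMDiffOn_extChartAt
  exact h1.comp ((contMDiffOn_extChartAt_symm x₀).mono Set.inter_subset_left) fun y hy => hy.2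

theorem fderiv_coordChange {x₀ x₁ : M} {y : E} (hy : y ∈ coordDomain x₀ x₁) (v : E) :
    fderiv ℝ (coordChange x₀ x₁) y v
      = chartDeriv x₁ ((extChartAt 𝓘(ℝ, E) x₀).symm y) (chartSymmDeriv x₀ y v) := by
  have h := (mdifferentiableAt_chart hy.2).hasMFDerivAt.comp y
    (mdifferentiableAt_chart_symm hy.1).hasMFDerivAt
  have h' : HasFDerivAt (coordChange x₀ x₁) ((chartDeriv x₁
      ((extChartAt 𝓘(ℝ, E) x₀).symm y)).comp (chartSymmDeriv x₀ y)) y :=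
    hasMFDerivAt_iff_hasFDerivAt.1 h
  rw [h'.fderiv]
  rfl

theorem chartSymmDeriv_coordChange {x₀ x₁ : M} {y : E} (hy : y ∈ coordDomain x₀ x₁) (v : E) :
    chartSymmDeriv x₁ (coordChange x₀ x₁ y) (fderiv ℝ (coordChange x₀ x₁) y v)
      = chartSymmDeriv x₀ y v := by
  have h1 := (extChartAt 𝓘(ℝ, E) x₁).left_inv hy.2
  have h2 := chartSymmDeriv_chartDeriv ((extChartAt 𝓘(ℝ, E) x₁).map_source hy.2)
    (chartSymmDeriv x₀ y v)
  rw [h1] at h2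
  rw [fderiv_coordChange hy]
  exact h2

theorem isMetricOn_chartBilin (g : RiemMetric E M) (x₀ : M) :
    IsMetricOn (chartBilin g.inner x₀) (extChartAt 𝓘(ℝ, E) x₀).target where
  isOpen := isOpen_chart_target x₀
  contDiffOn := (isSmoothBilin_iff g.inner).1 g.contMDiff x₀
  symm y _ v w := g.symm ((extChartAt 𝓘(ℝ, E) x₀).symm y) (chartSymmDeriv x₀ y v)
    (chartSymmDeriv x₀ y w)
  nondeg y hy v h := by
    by_contra hne
    have h1 : chartSymmDeriv x₀ y v ≠ 0 := fun h0 => hne (by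
      rw [← chartDeriv_chartSymmDeriv hy v, h0, map_zero])
    exact (g.pos ((extChartAt 𝓘(ℝ, E) x₀).symm y) (chartSymmDeriv x₀ y v) h1).ne' (h v)

theorem coordChange_bijective {x₀ x₁ : M} {y : E} (hy : y ∈ coordDomain x₀ x₁) :
    Function.Bijective (fderiv ℝ (coordChange x₀ x₁) y) := by
  refine Function.bijective_iff_has_inverse.2 ⟨fun v => chartDeriv x₀
    ((extChartAt 𝓘(ℝ, E) x₀).symm y) (chartSymmDeriv x₁ (coordChange x₀ x₁ y) v),
    fun v => ?_, fun v => ?_⟩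
  · simp only [chartSymmDeriv_coordChange hy, chartDeriv_chartSymmDeriv hy.1]
  · have h1 := (extChartAt 𝓘(ℝ, E) x₁).left_inv hy.2
    have h2 := chartDeriv_chartSymmDeriv ((extChartAt 𝓘(ℝ, E) x₁).map_source hy.2) v
    rw [h1] at h2
    simp only [fderiv_coordChange hy]
    rw [chartSymmDeriv_chartDeriv hy.1]
    exact h2

/-- Makes local curvature quantities independent of the chart, in particular `ricci`, which is
defined through the chart centred at each point. -/
theorem isLocalIsometryOn_coordChange (g : RiemMetric E M) (x₀ x₁ : M) :
    IsLocalIsometryOn (coordChange x₀ x₁) (chartBilin g.inner x₀) (coordDomain x₀ x₁)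
      (chartBilin g.inner x₁) (extChartAt 𝓘(ℝ, E) x₁).target where
  source := (isMetricOn_chartBilin g x₀).mono (isOpen_coordDomain x₀ x₁) Set.inter_subset_left
  target := isMetricOn_chartBilin g x₁
  contDiffOn := contDiffOn_coordChange x₀ x₁
  mapsTo y hy := (extChartAt 𝓘(ℝ, E) x₁).map_source hy.2
  bijective y hy := coordChange_bijective hy
  apply_eq y hy v w := by
    rw [chartBilin_apply, chartBilin_apply, chartSymmDeriv_coordChange hy,
      chartSymmDeriv_coordChange hy, coordChange, (extChartAt 𝓘(ℝ, E) x₁).left_inv hy.2]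

/-- The Ricci tensor may be computed in any chart. -/
theorem localRicci_chartBilin [FiniteDimensional ℝ E] (g : RiemMetric E M) {x₀ : M} {y : E}
    (hy : y ∈ (extChartAt 𝓘(ℝ, E) x₀).target) (v w : E) :
    localRicci (chartBilin g.inner x₀) y v w = ricci g ((extChartAt 𝓘(ℝ, E) x₀).symm y)
      (chartSymmDeriv x₀ y v) (chartSymmDeriv x₀ y w) := by
  have hy' : y ∈ coordDomain x₀ ((extChartAt 𝓘(ℝ, E) x₀).symm y) :=
    ⟨hy, mem_extChartAt_source _⟩
  rw [(isLocalIsometryOn_coordChange g x₀ _).localRicci_apply hy', fderiv_coordChange hy',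
    fderiv_coordChange hy']
  rfl

end Charts

/-! ### Spectral theorem for two eigenvalues. -/

section LinearAlgebra

variable {V : Type*} [AddCommGroup V] [Module ℝ V] [FiniteDimensional ℝ V]

/-- Simultaneous diagonalization of a symmetric bilinear form `R` and an inner product `B`, when
`R` has only the eigenvalues `a` and `b` with respect to `B`. -/
theorem exists_add_of_two_eigenvalues (B R : V →ₗ[ℝ] V →ₗ[ℝ] ℝ) (hB : ∀ v w, B v w = B w v)
    (hpos : ∀ v, v ≠ 0 → 0 < B v v) (hR : ∀ v w, R v w = R w v) {a b : ℝ}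
    (hspec : ∀ r v, v ≠ 0 → (∀ w, R v w = r * B v w) → r = a ∨ r = b) (v : V) :
    ∃ x y, v = x + y ∧ (∀ w, R x w = a * B x w) ∧ ∀ w, R y w = b * B y w := by
  -- With B as inner product, the operator B⁻¹R is symmetric, and its eigenvectors are those of R
  -- relative to B.
  let core : InnerProductSpace.Core ℝ V :=
    { inner := fun v w => B v w
      conj_inner_symm := fun v w => hB w v
      re_inner_nonneg := fun v => by
        rcases eq_or_ne v 0 with rfl | hv
        · simp
        · exact (hpos v hv).le
      add_left := fun v w x => by simp
      smul_left := fun v w c => by simp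
      definite := fun v hv => by
        by_contra hne
        exact (hpos v hne).ne' hv }
  let _ : NormedAddCommGroup V := core.toNormedAddCommGroup
  let _ : InnerProductSpace ℝ V := InnerProductSpace.ofCore core.toCore
  have hinner : ∀ v w : V, inner ℝ v w = B v w := fun v w => rfl
  have hinj : Function.Injective B := by
    rw [injective_iff_map_eq_zero]
    intro v hv
    by_contra hne
    exact (hpos v hne).ne' (by rw [hv]; rfl)
  let e : V ≃ₗ[ℝ] Module.Dual ℝ V := LinearEquiv.ofInjectiveOfFinrankEq (V' := Module.Dual ℝ V) B
    hinj (Subspace.dual_finrank_eq (K := ℝ) (V := V)).symm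
  have he : ∀ v w, e v w = B v w := fun v w => rfl
  let T : V →ₗ[ℝ] V := e.symm.toLinearMap.comp R
  have hT : ∀ v w, B (T v) w = R v w := by
    intro v w
    rw [← he]
    exact congrArg (fun l => l w) (e.apply_symm_apply (R v))
  have hsym : T.IsSymmetric := by
    intro v w
    rw [hinner, hinner, hT, hB, hT, hR]
  have heig : ∀ r x, x ∈ Module.End.eigenspace T r ↔ ∀ w, R x w = r * B x w := by
    intro r x
    rw [Module.End.mem_eigenspace_iff]
    constructor
    · intro h w
      rw [← hT, h]
      simp
    · intro h
      refine hinj (LinearMap.ext fun w => ?_)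
      rw [hT, h]
      simp
  have htop : (⨆ r : ℝ, Module.End.eigenspace T r) = ⊤ := by
    have := hsym.orthogonalComplement_iSup_eigenspaces_eq_bot
    rwa [Submodule.orthogonal_eq_bot_iff] at this
  have hle : (⨆ r : ℝ, Module.End.eigenspace T r)
      ≤ Module.End.eigenspace T a ⊔ Module.End.eigenspace T b := by
    refine iSup_le fun r => ?_
    by_cases h : r = a ∨ r = b
    · rcases h with rfl | rfl
      · exact le_sup_left
      · exact le_sup_right
    · intro x hx
      by_cases hx0 : x = 0
      · rw [hx0]
        exact zero_mem _
      · exact absurd (hspec r x hx0 ((heig r x).1 hx)) h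
  have hv : v ∈ Module.End.eigenspace T a ⊔ Module.End.eigenspace T b :=
    hle (htop ▸ Submodule.mem_top)
  obtain ⟨x, hx, y, hy, rfl⟩ := Submodule.mem_sup.1 hv
  exact ⟨x, y, rfl, (heig a x).1 hx, (heig b y).1 hy⟩

end LinearAlgebra

/-! ### Auxiliary smoothness and product rules. -/

section Local

variable {F : Type*} [NormedAddCommGroup F] [NormedSpace ℝ F]
  {G : F → F →L[ℝ] F →L[ℝ] ℝ} {U : Set F}

theorem covDeriv_comp {S T : F → F →L[ℝ] F} {y : F} (hS : DifferentiableAt ℝ S y)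
    (hT : DifferentiableAt ℝ T y) (u : F) :
    covDeriv G (fun z => (S z).comp (T z)) y u
      = (covDeriv G S y u).comp (T y) + (S y).comp (covDeriv G T y u) := by
  have h : fderiv ℝ (fun z => (S z).comp (T z)) y u
      = (S y).comp (fderiv ℝ T y u) + (fderiv ℝ S y u).comp (T y) :=
    congrArg (fun L => L u) (hS.hasFDerivAt.clm_comp hT.hasFDerivAt).fderiv
  simp only [covDeriv, h]
  ext v
  simp
  abel

theorem localExtDeriv_congr {V W : F → F →L[ℝ] F →L[ℝ] ℝ} {y : F} (h : V =ᶠ[𝓝 y] W)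
    (u v w : F) : localExtDeriv V y u v w = localExtDeriv W y u v w := by
  simp only [localExtDeriv, h.fderiv_eq]

variable [FiniteDimensional ℝ F]

/-- T v is obtained from the covector G(T v, ·) by the inverse metric, which is smooth. -/
theorem contDiffAt_of_metric (hG : IsMetricOn G U) {y : F} (hy : y ∈ U) {T : F → F →L[ℝ] F}
    (h : ∀ v w, ContDiffAt ℝ ∞ (fun z => G z (T z v) w) y) : ContDiffAt ℝ ∞ T y := by
  refine contDiffAt_of_clm_apply fun v => ?_
  have h1 : ContDiffAt ℝ ∞ (fun z => G z (T z v)) y := contDiffAt_of_clm_apply (h v)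
  refine ((hG.contDiffAt_inverse hy).clm_apply h1).congr_of_eventuallyEq ?_
  filter_upwards [hG.isOpen.mem_nhds hy] with z hz
  refine hG.ext hz fun w => ?_
  rw [apply_inverse_of_nondegenerate _ (hG.nondeg z hz)]

/-- The Ricci tensor as a continuous bilinear form. -/
noncomputable def ricciCLM (G : F → F →L[ℝ] F →L[ℝ] ℝ) (y : F) : F →L[ℝ] F →L[ℝ] ℝ :=
  LinearMap.toContinuousLinearMap
    ((LinearMap.toContinuousLinearMap (𝕜 := ℝ) (E := F) (F' := ℝ)).toLinearMap.comp
      (localRicci G y))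

theorem ricciCLM_apply (y v w : F) : ricciCLM G y v w = localRicci G y v w := rfl

theorem contDiffAt_ricciCLM (hG : IsMetricOn G U) {y : F} (hy : y ∈ U) :
    ContDiffAt ℝ ∞ (ricciCLM G) y :=
  contDiffAt_of_clm_apply₂ fun v w => contDiffAt_localRicci hG hy v w

end Local

/-! ### The eigenspace splitting and the almost Kähler flipped structure. -/

section Flip

variable {E : Type*} [NormedAddCommGroup E] [NormedSpace ℝ E]
  {M : Type*} [TopologicalSpace M] [ChartedSpace E M]

theorem forall_of_chart {P : M → Prop}
    (h : ∀ x₀ : M, ∀ y ∈ (extChartAt 𝓘(ℝ, E) x₀).target, P ((extChartAt 𝓘(ℝ, E) x₀).symm y))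
    (x : M) : P x := by
  have := h x _ (mem_extChartAt_target (I := 𝓘(ℝ, E)) x)
  rwa [(extChartAt 𝓘(ℝ, E) x).left_inv (mem_extChartAt_source x)] at this

variable [IsManifold 𝓘(ℝ, E) ∞ M] {g : RiemMetric E M} {J J' : EndoField E M}

theorem isHermitianOn_chart (hJ : IsOrthogonalAlmostComplex g J) (x₀ : M) :
    IsHermitianOn (chartBilin g.inner x₀) (chartEndo J x₀) (extChartAt 𝓘(ℝ, E) x₀).target where
  contDiffOn := (isSmoothEndo_iff J).1 hJ.smooth x₀
  sq y hy v := by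
    rw [chartEndo_apply, chartSymmDeriv_chartEndo J hy]
    rw [← chartDeriv_chartSymmDeriv hy (-v), map_neg]
    congr 1
    exact hJ.sq _ (chartSymmDeriv x₀ y v)
  orthogonal y hy v w := by
    rw [chartBilin_apply, chartSymmDeriv_chartEndo J hy, chartSymmDeriv_chartEndo J hy]
    exact hJ.orthogonal ((extChartAt 𝓘(ℝ, E) x₀).symm y) (chartSymmDeriv x₀ y v)
      (chartSymmDeriv x₀ y w)

theorem chartBilin_fundamentalForm (g : RiemMetric E M) (J : EndoField E M) (x₀ : M) {y : E}
    (hy : y ∈ (extChartAt 𝓘(ℝ, E) x₀).target) :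
    chartBilin (fundamentalForm g J) x₀ y
      = (chartBilin g.inner x₀ y).comp (chartEndo J x₀ y) := by
  ext v w
  change _ = chartBilin g.inner x₀ y (chartEndo J x₀ y v) w
  rw [chartBilin_apply, chartBilin_apply, chartSymmDeriv_chartEndo J hy]
  rfl

theorem localExtDeriv_fundamentalForm (g : RiemMetric E M) (J : EndoField E M) (x₀ : M) {y : E}
    (hy : y ∈ (extChartAt 𝓘(ℝ, E) x₀).target) (u v w : E) :
    localExtDeriv (chartBilin (fundamentalForm g J) x₀) y u v w = localExtDeriv
      (fun z => (chartBilin g.inner x₀ z).comp (chartEndo J x₀ z)) y u v w := by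
  refine localExtDeriv_congr ?_ u v w
  filter_upwards [(isOpen_chart_target x₀).mem_nhds hy] with z hz using
    chartBilin_fundamentalForm g J x₀ hz

variable [FiniteDimensional ℝ E]

/-- The complex structure of a Kähler manifold is parallel. -/
theorem IsKahler.covDeriv_eq_zero (h : IsKahler g J) (x₀ : M) {y : E}
    (hy : y ∈ (extChartAt 𝓘(ℝ, E) x₀).target) (u : E) :
    covDeriv (chartBilin g.inner x₀) (chartEndo J x₀) y u = 0 :=
  covDeriv_eq_zero_of_kahler (isMetricOn_chartBilin g x₀)
    (isHermitianOn_chart h.almostKahler.almostComplex x₀) hy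
    (fun u v w => by
      rw [← localExtDeriv_fundamentalForm g J x₀ hy]
      exact h.almostKahler.symplectic.closed x₀ y hy u v w)
    (h.integrable x₀ y hy) u

theorem isIntegrable_of_covDeriv_eq_zero (g : RiemMetric E M)
    (h : ∀ x₀ : M, ∀ y ∈ (extChartAt 𝓘(ℝ, E) x₀).target, ∀ u,
      covDeriv (chartBilin g.inner x₀) (chartEndo J x₀) y u = 0) : IsIntegrable J := by
  intro x₀ y hy v w
  rw [localNijenhuis_eq (isMetricOn_chartBilin g x₀) hy]
  simp [h x₀ y hy]

theorem ricci_symm (g : RiemMetric E M) (x : M) (v w : TangentSpace 𝓘(ℝ, E) x) :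
    ricci g x v w = ricci g x w v :=
  (isMetricOn_chartBilin g x).localRicci_symm (mem_extChartAt_target x) _ _

/-- The Ricci tensor of a Kähler manifold is invariant under the complex structure. -/
theorem IsKahler.ricci_invariant (h : IsKahler g J) (x : M) :
    ∀ v w : TangentSpace 𝓘(ℝ, E) x, ricci g x (J x v) (J x w) = ricci g x v w := by
  refine forall_of_chart (E := E) (P := fun x => ∀ v w : TangentSpace 𝓘(ℝ, E) x,
    ricci g x (J x v) (J x w) = ricci g x v w) (fun x₀ y hy v w => ?_) x
  have hv := chartSymmDeriv_chartDeriv hy v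
  have hw := chartSymmDeriv_chartDeriv hy w
  have h1 := localRicci_invariant (isMetricOn_chartBilin g x₀)
    (isHermitianOn_chart h.almostKahler.almostComplex x₀)
    (fun z hz u => h.covDeriv_eq_zero x₀ hz u) hy
    (chartDeriv x₀ ((extChartAt 𝓘(ℝ, E) x₀).symm y) v)
    (chartDeriv x₀ ((extChartAt 𝓘(ℝ, E) x₀).symm y) w)
  rw [localRicci_chartBilin g hy, localRicci_chartBilin g hy, chartSymmDeriv_chartEndo J hy,
    chartSymmDeriv_chartEndo J hy, hv, hw] at h1
  exact h1

theorem IsKahler.mem_ricciEigenspace (h : IsKahler g J) {r : ℝ} {x : M}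
    {v : TangentSpace 𝓘(ℝ, E) x} (hv : v ∈ ricciEigenspace g r x) :
    J x v ∈ ricciEigenspace g r x := by
  intro w
  have h1 := h.almostKahler.almostComplex.sq x w
  have h2 : w = -J x (J x w) := by rw [h1, neg_neg]
  rw [h2, map_neg, map_neg, h.ricci_invariant, h.almostKahler.almostComplex.orthogonal,
    hv (J x w), mul_neg]

variable {lam mu : ℝ}

theorem exists_add_of_ricciEigenvalues
    (hRic : ∀ (x : M) (r : ℝ), IsRicciEigenvalue g r x ↔ r = lam ∨ r = mu) (x : M)
    (v : TangentSpace 𝓘(ℝ, E) x) :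
    ∃ a ∈ ricciEigenspace g lam x, ∃ b ∈ ricciEigenspace g mu x, v = a + b := by
  have : FiniteDimensional ℝ (TangentSpace 𝓘(ℝ, E) x) := inferInstanceAs (FiniteDimensional ℝ E)
  let B : TangentSpace 𝓘(ℝ, E) x →ₗ[ℝ] TangentSpace 𝓘(ℝ, E) x →ₗ[ℝ] ℝ :=
    LinearMap.mk₂ ℝ (fun v w => g.inner x v w) (fun _ _ _ => by simp) (fun _ _ _ => by simp)
      (fun _ _ _ => by simp) (fun _ _ _ => by simp)
  obtain ⟨a, b, rfl, ha, hb⟩ := exists_add_of_two_eigenvalues B (ricci g x) (g.symm x) (g.pos x)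
    (ricci_symm g x) (a := lam) (b := mu) (fun r v hv h => (hRic x r).1 fun hbot => hv (by
      have : v ∈ ricciEigenspace g r x := h
      rwa [hbot, Submodule.mem_bot] at this)) v
  exact ⟨a, ha, b, hb, rfl⟩

theorem ricciEigenspace_orthogonal (g : RiemMetric E M) (hne : lam ≠ mu) {x : M}
    {a b : TangentSpace 𝓘(ℝ, E) x} (ha : a ∈ ricciEigenspace g lam x)
    (hb : b ∈ ricciEigenspace g mu x) : g.inner x a b = 0 := by
  have h1 := ha b
  have h2 := hb a
  rw [ricci_symm, h1, g.symm x b a] at h2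
  have h3 : (lam - mu) * g.inner x a b = 0 := by linarith
  exact (mul_eq_zero.1 h3).resolve_left (sub_ne_zero.2 hne)

theorem isCompl_ricciEigenspace (hne : lam ≠ mu)
    (hRic : ∀ (x : M) (r : ℝ), IsRicciEigenvalue g r x ↔ r = lam ∨ r = mu) (x : M) :
    IsCompl (ricciEigenspace g lam x) (ricciEigenspace g mu x) := by
  constructor
  · rw [Submodule.disjoint_def]
    intro v h1 h2
    by_contra hv
    exact (g.pos x v hv).ne' (ricciEigenspace_orthogonal g hne h1 h2)
  · rw [codisjoint_iff, eq_top_iff]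
    intro v _
    obtain ⟨a, ha, b, hb, rfl⟩ := exists_add_of_ricciEigenvalues hRic x v
    exact Submodule.add_mem_sup ha hb

theorem existsUnique_isFlip (J : EndoField E M) (hne : lam ≠ mu)
    (hRic : ∀ (x : M) (r : ℝ), IsRicciEigenvalue g r x ↔ r = lam ∨ r = mu) :
    ∃! J' : EndoField E M, IsFlip g J lam mu J' := by
  have hex : ∀ x : M, ∃ L : TangentSpace 𝓘(ℝ, E) x →L[ℝ] TangentSpace 𝓘(ℝ, E) x,
      (∀ v ∈ ricciEigenspace g lam x, L v = J x v) ∧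
        ∀ v ∈ ricciEigenspace g mu x, L v = -(J x v) := by
    intro x
    have hc := isCompl_ricciEigenspace hne hRic x
    let K : TangentSpace 𝓘(ℝ, E) x →ₗ[ℝ] TangentSpace 𝓘(ℝ, E) x := J x
    let L₀ := LinearMap.ofIsCompl hc (K.domRestrict _) (-(K.domRestrict _))
    let L : E →L[ℝ] E := LinearMap.toContinuousLinearMap (show E →ₗ[ℝ] E from L₀)
    refine ⟨L, fun v hv => ?_, fun v hv => ?_⟩
    · exact LinearMap.ofIsCompl_apply_left hc ⟨v, hv⟩
    · exact LinearMap.ofIsCompl_apply_right hc ⟨v, hv⟩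
  choose L hL using hex
  refine ⟨L, hL, fun L' hL' => funext fun x => ContinuousLinearMap.ext fun v => ?_⟩
  obtain ⟨a, ha, b, hb, rfl⟩ := exists_add_of_ricciEigenvalues hRic x v
  rw [map_add, map_add, (hL' x).1 a ha, (hL' x).2 b hb, (hL x).1 a ha, (hL x).2 b hb]

namespace IsFlip

/-- The fundamental form of the flipped structure is a combination of the Kähler form and the
Ricci form. -/
theorem inner_apply (hF : IsFlip g J lam mu J') (hJ : IsKahler g J)
    (hRic : ∀ (x : M) (r : ℝ), IsRicciEigenvalue g r x ↔ r = lam ∨ r = mu) (x : M)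
    (v w : TangentSpace 𝓘(ℝ, E) x) :
    (mu - lam) * g.inner x (J' x v) w
      = (lam + mu) * g.inner x (J x v) w - 2 * ricci g x (J x v) w := by
  -- On E_λ the right side has the factor (λ+μ) − 2λ = μ − λ, on E_μ the factor (λ+μ) − 2μ = −(μ −
  -- λ).
  obtain ⟨a, ha, b, hb, rfl⟩ := exists_add_of_ricciEigenvalues hRic x v
  have h1 := hJ.mem_ricciEigenspace ha w
  have h2 := hJ.mem_ricciEigenspace hb w
  simp only [map_add, (hF x).1 a ha, (hF x).2 b hb, add_apply, LinearMap.add_apply, h1, h2,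
    map_neg, neg_apply]
  ring

theorem sq (hF : IsFlip g J lam mu J') (hJ : IsKahler g J)
    (hRic : ∀ (x : M) (r : ℝ), IsRicciEigenvalue g r x ↔ r = lam ∨ r = mu) (x : M)
    (v : TangentSpace 𝓘(ℝ, E) x) : J' x (J' x v) = -v := by
  obtain ⟨a, ha, b, hb, rfl⟩ := exists_add_of_ricciEigenvalues hRic x v
  have s := hJ.almostKahler.almostComplex.sq x
  rw [map_add, (hF x).1 a ha, (hF x).2 b hb, map_add, map_neg,
    (hF x).1 _ (hJ.mem_ricciEigenspace ha), (hF x).2 _ (hJ.mem_ricciEigenspace hb), s, s]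
  abel

theorem comm (hF : IsFlip g J lam mu J') (hJ : IsKahler g J)
    (hRic : ∀ (x : M) (r : ℝ), IsRicciEigenvalue g r x ↔ r = lam ∨ r = mu) (x : M)
    (v : TangentSpace 𝓘(ℝ, E) x) : J x (J' x v) = J' x (J x v) := by
  obtain ⟨a, ha, b, hb, rfl⟩ := exists_add_of_ricciEigenvalues hRic x v
  rw [map_add, map_add, map_add, map_add, (hF x).1 a ha, (hF x).2 b hb,
    (hF x).1 _ (hJ.mem_ricciEigenspace ha), (hF x).2 _ (hJ.mem_ricciEigenspace hb), map_neg]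

theorem orthogonal (hF : IsFlip g J lam mu J') (hJ : IsKahler g J) (hne : lam ≠ mu)
    (hRic : ∀ (x : M) (r : ℝ), IsRicciEigenvalue g r x ↔ r = lam ∨ r = mu) (x : M)
    (v w : TangentSpace 𝓘(ℝ, E) x) : g.inner x (J' x v) (J' x w) = g.inner x v w := by
  obtain ⟨a, ha, b, hb, rfl⟩ := exists_add_of_ricciEigenvalues hRic x v
  obtain ⟨c, hc, d, hd, rfl⟩ := exists_add_of_ricciEigenvalues hRic x w
  have o := hJ.almostKahler.almostComplex.orthogonal x
  have h1 := ricciEigenspace_orthogonal g hne ha hd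
  have h2 := ricciEigenspace_orthogonal g hne hc hb
  rw [g.symm] at h2
  simp only [map_add, (hF x).1 a ha, (hF x).2 b hb, (hF x).1 c hc, (hF x).2 d hd, add_apply,
    map_neg, neg_apply, o, h1, h2]
  ring

theorem chart_apply (hF : IsFlip g J lam mu J') (hJ : IsKahler g J)
    (hRic : ∀ (x : M) (r : ℝ), IsRicciEigenvalue g r x ↔ r = lam ∨ r = mu) (x₀ : M) {y : E}
    (hy : y ∈ (extChartAt 𝓘(ℝ, E) x₀).target) (v w : E) :
    (mu - lam) * chartBilin g.inner x₀ y (chartEndo J' x₀ y v) w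
      = (lam + mu) * chartBilin g.inner x₀ y (chartEndo J x₀ y v) w
        - 2 * localRicci (chartBilin g.inner x₀) y (chartEndo J x₀ y v) w := by
  rw [chartBilin_apply, chartBilin_apply, localRicci_chartBilin g hy,
    chartSymmDeriv_chartEndo J hy, chartSymmDeriv_chartEndo J' hy]
  exact hF.inner_apply hJ hRic _ (chartSymmDeriv x₀ y v) (chartSymmDeriv x₀ y w)

theorem isOrthogonalAlmostComplex (hF : IsFlip g J lam mu J') (hJ : IsKahler g J)
    (hne : lam ≠ mu)
    (hRic : ∀ (x : M) (r : ℝ), IsRicciEigenvalue g r x ↔ r = lam ∨ r = mu) :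
    IsOrthogonalAlmostComplex g J' where
  smooth := by
    rw [isSmoothEndo_iff]
    intro x₀ y hy
    have hG := isMetricOn_chartBilin g x₀
    have hJs : ContDiffAt ℝ ∞ (chartEndo J x₀) y :=
      ((isSmoothEndo_iff J).1 hJ.almostKahler.almostComplex.smooth x₀).contDiffAt
        (hG.isOpen.mem_nhds hy)
    -- Smoothness is read off from the formula for g(J'v, w) in terms of g, J and Ric; no smooth
    -- frames of the eigenspaces are needed.
    refine (contDiffAt_of_metric hG hy fun v w => ?_).contDiffWithinAt
    have hJv := hJs.clm_apply (contDiffAt_const (c := v))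
    have h1 := ((hG.contDiffAt hy).clm_apply hJv).clm_apply (contDiffAt_const (c := w))
    have h2 := ((contDiffAt_ricciCLM hG hy).clm_apply hJv).clm_apply (contDiffAt_const (c := w))
    have h3 := contDiffAt_const (c := (mu - lam)⁻¹) |>.mul
      (((contDiffAt_const (c := lam + mu)).mul h1).sub ((contDiffAt_const (c := (2 : ℝ))).mul h2))
    refine h3.congr_of_eventuallyEq ?_
    filter_upwards [hG.isOpen.mem_nhds hy] with z hz
    rw [eq_inv_mul_iff_mul_eq₀ (sub_ne_zero.2 hne.symm), ricciCLM_apply]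
    exact hF.chart_apply hJ hRic x₀ hz v w
  sq := hF.sq hJ hRic
  orthogonal := hF.orthogonal hJ hne hRic

theorem isAlmostKahler (hF : IsFlip g J lam mu J') (hJ : IsKahler g J) (hne : lam ≠ mu)
    (hRic : ∀ (x : M) (r : ℝ), IsRicciEigenvalue g r x ↔ r = lam ∨ r = mu) :
    IsAlmostKahler g J' where
  almostComplex := hF.isOrthogonalAlmostComplex hJ hne hRic
  symplectic := by
    have hac := hF.isOrthogonalAlmostComplex hJ hne hRic
    refine ⟨?_, fun x v => ?_, fun x v h => ?_, fun x₀ y hy u v w => ?_⟩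
    · rw [isSmoothBilin_iff]
      intro x₀
      refine ((isMetricOn_chartBilin g x₀).contDiffOn.clm_comp
        ((isSmoothEndo_iff J').1 hac.smooth x₀)).congr fun y hy =>
        chartBilin_fundamentalForm g J' x₀ hy
    · have h1 := hac.orthogonal x (J' x v) v
      rw [hac.sq, map_neg, neg_apply, g.symm] at h1
      change g.inner x (J' x v) v = 0
      linarith
    · by_contra hv
      have h1 := h (J' x v)
      exact (g.pos x v hv).ne' ((hac.orthogonal x v v).symm.trans h1)
    · have hG := isMetricOn_chartBilin g x₀
      have hH := isHermitianOn_chart hJ.almostKahler.almostComplex x₀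
      have hH' := isHermitianOn_chart hac x₀
      have hJd := hH.differentiableAt hG hy
      have hJd' := hH'.differentiableAt hG hy
      rw [localExtDeriv_fundamentalForm g J' x₀ hy]
      set W' := fun z => (chartBilin g.inner x₀ z).comp (chartEndo J' x₀ z)
      set W := fun z => (chartBilin g.inner x₀ z).comp (chartEndo J x₀ z)
      set P := fun z => (ricciCLM (chartBilin g.inner x₀) z).comp (chartEndo J x₀ z)
      have hW : DifferentiableAt ℝ W y := (hG.differentiableAt hy).clm_comp hJd
      have hP : DifferentiableAt ℝ P y :=
        ((contDiffAt_ricciCLM hG hy).differentiableAt (by simp)).clm_comp hJd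
      have hWd : ∀ u v w, localExtDeriv W y u v w = 0 := fun u v w => by
        rw [← localExtDeriv_fundamentalForm g J x₀ hy]
        exact hJ.almostKahler.symplectic.closed x₀ y hy u v w
      have hPd := localExtDeriv_ricciForm hG hH (fun z hz u => hJ.covDeriv_eq_zero x₀ hz u)
        (P := P) hy hP (fun z _ v w => rfl)
      have hne' : mu - lam ≠ 0 := sub_ne_zero.2 hne.symm
      -- The flipped form is a constant-coefficient combination of the Kähler form W and the Ricci
      -- form P, both closed.
      have he : W' =ᶠ[𝓝 y]
          fun z => (mu - lam)⁻¹ • ((lam + mu) • W z - (2 : ℝ) • P z) := by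
        filter_upwards [hG.isOpen.mem_nhds hy] with z hz
        ext v w
        refine (eq_inv_mul_iff_mul_eq₀ hne').2 ?_
        exact hF.chart_apply hJ hRic x₀ hz v w
      have hd := ((hW.hasFDerivAt.const_smul (lam + mu)).sub
        (hP.hasFDerivAt.const_smul (2 : ℝ))).const_smul (mu - lam)⁻¹
      rw [localExtDeriv_congr he]
      have e1 := hWd u v w
      have e2 := hPd u v w
      simp only [localExtDeriv] at e1 e2 ⊢
      erw [hd.fderiv]
      simp
      linear_combination ((mu - lam)⁻¹ * (lam + mu)) * e1 - ((mu - lam)⁻¹ * 2) * e2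

end IsFlip

end Flip

/-! ### From a local product to a parallel flipped structure. -/

section ProductChart

variable {E : Type*} [NormedAddCommGroup E] [NormedSpace ℝ E]
  {M : Type*} [TopologicalSpace M] [ChartedSpace E M]
  {E₁ : Type*} [NormedAddCommGroup E₁] [NormedSpace ℝ E₁]
  {M₁ : Type*} [TopologicalSpace M₁] [ChartedSpace E₁ M₁]
  {E₂ : Type*} [NormedAddCommGroup E₂] [NormedSpace ℝ E₂]
  {M₂ : Type*} [TopologicalSpace M₂] [ChartedSpace E₂ M₂]

/-- The coordinate expression of a map into a product of two manifolds. -/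
noncomputable def productCoord (Φ : M → M₁ × M₂) (x₀ : M) (x₁ : M₁) (x₂ : M₂) (z : E) :
    E₁ × E₂ :=
  (extChartAt 𝓘(ℝ, E₁) x₁ (Φ ((extChartAt 𝓘(ℝ, E) x₀).symm z)).1,
    extChartAt 𝓘(ℝ, E₂) x₂ (Φ ((extChartAt 𝓘(ℝ, E) x₀).symm z)).2)

/-- The domain of the coordinate expression of a map into a product of two manifolds. -/
def productDomain (Φ : OpenPartialHomeomorph M (M₁ × M₂)) (x₀ : M) (x₁ : M₁) (x₂ : M₂) : Set E :=
  (extChartAt 𝓘(ℝ, E) x₀).target ∩ (extChartAt 𝓘(ℝ, E) x₀).symm ⁻¹' (Φ.source ∩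
    Φ ⁻¹' ((extChartAt 𝓘(ℝ, E₁) x₁).source ×ˢ (extChartAt 𝓘(ℝ, E₂) x₂).source))

theorem isOpen_productDomain (Φ : OpenPartialHomeomorph M (M₁ × M₂)) (x₀ : M) (x₁ : M₁)
    (x₂ : M₂) : IsOpen (productDomain (E := E) (E₁ := E₁) (E₂ := E₂) Φ x₀ x₁ x₂) :=
  (continuousOn_extChartAt_symm x₀).isOpen_inter_preimage (isOpen_chart_target x₀)
    (Φ.isOpen_inter_preimage ((isOpen_extChartAt_source x₁).prod (isOpen_extChartAt_source x₂)))

variable [IsManifold 𝓘(ℝ, E) ∞ M]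

theorem chartBilin_chartDeriv (B : BilinField E M) {x₀ p : M}
    (hp : p ∈ (extChartAt 𝓘(ℝ, E) x₀).source) (v w : TangentSpace 𝓘(ℝ, E) p) :
    chartBilin B x₀ (extChartAt 𝓘(ℝ, E) x₀ p) (chartDeriv (E := E) x₀ p v)
      (chartDeriv (E := E) x₀ p w) = B p v w := by
  obtain ⟨y, hy, rfl⟩ : ∃ y ∈ (extChartAt 𝓘(ℝ, E) x₀).target,
      (extChartAt 𝓘(ℝ, E) x₀).symm y = p :=
    ⟨_, (extChartAt 𝓘(ℝ, E) x₀).map_source hp, (extChartAt 𝓘(ℝ, E) x₀).left_inv hp⟩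
  rw [(extChartAt 𝓘(ℝ, E) x₀).right_inv hy, chartBilin_apply]
  have hv := chartSymmDeriv_chartDeriv hy v
  have hw := chartSymmDeriv_chartDeriv hy w
  rw [hv, hw]

theorem IsEinstein.localRicci_eq [FiniteDimensional ℝ E] {g : RiemMetric E M} {c : ℝ}
    (h : IsEinstein g c) {x₀ : M} {y : E} (hy : y ∈ (extChartAt 𝓘(ℝ, E) x₀).target) (v w : E) :
    localRicci (chartBilin g.inner x₀) y v w = c * chartBilin g.inner x₀ y v w := by
  rw [localRicci_chartBilin g hy, chartBilin_apply]
  exact h _ (chartSymmDeriv x₀ y v) (chartSymmDeriv x₀ y w)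

variable [IsManifold 𝓘(ℝ, E₁) ∞ M₁] [IsManifold 𝓘(ℝ, E₂) ∞ M₂]
  {g : RiemMetric E M} {g₁ : RiemMetric E₁ M₁} {g₂ : RiemMetric E₂ M₂}
  {Φ : OpenPartialHomeomorph M (M₁ × M₂)}

theorem contMDiffOn_chart (x₀ : M) : ContMDiffOn 𝓘(ℝ, E) 𝓘(ℝ, E) ∞ (extChartAt 𝓘(ℝ, E) x₀)
    (extChartAt 𝓘(ℝ, E) x₀).source := by
  rw [extChartAt_source]
  exact contMDiffOn_extChartAt

theorem contDiffOn_productCoord (h : IsLocalProductIsometry g g₁ g₂ Φ) (x₀ : M) (x₁ : M₁)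
    (x₂ : M₂) : ContDiffOn ℝ ∞ (productCoord (E := E) (E₁ := E₁) (E₂ := E₂) Φ x₀ x₁ x₂)
      (productDomain (E₁ := E₁) (E₂ := E₂) Φ x₀ x₁ x₂) := by
  have hΦ : ContMDiffOn 𝓘(ℝ, E) (𝓘(ℝ, E₁).prod 𝓘(ℝ, E₂)) ∞
      (fun z : E => Φ ((extChartAt 𝓘(ℝ, E) x₀).symm z))
      (productDomain (E₁ := E₁) (E₂ := E₂) Φ x₀ x₁ x₂) :=
    h.smooth.comp ((contMDiffOn_extChartAt_symm x₀).mono Set.inter_subset_left)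
      fun z hz => hz.2.1
  refine ContDiffOn.prodMk ?_ ?_
  · rw [← contMDiffOn_iff_contDiffOn]
    exact (contMDiffOn_chart x₁).comp (contMDiff_fst.comp_contMDiffOn hΦ) fun z hz => hz.2.2.1
  · rw [← contMDiffOn_iff_contDiffOn]
    exact (contMDiffOn_chart x₂).comp (contMDiff_snd.comp_contMDiffOn hΦ) fun z hz => hz.2.2.2

theorem fderiv_productCoord (h : IsLocalProductIsometry g g₁ g₂ Φ) {x₀ : M} {x₁ : M₁}
    {x₂ : M₂} {z : E} (hz : z ∈ productDomain (E₁ := E₁) (E₂ := E₂) Φ x₀ x₁ x₂) (v : E) :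
    fderiv ℝ (productCoord (E := E) (E₁ := E₁) (E₂ := E₂) Φ x₀ x₁ x₂) z v
      = (chartDeriv (E := E₁) x₁ (Φ ((extChartAt 𝓘(ℝ, E) x₀).symm z)).1
          (mfderiv 𝓘(ℝ, E) 𝓘(ℝ, E₁) (fun z => (Φ z).1) ((extChartAt 𝓘(ℝ, E) x₀).symm z)
            (chartSymmDeriv x₀ z v)),
        chartDeriv (E := E₂) x₂ (Φ ((extChartAt 𝓘(ℝ, E) x₀).symm z)).2
          (mfderiv 𝓘(ℝ, E) 𝓘(ℝ, E₂) (fun z => (Φ z).2) ((extChartAt 𝓘(ℝ, E) x₀).symm z)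
            (chartSymmDeriv x₀ z v))) := by
  set x := (extChartAt 𝓘(ℝ, E) x₀).symm z with hx
  have hΦ : ContMDiffAt 𝓘(ℝ, E) (𝓘(ℝ, E₁).prod 𝓘(ℝ, E₂)) ∞ Φ x :=
    h.smooth.contMDiffAt (Φ.open_source.mem_nhds hz.2.1)
  have h1 : MDifferentiableAt 𝓘(ℝ, E) 𝓘(ℝ, E₁) (fun z => (Φ z).1) x :=
    (contMDiffAt_fst.comp x hΦ).mdifferentiableAt (by simp)
  have h2 : MDifferentiableAt 𝓘(ℝ, E) 𝓘(ℝ, E₂) (fun z => (Φ z).2) x :=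
    (contMDiffAt_snd.comp x hΦ).mdifferentiableAt (by simp)
  have hs := (mdifferentiableAt_chart_symm hz.1).hasMFDerivAt
  have c1 := ((mdifferentiableAt_chart hz.2.2.1).hasMFDerivAt.comp x h1.hasMFDerivAt).comp z hs
  have c2 := ((mdifferentiableAt_chart hz.2.2.2).hasMFDerivAt.comp x h2.hasMFDerivAt).comp z hs
  have d1 := hasMFDerivAt_iff_hasFDerivAt.1 c1
  have d2 := hasMFDerivAt_iff_hasFDerivAt.1 c2
  have d : HasFDerivAt (productCoord (E := E) (E₁ := E₁) (E₂ := E₂) Φ x₀ x₁ x₂) _ z :=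
    HasFDerivAt.prodMk (𝕜 := ℝ) (E := E) (F := E₁) (G := E₂) d1 d2
  rw [d.fderiv]
  rfl

/-- The coordinate expression of Φ⁻¹ is differentiable and inverts that of Φ locally on both sides,
so the derivatives are mutually inverse. -/
theorem productCoord_bijective (h : IsLocalProductIsometry g g₁ g₂ Φ) {x₀ : M} {x₁ : M₁}
    {x₂ : M₂} {z : E} (hz : z ∈ productDomain (E₁ := E₁) (E₂ := E₂) Φ x₀ x₁ x₂) :
    Function.Bijective
      (fderiv ℝ (productCoord (E := E) (E₁ := E₁) (E₂ := E₂) Φ x₀ x₁ x₂) z) := by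
  set φ := productCoord (E := E) (E₁ := E₁) (E₂ := E₂) Φ x₀ x₁ x₂ with hφ
  set x := (extChartAt 𝓘(ℝ, E) x₀).symm z with hx
  let c : E₁ × E₂ → M₁ × M₂ := fun w =>
    ((extChartAt 𝓘(ℝ, E₁) x₁).symm w.1, (extChartAt 𝓘(ℝ, E₂) x₂).symm w.2)
  let ψ : E₁ × E₂ → E := fun w => extChartAt 𝓘(ℝ, E) x₀ (Φ.symm (c w))
  have hc : ∀ z' ∈ productDomain (E₁ := E₁) (E₂ := E₂) Φ x₀ x₁ x₂,
      c (φ z') = Φ ((extChartAt 𝓘(ℝ, E) x₀).symm z') := fun z' hz' =>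
    Prod.ext ((extChartAt 𝓘(ℝ, E₁) x₁).left_inv hz'.2.2.1)
      ((extChartAt 𝓘(ℝ, E₂) x₂).left_inv hz'.2.2.2)
  have hψφ : ∀ z' ∈ productDomain (E₁ := E₁) (E₂ := E₂) Φ x₀ x₁ x₂, ψ (φ z') = z' := by
    intro z' hz'
    simp only [ψ]
    rw [hc z' hz', Φ.left_inv hz'.2.1, (extChartAt 𝓘(ℝ, E) x₀).right_inv hz'.1]
  have hcx : c (φ z) = Φ x := hc z hz
  have ht1 : (φ z).1 ∈ (extChartAt 𝓘(ℝ, E₁) x₁).target :=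
    (extChartAt 𝓘(ℝ, E₁) x₁).map_source hz.2.2.1
  have ht2 : (φ z).2 ∈ (extChartAt 𝓘(ℝ, E₂) x₂).target :=
    (extChartAt 𝓘(ℝ, E₂) x₂).map_source hz.2.2.2
  have hcd : MDifferentiableAt 𝓘(ℝ, E₁ × E₂) (𝓘(ℝ, E₁).prod 𝓘(ℝ, E₂)) c (φ z) :=
    ((mdifferentiableAt_chart_symm ht1).comp (φ z)
      (differentiableAt_fst (𝕜 := ℝ)).mdifferentiableAt).prodMk
    ((mdifferentiableAt_chart_symm ht2).comp (φ z)
      (differentiableAt_snd (𝕜 := ℝ)).mdifferentiableAt)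
  have hΦs : MDifferentiableAt (𝓘(ℝ, E₁).prod 𝓘(ℝ, E₂)) 𝓘(ℝ, E) Φ.symm (c (φ z)) := by
    refine (h.smooth_symm.contMDiffAt (Φ.open_target.mem_nhds ?_)).mdifferentiableAt (by simp)
    rw [hcx]
    exact Φ.map_source hz.2.1
  have hψd : DifferentiableAt ℝ ψ (φ z) := by
    rw [← mdifferentiableAt_iff_differentiableAt]
    refine MDifferentiableAt.comp (φ z) (mdifferentiableAt_chart ?_) (hΦs.comp (φ z) hcd)
    rw [hcx, Φ.left_inv hz.2.1]
    exact (extChartAt 𝓘(ℝ, E) x₀).map_target hz.1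
  have hφd : DifferentiableAt ℝ φ z := ((contDiffOn_productCoord h x₀ x₁ x₂).contDiffAt
    ((isOpen_productDomain Φ x₀ x₁ x₂).mem_nhds hz)).differentiableAt (by simp)
  have hψz : ψ (φ z) = z := hψφ z hz
  have h1 : (fderiv ℝ ψ (φ z)).comp (fderiv ℝ φ z) = ContinuousLinearMap.id ℝ E :=
    (hψd.hasFDerivAt.comp z hφd.hasFDerivAt).unique
      ((hasFDerivAt_id z).congr_of_eventuallyEq (by
        filter_upwards [(isOpen_productDomain Φ x₀ x₁ x₂).mem_nhds hz] with z' hz' using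
          hψφ z' hz'))
  have h2 : (fderiv ℝ φ z).comp (fderiv ℝ ψ (φ z)) = ContinuousLinearMap.id ℝ (E₁ × E₂) := by
    rw [← hψz] at hφd
    have e1 := hφd.hasFDerivAt.comp (φ z) hψd.hasFDerivAt
    rw [hψz] at e1
    refine e1.unique ((hasFDerivAt_id (φ z)).congr_of_eventuallyEq ?_)
    have n1 : ∀ᶠ w in 𝓝 (φ z), w ∈ (extChartAt 𝓘(ℝ, E₁) x₁).target ×ˢ
        (extChartAt 𝓘(ℝ, E₂) x₂).target :=
      ((isOpen_chart_target x₁).prod (isOpen_chart_target x₂)).mem_nhds ⟨ht1, ht2⟩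
    have n2 : ∀ᶠ w in 𝓝 (φ z), c w ∈ Φ.target := by
      refine hcd.continuousAt.eventually (Φ.open_target.mem_nhds ?_)
      rw [hcx]
      exact Φ.map_source hz.2.1
    have n3 : ∀ᶠ w in 𝓝 (φ z), Φ.symm (c w) ∈ (extChartAt 𝓘(ℝ, E) x₀).source := by
      refine (hΦs.continuousAt.comp hcd.continuousAt).eventually
        ((isOpen_extChartAt_source x₀).mem_nhds ?_)
      simp only [Function.comp_apply]
      rw [hcx, Φ.left_inv hz.2.1]
      exact (extChartAt 𝓘(ℝ, E) x₀).map_target hz.1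
    filter_upwards [n1, n2, n3] with w hw1 hw2 hw3
    have e2 : Φ ((extChartAt 𝓘(ℝ, E) x₀).symm (ψ w)) = c w := by
      simp only [ψ]
      rw [(extChartAt 𝓘(ℝ, E) x₀).left_inv hw3, Φ.right_inv hw2]
    refine Prod.ext ?_ ?_
    · change extChartAt 𝓘(ℝ, E₁) x₁ (Φ ((extChartAt 𝓘(ℝ, E) x₀).symm (ψ w))).1 = w.1
      rw [e2]
      exact (extChartAt 𝓘(ℝ, E₁) x₁).right_inv hw1.1
    · change extChartAt 𝓘(ℝ, E₂) x₂ (Φ ((extChartAt 𝓘(ℝ, E) x₀).symm (ψ w))).2 = w.2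
      rw [e2]
      exact (extChartAt 𝓘(ℝ, E₂) x₂).right_inv hw1.2
  exact Function.bijective_iff_has_inverse.2 ⟨fderiv ℝ ψ (φ z),
    fun v => congrArg (fun L => L v) h1, fun v => congrArg (fun L => L v) h2⟩

variable [FiniteDimensional ℝ E₁] [FiniteDimensional ℝ E₂]

theorem isLocalIsometryOn_productCoord (h : IsLocalProductIsometry g g₁ g₂ Φ) (x₀ : M) (x₁ : M₁)
    (x₂ : M₂) :
    IsLocalIsometryOn (productCoord (E := E) (E₁ := E₁) (E₂ := E₂) Φ x₀ x₁ x₂)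
      (chartBilin g.inner x₀) (productDomain (E₁ := E₁) (E₂ := E₂) Φ x₀ x₁ x₂)
      (prodMetric (chartBilin g₁.inner x₁) (chartBilin g₂.inner x₂))
      ((extChartAt 𝓘(ℝ, E₁) x₁).target ×ˢ (extChartAt 𝓘(ℝ, E₂) x₂).target) where
  source := (isMetricOn_chartBilin g x₀).mono (isOpen_productDomain Φ x₀ x₁ x₂)
    Set.inter_subset_left
  target := (isMetricOn_chartBilin g₁ x₁).prod (isMetricOn_chartBilin g₂ x₂)
  contDiffOn := contDiffOn_productCoord h x₀ x₁ x₂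
  mapsTo z hz := ⟨(extChartAt 𝓘(ℝ, E₁) x₁).map_source hz.2.2.1,
    (extChartAt 𝓘(ℝ, E₂) x₂).map_source hz.2.2.2⟩
  bijective z hz := productCoord_bijective h hz
  apply_eq z hz v w := by
    rw [fderiv_productCoord h hz, fderiv_productCoord h hz, prodMetric_apply]
    have h1 := chartBilin_chartDeriv g₁.inner hz.2.2.1
    have h2 := chartBilin_chartDeriv g₂.inner hz.2.2.2
    refine (h.isometry _ hz.2.1 (chartSymmDeriv x₀ z v) (chartSymmDeriv x₀ z w)).trans ?_
    exact congrArg₂ (· + ·) (h1 _ _).symm (h2 _ _).symm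

variable [FiniteDimensional ℝ E] {J J' : EndoField E M} {lam mu : ℝ}

/-- In a local product of Einstein manifolds the flipped structure is parallel. -/
theorem IsFlip.covDeriv_eq_zero_of_product (hF : IsFlip g J lam mu J') (hJ : IsKahler g J)
    (hne : lam ≠ mu)
    (hRic : ∀ (x : M) (r : ℝ), IsRicciEigenvalue g r x ↔ r = lam ∨ r = mu)
    (h : IsLocalProductIsometry g g₁ g₂ Φ) (he₁ : IsEinstein g₁ lam) (he₂ : IsEinstein g₂ mu)
    (x₀ : M) {y : E} (hy : y ∈ (extChartAt 𝓘(ℝ, E) x₀).target)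
    (hyΦ : (extChartAt 𝓘(ℝ, E) x₀).symm y ∈ Φ.source) (u : E) :
    covDeriv (chartBilin g.inner x₀) (chartEndo J' x₀) y u = 0 := by
  set x₁ := (Φ ((extChartAt 𝓘(ℝ, E) x₀).symm y)).1 with hx₁
  set x₂ := (Φ ((extChartAt 𝓘(ℝ, E) x₀).symm y)).2 with hx₂
  have hyD : y ∈ productDomain (E₁ := E₁) (E₂ := E₂) Φ x₀ x₁ x₂ :=
    ⟨hy, hyΦ, mem_extChartAt_source x₁, mem_extChartAt_source x₂⟩
  set φ := productCoord (E := E) (E₁ := E₁) (E₂ := E₂) Φ x₀ x₁ x₂ with hφ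
  have hφi := isLocalIsometryOn_productCoord h x₀ x₁ x₂
  have hm₁ := isMetricOn_chartBilin g₁ x₁
  have hm₂ := isMetricOn_chartBilin g₂ x₂
  have hG := isMetricOn_chartBilin g x₀
  have hH := isHermitianOn_chart hJ.almostKahler.almostComplex x₀
  have hH' := isHermitianOn_chart (hF.isOrthogonalAlmostComplex hJ hne hRic) x₀
  -- The expected value of J'J in product coordinates: −1 on the λ-factor and 1 on the μ-factor.
  let K : E₁ × E₂ →L[ℝ] E₁ × E₂ :=
    (-ContinuousLinearMap.fst ℝ E₁ E₂).prod (ContinuousLinearMap.snd ℝ E₁ E₂)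
  let T : E → E →L[ℝ] E := fun z => (chartEndo J' x₀ z).comp (chartEndo J x₀ z)
  have hTd : DifferentiableAt ℝ T y :=
    (hH'.differentiableAt hG hy).clm_comp (hH.differentiableAt hG hy)
  have hTK : ∀ z ∈ productDomain (E₁ := E₁) (E₂ := E₂) Φ x₀ x₁ x₂, ∀ v,
      fderiv ℝ φ z (T z v) = K (fderiv ℝ φ z v) := by
    intro z hz v
    refine hφi.target.ext (hφi.mapsTo hz) fun w' => ?_
    obtain ⟨w, rfl⟩ := (hφi.bijective z hz).2 w'
    -- Applied to Jv, the formula becomes (μ−λ)g(J'Jv, w) = 2 Ric(v, w) − (λ+μ)g(v, w), and Ric is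
    -- known on the product.
    have e1 := hF.chart_apply hJ hRic x₀ hz.1 (chartEndo J x₀ z v) w
    rw [hH.sq z hz.1, hφi.localRicci_apply hz,
      localRicci_prod hm₁ hm₂ (hφi.mapsTo hz), he₁.localRicci_eq (hφi.mapsTo hz).1,
      he₂.localRicci_eq (hφi.mapsTo hz).2, hφi.apply_eq z hz, hφi.apply_eq z hz] at e1
    simp only [prodMetric_apply, map_neg, Prod.fst_neg, Prod.snd_neg, neg_apply] at e1
    refine mul_left_cancel₀ (sub_ne_zero.2 hne.symm) ?_
    refine e1.trans ?_
    simp [prodMetric_apply, K]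
    ring
  have hKd : ∀ a b, covDeriv (prodMetric (chartBilin g₁.inner x₁) (chartBilin g₂.inner x₂))
      (fun _ => K) (φ y) a b = 0 := by
    intro a b
    have hP : φ y ∈ _ := hφi.mapsTo hyD
    simp [covDeriv, K, christoffel_prod hm₁ hm₂ hP]
  have hT0 : covDeriv (chartBilin g.inner x₀) T y u = 0 := by
    ext v
    refine (hφi.bijective y hyD).1 ?_
    rw [hφi.covDeriv_apply hyD hTd (differentiableAt_const K) (by
      filter_upwards [(isOpen_productDomain Φ x₀ x₁ x₂).mem_nhds hyD] with z hz using hTK z hz),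
      hKd]
    simp
  -- As ∇J = 0, the product rule leaves (∇J')J = 0; evaluating at −Jv gives ∇J' = 0.
  rw [covDeriv_comp (hH'.differentiableAt hG hy) (hH.differentiableAt hG hy),
    hJ.covDeriv_eq_zero x₀ hy, ContinuousLinearMap.comp_zero, add_zero] at hT0
  ext v
  have e := congrArg (fun L => L (-chartEndo J x₀ y v)) hT0
  simpa [hH.sq y hy] using e

theorem IsFlip.isIntegrable_of_locallyProduct (hF : IsFlip g J lam mu J') (hJ : IsKahler g J)
    (hne : lam ≠ mu)
    (hRic : ∀ (x : M) (r : ℝ), IsRicciEigenvalue g r x ↔ r = lam ∨ r = mu)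
    (h : IsLocallyProductKahlerEinstein g lam mu) : IsIntegrable J' := by
  refine isIntegrable_of_covDeriv_eq_zero g fun x₀ y hy u => ?_
  obtain ⟨p, q, M₁, _, _, _, _, _, M₂, _, _, _, _, _, g₁, _, g₂, _, Φ, _, he₁, _, he₂, hx, hΦ⟩ :=
    h ((extChartAt 𝓘(ℝ, E) x₀).symm y)
  exact hF.covDeriv_eq_zero_of_product hJ hne hRic hΦ he₁ he₂ x₀ hy hx u

end ProductChart

/-! ### Restriction to a totally geodesic linear subspace. -/

section Restriction

variable {A : Type*} [NormedAddCommGroup A] [NormedSpace ℝ A]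
  {F : Type*} [NormedAddCommGroup F] [NormedSpace ℝ F]

/-- The restriction of a field of endomorphisms to the image of `ι`, where `π` is a left inverse
of `ι`. -/
noncomputable def restrictEndo (ι : A →L[ℝ] F) (π : F →L[ℝ] A) (J : F → F →L[ℝ] F) (y : A) :
    A →L[ℝ] A :=
  (π.comp (J (ι y))).comp ι

theorem pullbackBilin_clm (ι : A →L[ℝ] F) (G : F → F →L[ℝ] F →L[ℝ] ℝ) (y v w : A) :
    pullbackBilin ι G y v w = G (ι y) (ι v) (ι w) := by
  simp [pullbackBilin]

variable {ι : A →L[ℝ] F} {π : F →L[ℝ] A} {G : F → F →L[ℝ] F →L[ℝ] ℝ} {J : F → F →L[ℝ] F}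

theorem IsHermitianOn.restrict (hJ : IsHermitianOn G J Set.univ)
    (hJι : ∀ y a, ι (π (J (ι y) (ι a))) = J (ι y) (ι a)) (hπ : ∀ a, π (ι a) = a) :
    IsHermitianOn (pullbackBilin ι G) (restrictEndo ι π J) Set.univ where
  contDiffOn := by
    have h1 : ContDiff ℝ ∞ J := contDiffOn_univ.1 hJ.contDiffOn
    exact ((contDiff_const.clm_comp (h1.comp ι.contDiff)).clm_comp contDiff_const).contDiffOn
  sq y _ v := by
    change π (J (ι y) (ι (π (J (ι y) (ι v))))) = -v
    rw [hJι, hJ.sq _ trivial, map_neg, hπ]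
  orthogonal y _ v w := by
    rw [pullbackBilin_clm, pullbackBilin_clm]
    change G (ι y) (ι (π (J (ι y) (ι v)))) (ι (π (J (ι y) (ι w)))) = _
    rw [hJι, hJι, hJ.orthogonal _ trivial]

/-- The hypothesis hΓ says that ι is totally geodesic and hJι that J preserves its image; together
they make restriction commute with ∇. -/
theorem covDeriv_restrictEndo (hJ : ContDiff ℝ ∞ J)
    (hJι : ∀ y a, ι (π (J (ι y) (ι a))) = J (ι y) (ι a)) (hπ : ∀ a, π (ι a) = a)
    (hΓ : ∀ y u v, christoffel G (ι y) (ι u) (ι v) = ι (christoffel (pullbackBilin ι G) y u v))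
    (y u v : A) :
    covDeriv (pullbackBilin ι G) (restrictEndo ι π J) y u v
      = π (covDeriv G J (ι y) (ι u) (ι v)) := by
  have h1 := (hJ.differentiable (by simp) (ι y)).hasFDerivAt.comp y ι.hasFDerivAt
  have h2 := ((hasFDerivAt_const π y).clm_comp h1).clm_comp (hasFDerivAt_const ι y)
  have h3 : fderiv ℝ (restrictEndo ι π J) y u v = π (fderiv ℝ J (ι y) (ι u) (ι v)) := by
    refine (congrArg (fun L => L u v) h2.fderiv).trans ?_
    simp
  simp only [covDeriv, add_apply, sub_apply, ContinuousLinearMap.comp_apply, h3, map_add, map_sub,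
    hΓ]
  congr 2
  change christoffel (pullbackBilin ι G) y u (π (J (ι y) (ι v))) = _
  rw [← hJι, hΓ, hπ, hπ]

end Restriction

/-! ### Local de Rham splitting of the metric. -/

section Splitting

variable {A : Type*} [NormedAddCommGroup A] [NormedSpace ℝ A] [FiniteDimensional ℝ A]
  {B : Type*} [NormedAddCommGroup B] [NormedSpace ℝ B] [FiniteDimensional ℝ B]

variable {G : A × B → (A × B) →L[ℝ] (A × B) →L[ℝ] ℝ}

/-- A metric on a product for which the two factors are orthogonal and parallel is a product
metric. -/
theorem eq_prodMetric (hG : IsMetricOn G Set.univ)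
    (hb : ∀ z a b, G z (a, 0) (0, b) = 0)
    (hp : ∀ z u v, christoffel G z u (v.1, 0) = ((christoffel G z u v).1, 0)) :
    G = prodMetric (pullbackBilin (ContinuousLinearMap.inl ℝ A B) G)
      (pullbackBilin (ContinuousLinearMap.inr ℝ A B) G) := by
  -- Both factors are parallel, so by symmetry of Γ a mixed Christoffel symbol lies in each of them,
  -- hence is zero.
  have h0 : ∀ z a b, christoffel G z (a, 0) (0, b) = 0 := by
    intro z a b
    have h1 := hp z (a, 0) (0, b)
    have h2 := hp z (0, b) (a, 0)
    rw [hG.christoffel_symm trivial (0, b) (a, 0)] at h2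
    have h3 := congrArg Prod.snd h2
    have h4 := congrArg Prod.fst h1
    simp only [Prod.mk_zero_zero, map_zero, Prod.fst_zero] at h4
    exact Prod.ext h4.symm h3
  have h0' : ∀ z a b, christoffel G z (0, b) (a, 0) = 0 := fun z a b => by
    rw [hG.christoffel_symm trivial, h0]
  have hGd : Differentiable ℝ G := fun z => hG.differentiableAt trivial
  -- By metric compatibility the derivative of this block along the other factor involves only mixed
  -- Christoffel symbols.
  have hA : ∀ x y a a', G (x, y) (a, 0) (a', 0) = G (x, 0) (a, 0) (a', 0) := by
    intro x y a a'
    have hd : ∀ t, HasFDerivAt (fun t => G (x, t) (a, 0) (a', 0)) (0 : B →L[ℝ] ℝ) t := by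
      intro t
      have h1 := (hGd (x, t)).hasFDerivAt.comp t
        ((hasFDerivAt_const x t).prodMk (hasFDerivAt_id t))
      have h2 := (h1.clm_apply (hasFDerivAt_const (a, (0 : B)) t)).clm_apply
        (hasFDerivAt_const (a', (0 : B)) t)
      refine h2.congr_fderiv (ContinuousLinearMap.ext fun w => ?_)
      have h3 := hG.compat (y := (x, t)) trivial (0, w) (a, 0) (a', 0)
      rw [h0', h0'] at h3
      simpa using h3
    exact is_const_of_fderiv_eq_zero (𝕜 := ℝ) (fun t => (hd t).differentiableAt)
      (fun t => (hd t).fderiv) y 0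
  have hB : ∀ x y b b', G (x, y) (0, b) (0, b') = G (0, y) (0, b) (0, b') := by
    intro x y b b'
    have hd : ∀ t, HasFDerivAt (fun t => G (t, y) (0, b) (0, b')) (0 : A →L[ℝ] ℝ) t := by
      intro t
      have h1 := HasFDerivAt.comp (f := fun t : A => (t, y)) t (hGd (t, y)).hasFDerivAt
        ((hasFDerivAt_id t).prodMk (hasFDerivAt_const y t))
      have h2 := (h1.clm_apply (hasFDerivAt_const ((0 : A), b) t)).clm_apply
        (hasFDerivAt_const ((0 : A), b') t)
      refine h2.congr_fderiv (ContinuousLinearMap.ext fun w => ?_)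
      have h3 := hG.compat (y := (t, y)) trivial (w, 0) (0, b) (0, b')
      rw [h0, h0] at h3
      simpa using h3
    exact is_const_of_fderiv_eq_zero (𝕜 := ℝ) (fun t => (hd t).differentiableAt)
      (fun t => (hd t).fderiv) x 0
  funext z
  ext v w
  · simp [prodMetric_apply, pullbackBilin_clm, ← hA z.1 z.2]
  · have := hb z v w
    simpa [prodMetric_apply, pullbackBilin_clm, Prod.mk_zero_zero] using this
  · have := hb z w v
    rw [hG.symm z trivial] at this
    simpa [prodMetric_apply, pullbackBilin_clm, Prod.mk_zero_zero] using this
  · simp [prodMetric_apply, pullbackBilin_clm, ← hB z.1 z.2]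

end Splitting

/-! ### A vector space as a manifold with the identity chart. -/

section VectorSpace

variable {V : Type*} [NormedAddCommGroup V] [NormedSpace ℝ V]

theorem chartDeriv_self (x₀ x : V) : chartDeriv (E := V) x₀ x = ContinuousLinearMap.id ℝ V := by
  rw [chartDeriv, mfderiv_eq_fderiv, extChartAt_model_space_eq_id]
  exact fderiv_id

theorem chartSymmDeriv_self (x₀ y : V) :
    chartSymmDeriv (E := V) x₀ y = ContinuousLinearMap.id ℝ V := by
  rw [chartSymmDeriv, mfderiv_eq_fderiv, extChartAt_model_space_eq_id]
  exact fderiv_id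

theorem chart_target_self (x₀ : V) : (extChartAt 𝓘(ℝ, V) x₀).target = Set.univ := by
  rw [extChartAt_model_space_eq_id]
  rfl

theorem chartBilin_self (B : BilinField V V) (x₀ y v w : V) :
    chartBilin B x₀ y v w = B y v w := by
  rw [chartBilin_apply, chartSymmDeriv_self]
  rfl

theorem chartEndo_self (J : EndoField V V) (x₀ y v : V) : chartEndo J x₀ y v = J y v := by
  rw [chartEndo_apply, chartSymmDeriv_self, chartDeriv_self]
  rfl

theorem chartBilin_eq (G : V → V →L[ℝ] V →L[ℝ] ℝ) (x₀ : V) :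
    chartBilin (E := V) (M := V) G x₀ = G :=
  funext fun y => ContinuousLinearMap.ext fun v => ContinuousLinearMap.ext fun w =>
    chartBilin_self (V := V) G x₀ y v w

theorem chartEndo_eq (J : V → V →L[ℝ] V) (x₀ : V) : chartEndo (E := V) (M := V) J x₀ = J :=
  funext fun y => ContinuousLinearMap.ext fun v => chartEndo_self (V := V) J x₀ y v

/-- On the compact unit sphere B is bounded below by some c > 0, so c‖v‖² ≤ B v v.
`riemMetricOfBilin` needs this bound. -/
theorem isVonNBounded_of_posDef [FiniteDimensional ℝ V] (B : V →L[ℝ] V →L[ℝ] ℝ)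
    (h : ∀ v, v ≠ 0 → 0 < B v v) : Bornology.IsVonNBounded ℝ {v : V | B v v < 1} := by
  obtain ⟨c, hc, hcB⟩ := (isCompact_sphere (0 : V) 1).exists_forall_le'
    (f := fun v => B v v) (by fun_prop) (a := 0)
    (fun v hv => h v fun h0 => by simp [h0] at hv)
  rw [NormedSpace.isVonNBounded_iff]
  refine (Metric.isBounded_closedBall (x := (0 : V)) (r := √(1 / c))).subset fun v hv => ?_
  rw [mem_closedBall_zero_iff]
  refine Real.le_sqrt_of_sq_le ?_
  rw [le_div_iff₀ hc]
  by_cases h0 : v = 0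
  · simp [h0]
  have hn : ‖v‖ ≠ 0 := norm_ne_zero_iff.2 h0
  have h1 := hcB (‖v‖⁻¹ • v) (by simp [norm_smul, hn])
  simp only [map_smul, FunLike.coe_smul, Pi.smul_apply, smul_eq_mul] at h1
  have h2 : c * ‖v‖ ^ 2 ≤ B v v := by
    have := mul_le_mul_of_nonneg_right h1 (sq_nonneg ‖v‖)
    refine this.trans_eq ?_
    field_simp
  have h3 : B v v < 1 := hv
  linarith

/-- A smooth Riemannian metric on a vector space. -/
noncomputable def riemMetricOfBilin [FiniteDimensional ℝ V] (G : V → V →L[ℝ] V →L[ℝ] ℝ)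
    (hG : ContDiff ℝ ∞ G) (hs : ∀ y v w, G y v w = G y w v)
    (hpos : ∀ y v, v ≠ 0 → 0 < G y v v) : RiemMetric V V where
  inner := G
  symm := hs
  pos := hpos
  isVonNBounded y := isVonNBounded_of_posDef (G y) (hpos y)
  contMDiff := (isSmoothBilin_iff (E := V) (M := V) G).2 fun x₀ =>
    (chartBilin_eq G x₀).symm ▸ hG.contDiffOn

variable [FiniteDimensional ℝ V] {g : RiemMetric V V} {G : V → V →L[ℝ] V →L[ℝ] ℝ}

theorem isEinstein_of_localRicci {c : ℝ} (hg : ∀ x₀, chartBilin g.inner x₀ = G)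
    (h : ∀ y v w : V, localRicci G y v w = c * G y v w) : IsEinstein g c := by
  intro x v w
  have h1 := localRicci_chartBilin g (x₀ := x) (y := x)
    (by rw [chart_target_self]; trivial) v w
  have h2 := chartBilin_self g.inner x x v w
  rw [chartSymmDeriv_self, hg] at h1
  rw [hg] at h2
  exact (h1.symm.trans (h x v w)).trans (congrArg (c * ·) h2)

/-- Both dΩ and the Nijenhuis tensor are linear in ∇J, so a parallel J makes them vanish. -/
theorem isKahler_of_covDeriv_eq_zero {J : V → V →L[ℝ] V} (hg : ∀ x₀, chartBilin g.inner x₀ = G)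
    (hJ : IsHermitianOn G J Set.univ) (hp : ∀ y u, covDeriv G J y u = 0) :
    IsKahler (E := V) (M := V) g J := by
  have hgG : ∀ y v w : V, G y v w = g.inner y v w := fun y v w => by
    rw [← hg 0, chartBilin_self]
  have hG : IsMetricOn G Set.univ := by
    rw [← hg 0, ← chart_target_self (0 : V)]
    exact isMetricOn_chartBilin g (0 : V)
  have hac : IsOrthogonalAlmostComplex (E := V) (M := V) g J := by
    refine ⟨(isSmoothEndo_iff (E := V) (M := V) J).2 fun x₀ => ?_, fun y v => hJ.sq y trivial v,
      fun y v w => ?_⟩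
    · rw [chartEndo_eq]
      exact hJ.contDiffOn.mono (Set.subset_univ _)
    · exact ((hgG _ _ _).symm.trans (hJ.orthogonal y trivial v w)).trans (hgG _ _ _)
  have hW : ∀ x₀ : V, ∀ y, chartBilin (fundamentalForm (E := V) (M := V) g J) x₀ y
      = (G y).comp (J y) := fun x₀ y => by
    rw [chartBilin_fundamentalForm (E := V) (M := V) g J x₀
      (by rw [chart_target_self]; trivial), hg, chartEndo_eq]
  refine ⟨⟨hac, ?_, fun y v => ?_, fun y v h => ?_, fun x₀ y hy u v w => ?_⟩, fun x₀ y hy v w => ?_⟩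
  · refine (isSmoothBilin_iff _).2 fun x₀ => ?_
    refine ((hG.contDiffOn.clm_comp hJ.contDiffOn).mono (Set.subset_univ _)).congr
      fun y _ => hW x₀ y
  · have h1 := hJ.skew (y := y) trivial v v
    have h2 := hG.symm y trivial v (J y v)
    have h3 : G y (J y v) v = 0 := by linarith
    exact (hgG _ _ _).symm.trans h3
  · by_contra hv
    have h1 := h (J y v)
    exact (g.pos y v hv).ne' ((hac.orthogonal y v v).symm.trans h1)
  · rw [localExtDeriv_congr (W := fun z => (G z).comp (J z)) (.of_forall fun z => hW x₀ z),
      localExtDeriv_eq hG hJ trivial]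
    simp [hp]
  · rw [chartEndo_eq, localNijenhuis_eq hG trivial]
    simp [hp]

end VectorSpace

/-! ### Coordinates with a product of Euclidean spaces as domain. -/

section ProductCoordinates

variable {F : Type*} [NormedAddCommGroup F] [NormedSpace ℝ F] [FiniteDimensional ℝ F]

/-- A projection is the first projection of a product decomposition. -/
theorem exists_equiv_of_projection {Q : F →L[ℝ] F} (hQ : Q * Q = Q) :
    ∃ (p q : ℕ) (L : (EuclideanSpace ℝ (Fin p) × EuclideanSpace ℝ (Fin q)) ≃L[ℝ] F),
      ∀ v, Q (L v) = L (v.1, 0) := by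
  have hQ' : ∀ v, Q (Q v) = Q v := fun v => congrArg (fun T => T v) hQ
  let Q₀ : F →ₗ[ℝ] F := Q
  have hi : IsIdempotentElem Q₀ := LinearMap.ext hQ'
  have hc : IsCompl Q₀.range Q₀.ker := LinearMap.IsIdempotentElem.isCompl hi
  let p := Module.finrank ℝ Q₀.range
  let q := Module.finrank ℝ Q₀.ker
  let α : EuclideanSpace ℝ (Fin p) ≃ₗ[ℝ] Q₀.range := LinearEquiv.ofFinrankEq _ _ (by simp [p])
  let β : EuclideanSpace ℝ (Fin q) ≃ₗ[ℝ] Q₀.ker := LinearEquiv.ofFinrankEq _ _ (by simp [q])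
  refine ⟨p, q, ((α.prodCongr β).trans
    (Submodule.prodEquivOfIsCompl _ _ hc)).toContinuousLinearEquiv, fun v => ?_⟩
  change Q ((α v.1 : F) + (β v.2 : F)) = (α v.1 : F) + (β (0 : EuclideanSpace ℝ (Fin q)) : F)
  obtain ⟨w, hw⟩ := (α v.1).2
  have h1 : Q (α v.1 : F) = α v.1 := by
    rw [← hw]
    exact hQ' w
  have h2 : Q (β v.2 : F) = 0 := (β v.2).2
  rw [map_add, h1, h2]
  simp

theorem fderiv_openPartialHomeomorph_symm {A B : Type*} [NormedAddCommGroup A] [NormedSpace ℝ A]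
    [NormedAddCommGroup B] [NormedSpace ℝ B] (e : OpenPartialHomeomorph A B) {t : B}
    (ht : t ∈ e.target) (h1 : DifferentiableAt ℝ e (e.symm t)) (h2 : DifferentiableAt ℝ e.symm t) :
    (∀ v, fderiv ℝ e (e.symm t) (fderiv ℝ e.symm t v) = v) ∧
      ∀ v, fderiv ℝ e.symm t (fderiv ℝ e (e.symm t) v) = v := by
  constructor
  · have h3 := (h1.hasFDerivAt.comp t h2.hasFDerivAt).unique
      ((hasFDerivAt_id (𝕜 := ℝ) t).congr_of_eventuallyEq (e.eventually_right_inverse ht))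
    exact fun v => congrArg (fun L => L v) h3
  · have hs := e.map_target ht
    have h2' : DifferentiableAt ℝ e.symm (e (e.symm t)) := by rwa [e.right_inv ht]
    have h3 := (h2'.hasFDerivAt.comp _ h1.hasFDerivAt).unique
      ((hasFDerivAt_id (𝕜 := ℝ) _).congr_of_eventuallyEq (e.eventually_left_inverse hs))
    rw [e.right_inv ht] at h3
    exact fun v => congrArg (fun L => L v) h3

/-- Near each point, a smooth field of projections that is parallel for a torsion-free connection
is the first projection of coordinates whose range is a product of two Euclidean spaces. -/
theorem exists_product_coordinates {Q : F → F →L[ℝ] F} {Γ : F → F →L[ℝ] F →L[ℝ] F} {U : Set F}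
    (hU : IsOpen U) {x₀ : F} (hx₀ : x₀ ∈ U) (hQ : ContDiffOn ℝ ∞ Q U)
    (hsq : ∀ x ∈ U, Q x * Q x = Q x) (hΓ : ∀ x ∈ U, ∀ u v, Γ x u v = Γ x v u)
    (hp : ∀ x ∈ U, ∀ u, fderiv ℝ Q x u = Q x * Γ x u - Γ x u * Q x) :
    ∃ (p q : ℕ) (τ : OpenPartialHomeomorph
        (EuclideanSpace ℝ (Fin p) × EuclideanSpace ℝ (Fin q)) F),
      τ.source = Set.univ ∧ x₀ ∈ τ.target ∧ τ.target ⊆ U ∧ ContDiff ℝ ∞ τ ∧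
      ContDiffOn ℝ ∞ τ.symm τ.target ∧
      ∀ z v, Q (τ z) (fderiv ℝ τ z v) = fderiv ℝ τ z (v.1, 0) := by
  obtain ⟨Φ, hΦ, hΦ0, hΦQ⟩ := exists_straightening hU hx₀ hQ hsq hΓ hp
  obtain ⟨p, q, L, hL⟩ := exists_equiv_of_projection (hsq x₀ hx₀)
  have hΦe : HasFDerivAt Φ ((ContinuousLinearEquiv.refl ℝ F : F ≃L[ℝ] F) : F →L[ℝ] F) x₀ := by
    have := (hΦ.self_of_nhds.differentiableAt (by simp)).hasFDerivAt
    rw [hΦ0] at this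
    exact this
  have hinv : ∀ᶠ x in 𝓝 x₀, (fderiv ℝ Φ x).IsInvertible := by
    have h1 : ContinuousAt (fderiv ℝ Φ) x₀ :=
      (hΦ.self_of_nhds.fderiv_right (m := 0) (by simp)).continuousAt
    refine h1.eventually (eventually_isInvertible ?_)
    rw [hΦe.fderiv]
    exact ContinuousLinearMap.isInvertible_equiv
  obtain ⟨W, hW, hWo, hxW⟩ := eventually_nhds_iff.1
    (hΦ.and (hinv.and (hΦQ.and (hU.mem_nhds hx₀))))
  set e : OpenPartialHomeomorph F (EuclideanSpace ℝ (Fin p) × EuclideanSpace ℝ (Fin q)) :=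
    ((hΦ.self_of_nhds.toOpenPartialHomeomorph Φ hΦe (by simp)).restrOpen W hWo).transHomeomorph
      L.symm.toHomeomorph with he
  have hes : ∀ x ∈ e.source, x ∈ W := fun x hx => hx.2
  have hex : x₀ ∈ e.source :=
    ⟨hΦ.self_of_nhds.mem_toOpenPartialHomeomorph_source hΦe (by simp), hxW⟩
  have hecoe : ∀ x, e x = L.symm (Φ x) := fun x => rfl
  have heD : ∀ x ∈ W, HasFDerivAt e
      ((L.symm : F →L[ℝ] EuclideanSpace ℝ (Fin p) × EuclideanSpace ℝ (Fin q)).comp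
        (fderiv ℝ Φ x)) x := fun x hx =>
    L.symm.hasFDerivAt.comp x ((hW x hx).1.differentiableAt (by simp)).hasFDerivAt
  have heC : ∀ x ∈ W, ContDiffAt ℝ ∞ e x := fun x hx =>
    L.symm.contDiff.contDiffAt.comp x (hW x hx).1
  have hsymm : ∀ t ∈ e.target, ContDiffAt ℝ ∞ e.symm t := by
    intro t ht
    have hx := hes _ (e.map_target ht)
    obtain ⟨N, hN⟩ := (hW _ hx).2.1
    refine e.contDiffAt_symm ht (f₀' := N.trans L.symm) ?_ (heC _ hx)
    have := heD _ hx
    rwa [← hN] at this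
  obtain ⟨r, hr, hball⟩ := Metric.isOpen_iff.1 e.open_target (e x₀) (e.map_source hex)
  -- Parametrizing a product of balls by whole Euclidean spaces lets the factors be vector spaces.
  -- For the sup norm this product is a ball, and a product of maps respects the splitting.
  set b := (OpenPartialHomeomorph.univBall (E := EuclideanSpace ℝ (Fin p)) (e x₀).1 r).prod
    (OpenPartialHomeomorph.univBall (E := EuclideanSpace ℝ (Fin q)) (e x₀).2 r) with hb
  have hbs : b.source = Set.univ := by simp [hb]
  have hbt : b.target = Metric.ball (e x₀) r := by
    simp [hb, OpenPartialHomeomorph.univBall_target _ hr, ball_prod_same]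
  have hbm : ∀ z, b z ∈ e.target := fun z => hball (hbt ▸ b.map_source (hbs ▸ trivial))
  set τ := b.trans e.symm with hτ
  have hτs : τ.source = Set.univ := by
    refine Set.eq_univ_of_forall fun z => ?_
    rw [hτ, OpenPartialHomeomorph.trans_source]
    exact ⟨hbs ▸ trivial, hbm z⟩
  have hτt : τ.target = e.source ∩ e ⁻¹' Metric.ball (e x₀) r := by
    rw [hτ, OpenPartialHomeomorph.trans_target, hbt]
    rfl
  have hbc : ContDiff ℝ ∞ b :=
    (OpenPartialHomeomorph.contDiff_univBall.comp contDiff_fst).prodMk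
      (OpenPartialHomeomorph.contDiff_univBall.comp contDiff_snd)
  have hbC : ∀ z v, fderiv ℝ b z (v.1, 0) = ((fderiv ℝ b z v).1, 0) := by
    intro z v
    have d1 : DifferentiableAt ℝ (OpenPartialHomeomorph.univBall
        (E := EuclideanSpace ℝ (Fin p)) (e x₀).1 r) z.1 :=
      (OpenPartialHomeomorph.contDiff_univBall (n := 1)).differentiable (by simp) _
    have d2 : DifferentiableAt ℝ (OpenPartialHomeomorph.univBall
        (E := EuclideanSpace ℝ (Fin q)) (e x₀).2 r) z.2 :=
      (OpenPartialHomeomorph.contDiff_univBall (n := 1)).differentiable (by simp) _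
    have d := (d1.hasFDerivAt.comp z hasFDerivAt_fst).prodMk
      (d2.hasFDerivAt.comp z hasFDerivAt_snd)
    have hd : HasFDerivAt b _ z := d
    rw [hd.fderiv]
    simp
  refine ⟨p, q, τ, hτs, ?_, ?_, ?_, ?_, ?_⟩
  · rw [hτt]
    exact ⟨hex, Metric.mem_ball_self hr⟩
  · rw [hτt]
    exact fun x hx => (hW x (hes x hx.1)).2.2.2
  · exact contDiff_iff_contDiffAt.2 fun z => (hsymm _ (hbm z)).comp z hbc.contDiffAt
  · rw [hτt]
    intro x hx
    have h1 : ContDiffAt ℝ ∞ b.symm (e x) := by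
      refine ContDiffAt.prodMk ?_ ?_
      · refine ((OpenPartialHomeomorph.contDiffOn_univBall_symm).contDiffAt
          (Metric.isOpen_ball.mem_nhds ?_)).comp (e x) contDiffAt_fst
        exact (ball_prod_same (e x₀).1 (e x₀).2 r ▸ hx.2 :
          e x ∈ Metric.ball (e x₀).1 r ×ˢ Metric.ball (e x₀).2 r).1
      · refine ((OpenPartialHomeomorph.contDiffOn_univBall_symm).contDiffAt
          (Metric.isOpen_ball.mem_nhds ?_)).comp (e x) contDiffAt_snd
        exact (ball_prod_same (e x₀).1 (e x₀).2 r ▸ hx.2 :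
          e x ∈ Metric.ball (e x₀).1 r ×ˢ Metric.ball (e x₀).2 r).2
    exact (h1.comp x (heC x (hes x hx.1))).contDiffWithinAt
  · intro z v
    have ht := hbm z
    have hx := hes _ (e.map_target ht)
    have hd := ((hsymm _ ht).differentiableAt (by simp))
    obtain ⟨i1, i2⟩ := fderiv_openPartialHomeomorph_symm e ht
      ((heC _ hx).differentiableAt (by simp)) hd
    have hτd : fderiv ℝ τ z = (fderiv ℝ e.symm (b z)).comp (fderiv ℝ b z) :=
      (hd.hasFDerivAt.comp z (hbc.differentiable (by simp) z).hasFDerivAt).fderiv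
    -- Φ straightens Q to the constant Q x₀, and L identifies Q x₀ with the first projection.
    have hcomm : ∀ c, fderiv ℝ e (e.symm (b z)) (Q (e.symm (b z)) c)
        = ((fderiv ℝ e (e.symm (b z)) c).1, 0) := by
      intro c
      rw [(heD _ hx).fderiv]
      change L.symm (fderiv ℝ Φ _ (Q _ c)) = ((L.symm (fderiv ℝ Φ _ c)).1, 0)
      have h1 : fderiv ℝ Φ (e.symm (b z)) (Q (e.symm (b z)) c)
          = Q x₀ (fderiv ℝ Φ (e.symm (b z)) c) := congrArg (fun T => T c) (hW _ hx).2.2.1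
      rw [h1, L.symm_apply_eq, ← hL, L.apply_symm_apply]
    have h1 := hcomm (fderiv ℝ e.symm (b z) (fderiv ℝ b z v))
    rw [i1] at h1
    rw [hτd]
    change Q (e.symm (b z)) (fderiv ℝ e.symm (b z) (fderiv ℝ b z v))
      = fderiv ℝ e.symm (b z) (fderiv ℝ b z (v.1, 0))
    rw [hbC, ← h1, i2]

end ProductCoordinates

/-! ### Kähler–Einstein structures on the factors. -/

section Factor

variable {A : Type*} [NormedAddCommGroup A] [NormedSpace ℝ A]

/-- A Riemannian metric on a vector space with a parallel complex structure and `Ric = c G`. -/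
structure IsKahlerEinsteinOnSpace (G : A → A →L[ℝ] A →L[ℝ] ℝ) (J : A → A →L[ℝ] A) (c : ℝ) :
    Prop where
  contDiff : ContDiff ℝ ∞ G
  symm : ∀ y v w, G y v w = G y w v
  pos : ∀ y v, v ≠ 0 → 0 < G y v v
  isHermitianOn : IsHermitianOn G J Set.univ
  parallel : ∀ y u, covDeriv G J y u = 0
  ricci_eq : ∀ y v w, localRicci G y v w = c * G y v w

theorem IsKahlerEinsteinOnSpace.exists_riemMetric [FiniteDimensional ℝ A]
    {G : A → A →L[ℝ] A →L[ℝ] ℝ} {J : A → A →L[ℝ] A} {c : ℝ} (h : IsKahlerEinsteinOnSpace G J c) :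
    ∃ g : RiemMetric A A, (∀ y v w : A, g.inner y v w = G y v w) ∧
      IsKahler (E := A) (M := A) g J ∧ IsEinstein g c := by
  refine ⟨riemMetricOfBilin G h.contDiff h.symm h.pos, fun _ _ _ => rfl, ?_, ?_⟩
  · exact isKahler_of_covDeriv_eq_zero (chartBilin_eq G) h.isHermitianOn h.parallel
  · exact isEinstein_of_localRicci (chartBilin_eq G) h.ricci_eq

/-- A totally geodesic linear subspace which is invariant under the complex structure inherits a
Kähler–Einstein structure. -/
theorem IsKahlerEinsteinOnSpace.restrict [FiniteDimensional ℝ A]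
    {F : Type*} [NormedAddCommGroup F] [NormedSpace ℝ F]
    {ι : A →L[ℝ] F} {π : F →L[ℝ] A} {G : F → F →L[ℝ] F →L[ℝ] ℝ} {J : F → F →L[ℝ] F} {c : ℝ}
    (hG : ContDiff ℝ ∞ G) (hs : ∀ y v w, G y v w = G y w v) (hpos : ∀ y v, v ≠ 0 → 0 < G y v v)
    (hJ : IsHermitianOn G J Set.univ) (hp : ∀ y u, covDeriv G J y u = 0)
    (hπ : ∀ a, π (ι a) = a) (hJι : ∀ y a, ι (π (J (ι y) (ι a))) = J (ι y) (ι a))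
    (hΓ : ∀ y u v, christoffel G (ι y) (ι u) (ι v) = ι (christoffel (pullbackBilin ι G) y u v))
    (hR : ∀ y v w, localRicci (pullbackBilin ι G) y v w = c * G (ι y) (ι v) (ι w)) :
    IsKahlerEinsteinOnSpace (pullbackBilin ι G) (restrictEndo ι π J) c where
  contDiff := contDiff_iff_contDiffAt.2 fun _ =>
    contDiffAt_pullbackBilin ι.contDiff.contDiffAt hG.contDiffAt
  symm y v w := by rw [pullbackBilin_clm, pullbackBilin_clm, hs]
  pos y v hv := by
    rw [pullbackBilin_clm]
    refine hpos _ _ fun h => hv ?_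
    rw [← hπ v, h, map_zero]
  isHermitianOn := hJ.restrict hJι hπ
  parallel y u := by
    ext v
    rw [covDeriv_restrictEndo (contDiffOn_univ.1 hJ.contDiffOn) hJι hπ hΓ, hp]
    simp
  ricci_eq y v w := by rw [hR, pullbackBilin_clm]

end Factor

/-! ### The Kähler–Einstein factors in straightened coordinates. -/

section LocalSplitting

variable {F : Type*} [NormedAddCommGroup F] [NormedSpace ℝ F] [FiniteDimensional ℝ F]
  {A : Type*} [NormedAddCommGroup A] [NormedSpace ℝ A] [FiniteDimensional ℝ A]
  {B : Type*} [NormedAddCommGroup B] [NormedSpace ℝ B] [FiniteDimensional ℝ B]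
  {G : F → F →L[ℝ] F →L[ℝ] ℝ} {J Q : F → F →L[ℝ] F} {U : Set F} {τ : A × B → F} {lam mu : ℝ}

/-- A Kähler metric whose Ricci tensor has two eigenvalues, with parallel projections on the
eigenspaces, is a product of two Kähler–Einstein metrics in coordinates in which these projections
are constant. -/
theorem exists_kahlerEinstein_factors (hG : IsMetricOn G U)
    (hpos : ∀ y ∈ U, ∀ v, v ≠ 0 → 0 < G y v v) (hJ : IsHermitianOn G J U)
    (hJp : ∀ y ∈ U, ∀ u, covDeriv G J y u = 0) (hQ : ∀ y ∈ U, DifferentiableAt ℝ Q y)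
    (hQp : ∀ y ∈ U, ∀ u, covDeriv G Q y u = 0)
    (hQG : ∀ y ∈ U, ∀ v w, G y (Q y v) w = G y v (Q y w))
    (hQJ : ∀ y ∈ U, ∀ v, J y (Q y v) = Q y (J y v))
    (hR : ∀ y ∈ U, ∀ v w, localRicci G y v w = mu * G y v w - (mu - lam) * G y (Q y v) w)
    (hτ : ContDiff ℝ ∞ τ) (hτU : ∀ z, τ z ∈ U) (hτb : ∀ z, Function.Bijective (fderiv ℝ τ z))
    (hτQ : ∀ z v, Q (τ z) (fderiv ℝ τ z v) = fderiv ℝ τ z (v.1, 0)) :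
    ∃ (G₁ : A → A →L[ℝ] A →L[ℝ] ℝ) (J₁ : A → A →L[ℝ] A) (G₂ : B → B →L[ℝ] B →L[ℝ] ℝ)
      (J₂ : B → B →L[ℝ] B), IsKahlerEinsteinOnSpace G₁ J₁ lam ∧ IsKahlerEinsteinOnSpace G₂ J₂ mu ∧
      ∀ z v w, G (τ z) (fderiv ℝ τ z v) (fderiv ℝ τ z w)
        = G₁ z.1 v.1 w.1 + G₂ z.2 v.2 w.2 := by
  set G' := pullbackBilin τ G with hG'
  have hi : IsLocalIsometryOn τ G' Set.univ G U := IsLocalIsometryOn.pullback isOpen_univ hG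
    hτ.contDiffOn (fun z _ => hτU z) fun z _ => hτb z
  have hm := hi.source
  have hG'a : ∀ z v w, G' z v w = G (τ z) (fderiv ℝ τ z v) (fderiv ℝ τ z w) := fun z v w => rfl
  have hinj : ∀ z, Function.Injective (fderiv ℝ τ z) := fun z => (hτb z).1
  have hpos' : ∀ z v, v ≠ 0 → 0 < G' z v v := fun z v hv => hpos _ (hτU z) _ fun h =>
    hv (hinj z (h.trans (map_zero _).symm))
  let C : A × B →L[ℝ] A × B := (ContinuousLinearMap.inl ℝ A B).comp (ContinuousLinearMap.fst ℝ A B)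
  -- The constant projection C corresponds to Q under τ, hence is parallel; for a constant field
  -- this says that it commutes with Γ.
  have hC : ∀ z u v, christoffel G' z u (v.1, 0) = ((christoffel G' z u v).1, 0) := by
    intro z u v
    have h1 := hi.covDeriv_apply (y := z) trivial (T := fun _ => C) (T' := Q)
      (differentiableAt_const C) (hQ _ (hτU z)) (.of_forall fun z v => (hτQ z v).symm) u v
    rw [hQp _ (hτU z), zero_apply, ← map_zero (fderiv ℝ τ z)] at h1
    have h2 := hinj z h1
    simpa [covDeriv, C, sub_eq_zero] using h2
  -- The two vectors correspond to the range and the kernel of Q, which is self-adjoint.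
  have hb : ∀ z a b, G' z (a, 0) (0, b) = 0 := by
    intro z a b
    have h1 := hτQ z (a, 0)
    have h2 := hτQ z (0, b)
    rw [hG'a, ← h1, hQG _ (hτU z), h2]
    simp [Prod.mk_zero_zero]
  have hprod := eq_prodMetric hm hb hC
  set G₁ := pullbackBilin (ContinuousLinearMap.inl ℝ A B) G' with hG₁
  set G₂ := pullbackBilin (ContinuousLinearMap.inr ℝ A B) G' with hG₂
  let J' : A × B → (A × B) →L[ℝ] A × B := fun z =>
    (fderiv ℝ τ z).inverse.comp ((J (τ z)).comp (fderiv ℝ τ z))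
  have hinv : ∀ z, (fderiv ℝ τ z).IsInvertible := fun z =>
    ⟨(LinearEquiv.ofBijective (fderiv ℝ τ z : A × B →ₗ[ℝ] F) (hτb z)).toContinuousLinearEquiv,
      rfl⟩
  have hJ'a : ∀ z v, fderiv ℝ τ z (J' z v) = J (τ z) (fderiv ℝ τ z v) := fun z v =>
    (hinv z).self_apply_inverse _
  have hJ's : ContDiff ℝ ∞ J' := by
    refine contDiff_iff_contDiffAt.2 fun z => contDiffAt_of_metric hm trivial fun v w => ?_
    have h1 : ∀ v, ContDiffAt ℝ ∞ (fun z => fderiv ℝ τ z v) z := fun v =>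
      (contDiffAt_fderiv hτ.contDiffAt).clm_apply contDiffAt_const
    have h2 := (((hG.contDiffAt (hτU z)).comp z hτ.contDiffAt).clm_apply
      (((hJ.contDiffOn.contDiffAt (hG.isOpen.mem_nhds (hτU z))).comp z
        hτ.contDiffAt).clm_apply (h1 v))).clm_apply (h1 w)
    refine h2.congr_of_eventuallyEq (.of_forall fun z => ?_)
    simp only [hG'a, hJ'a, Function.comp_apply]
  have hJ'h : IsHermitianOn G' J' Set.univ := by
    refine ⟨hJ's.contDiffOn, fun z _ v => hinj z ?_, fun z _ v w => ?_⟩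
    · rw [hJ'a, hJ'a, hJ.sq _ (hτU z), map_neg]
    · rw [hG'a, hJ'a, hJ'a, hJ.orthogonal _ (hτU z), hG'a]
  have hJ'p : ∀ z u, covDeriv G' J' z u = 0 := by
    intro z u
    refine ContinuousLinearMap.ext fun v => hinj z ?_
    rw [hi.covDeriv_apply trivial (hJ's.differentiable (by simp) z)
      (hJ.differentiableAt hG (hτU z)) (.of_forall hJ'a), hJp _ (hτU z)]
    simp
  have hJ'C : ∀ z v, J' z (v.1, 0) = ((J' z v).1, 0) := by
    intro z v
    refine hinj z ?_
    rw [hJ'a, ← hτQ, hQJ _ (hτU z), ← hJ'a, hτQ]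
  have hGs : ContDiff ℝ ∞ G' := contDiffOn_univ.1 hm.contDiffOn
  have hm₁ : IsMetricOn G₁ Set.univ := by
    refine ⟨isOpen_univ, fun y _ => (contDiffAt_pullbackBilin
      (ContinuousLinearMap.contDiff _).contDiffAt hGs.contDiffAt).contDiffWithinAt,
      fun y _ v w => ?_, fun y _ v h => ?_⟩
    · rw [hG₁, pullbackBilin_clm, pullbackBilin_clm, hm.symm _ trivial]
    · by_contra hv
      have h1 := h v
      rw [hG₁, pullbackBilin_clm] at h1
      exact (hpos' _ _ fun h2 => hv (congrArg Prod.fst h2)).ne' h1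
  have hm₂ : IsMetricOn G₂ Set.univ := by
    refine ⟨isOpen_univ, fun y _ => (contDiffAt_pullbackBilin
      (ContinuousLinearMap.contDiff _).contDiffAt hGs.contDiffAt).contDiffWithinAt,
      fun y _ v w => ?_, fun y _ v h => ?_⟩
    · rw [hG₂, pullbackBilin_clm, pullbackBilin_clm, hm.symm _ trivial]
    · by_contra hv
      have h1 := h v
      rw [hG₂, pullbackBilin_clm] at h1
      exact (hpos' _ _ fun h2 => hv (congrArg Prod.snd h2)).ne' h1
  have hΓ : ∀ z u v, christoffel G' z u v
      = (christoffel G₁ z.1 u.1 v.1, christoffel G₂ z.2 u.2 v.2) := fun z u v => by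
    conv_lhs => rw [hprod]
    exact christoffel_prod hm₁ hm₂ ⟨trivial, trivial⟩ u v
  have hRic : ∀ z v w, localRicci G (τ z) (fderiv ℝ τ z v) (fderiv ℝ τ z w)
      = localRicci G₁ z.1 v.1 w.1 + localRicci G₂ z.2 v.2 w.2 := fun z v w => by
    rw [← hi.localRicci_apply trivial]
    conv_lhs => rw [hprod]
    exact localRicci_prod hm₁ hm₂ ⟨trivial, trivial⟩ v w
  refine ⟨G₁, restrictEndo (ContinuousLinearMap.inl ℝ A B) (ContinuousLinearMap.fst ℝ A B) J', G₂,
    restrictEndo (ContinuousLinearMap.inr ℝ A B) (ContinuousLinearMap.snd ℝ A B) J', ?_, ?_, ?_⟩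
  · refine .restrict hGs (fun z => hm.symm z trivial) hpos' hJ'h hJ'p (fun a => rfl) ?_ ?_ ?_
    · intro y a
      exact (hJ'C (y, 0) (a, 0)).symm
    · intro y u v
      rw [hΓ]
      simp [hG₁]
    · intro y v w
      -- On vectors of the first factor Q is the identity, so μG − (μ−λ)G(Q·,·) is λG; on the second
      -- factor Q vanishes and μG remains.
      have h1 := hRic (y, 0) (v, 0) (w, 0)
      rw [hR _ (hτU _), hτQ] at h1
      simp only [map_zero, add_zero] at h1
      rw [← hG₁, ← h1, ContinuousLinearMap.inl_apply, ContinuousLinearMap.inl_apply,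
        ContinuousLinearMap.inl_apply, hG'a]
      ring
  · refine .restrict hGs (fun z => hm.symm z trivial) hpos' hJ'h hJ'p (fun a => rfl) ?_ ?_ ?_
    · intro y a
      have h1 := hJ'C (0, y) (0, a)
      have h2 := congrArg Prod.fst h1
      simp only [Prod.mk_zero_zero, map_zero, Prod.fst_zero] at h2
      exact Prod.ext h2 rfl
    · intro y u v
      rw [hΓ]
      simp [hG₂]
    · intro y v w
      have h1 := hRic (0, y) (0, v) (0, w)
      rw [hR _ (hτU _), hτQ] at h1
      simp only [map_zero, zero_add, Prod.mk_zero_zero, zero_apply, mul_zero, sub_zero] at h1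
      rw [← hG₂, ← h1, ContinuousLinearMap.inr_apply, ContinuousLinearMap.inr_apply,
        ContinuousLinearMap.inr_apply, hG'a]
  · intro z v w
    rw [← hG'a]
    conv_lhs => rw [hprod]
    rfl

end LocalSplitting

/-! ### From product coordinates to a local product isometry. -/

section ManifoldSplitting

variable {E : Type*} [NormedAddCommGroup E] [NormedSpace ℝ E]
  {M : Type*} [TopologicalSpace M] [ChartedSpace E M] [IsManifold 𝓘(ℝ, E) ∞ M]
  {A : Type*} [NormedAddCommGroup A] [NormedSpace ℝ A]
  {B : Type*} [NormedAddCommGroup B] [NormedSpace ℝ B]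
  {g : RiemMetric E M} {g₁ : RiemMetric A A} {g₂ : RiemMetric B B}

/-- Coordinates in which the metric is a product metric are a local product isometry. -/
theorem isLocalProductIsometry_of_coordinates (x : M) {τ : OpenPartialHomeomorph (A × B) E}
    (hτs : τ.source = Set.univ) (hτU : τ.target ⊆ (extChartAt 𝓘(ℝ, E) x).target)
    (hτ : ContDiff ℝ ∞ τ) (hτ' : ContDiffOn ℝ ∞ τ.symm τ.target)
    (hg : ∀ (z v w : A × B), chartBilin g.inner x (τ z) (fderiv ℝ τ z v) (fderiv ℝ τ z w)
      = g₁.inner z.1 v.1 w.1 + g₂.inner z.2 v.2 w.2) :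
    IsLocalProductIsometry g g₁ g₂ ((chartAt E x).trans τ.symm) := by
  set Φ := (chartAt E x).trans τ.symm with hΦ
  have hsrc : ∀ m ∈ Φ.source, m ∈ (extChartAt 𝓘(ℝ, E) x).source ∧
      extChartAt 𝓘(ℝ, E) x m ∈ τ.target := fun m hm => by
    rw [hΦ, OpenPartialHomeomorph.trans_source] at hm
    rw [extChartAt_source]
    exact hm
  have hmem : ∀ z, τ z ∈ τ.target := fun z => τ.map_source (hτs ▸ trivial)
  have hchart : ContMDiffOn 𝓘(ℝ, E) 𝓘(ℝ, A × B) ∞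
      (fun m => τ.symm (extChartAt 𝓘(ℝ, E) x m)) Φ.source :=
    (contMDiffOn_iff_contDiffOn.2 hτ').comp ((contMDiffOn_chart x).mono fun m hm => (hsrc m hm).1)
      fun m hm => (hsrc m hm).2
  have h1 : ContMDiffOn 𝓘(ℝ, E) 𝓘(ℝ, A) ∞ (fun m => (Φ m).1) Φ.source :=
    (contDiff_fst (𝕜 := ℝ) (E := A) (F := B)).contMDiff.comp_contMDiffOn hchart
  have h2 : ContMDiffOn 𝓘(ℝ, E) 𝓘(ℝ, B) ∞ (fun m => (Φ m).2) Φ.source :=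
    (contDiff_snd (𝕜 := ℝ) (E := A) (F := B)).contMDiff.comp_contMDiffOn hchart
  refine ⟨h1.prodMk h2, ?_, fun m hm v w => ?_⟩
  · have h3 : ContMDiff (𝓘(ℝ, A).prod 𝓘(ℝ, B)) 𝓘(ℝ, A × B) ∞ fun z : A × B => (z.1, z.2) :=
      contMDiff_fst.prodMk_space contMDiff_snd
    have h4 : ContMDiff (𝓘(ℝ, A).prod 𝓘(ℝ, B)) 𝓘(ℝ, E) ∞ τ := hτ.contMDiff.comp h3
    have h5 := (contMDiffOn_extChartAt_symm (I := 𝓘(ℝ, E)) (n := ∞) x).comp h4.contMDiffOn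
      (s := Set.univ) fun z _ => hτU (hmem z)
    exact h5.mono (Set.subset_univ _)
  · obtain ⟨hm1, hm2⟩ := hsrc m hm
    set η := extChartAt 𝓘(ℝ, E) x m with hη
    have hd : DifferentiableAt ℝ τ.symm η :=
      (hτ'.contDiffAt (τ.open_target.mem_nhds hm2)).differentiableAt (by simp)
    have hdτ : DifferentiableAt ℝ τ (τ.symm η) := hτ.differentiable (by simp) _
    have hinv := (fderiv_openPartialHomeomorph_symm τ hm2 hdτ hd).1
    have hc := (mdifferentiableAt_chart hm1).hasMFDerivAt
    have d1 := (hd.hasFDerivAt.fst.hasMFDerivAt.comp m hc).mfderiv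
    have d2 := (hd.hasFDerivAt.snd.hasMFDerivAt.comp m hc).mfderiv
    have e1 : mfderiv 𝓘(ℝ, E) 𝓘(ℝ, A) (fun z => (Φ z).1) m = _ := d1
    have e2 : mfderiv 𝓘(ℝ, E) 𝓘(ℝ, B) (fun z => (Φ z).2) m = _ := d2
    have h := hg (τ.symm η) (fderiv ℝ τ.symm η (chartDeriv (E := E) x m v))
      (fderiv ℝ τ.symm η (chartDeriv (E := E) x m w))
    rw [hinv, hinv, τ.right_inv hm2] at h
    rw [e1, e2]
    exact (chartBilin_chartDeriv g.inner hm1 v w).symm.trans h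

end ManifoldSplitting

/-! ### An integrable flipped structure gives a local product. -/

section Flip

variable {E : Type*} [NormedAddCommGroup E] [NormedSpace ℝ E] [FiniteDimensional ℝ E]
  {M : Type*} [TopologicalSpace M] [ChartedSpace E M] [IsManifold 𝓘(ℝ, E) ∞ M]
  {g : RiemMetric E M} {J J' : EndoField E M} {lam mu : ℝ}

namespace IsFlip

theorem chartEndo_comm (hF : IsFlip g J lam mu J') (hJ : IsKahler g J)
    (hRic : ∀ (x : M) (r : ℝ), IsRicciEigenvalue g r x ↔ r = lam ∨ r = mu) (x₀ : M) {y : E}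
    (hy : y ∈ (extChartAt 𝓘(ℝ, E) x₀).target) (v : E) :
    chartEndo J x₀ y (chartEndo J' x₀ y v) = chartEndo J' x₀ y (chartEndo J x₀ y v) := by
  have h1 := (chartSymmDeriv_chartEndo J hy (chartEndo J' x₀ y v)).trans
    (congrArg (J _) (chartSymmDeriv_chartEndo J' hy v))
  have h2 := (chartSymmDeriv_chartEndo J' hy (chartEndo J x₀ y v)).trans
    (congrArg (J' _) (chartSymmDeriv_chartEndo J hy v))
  have h3 := h1.trans ((hF.comm hJ hRic _ (chartSymmDeriv x₀ y v)).trans h2.symm)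
  exact (chartDeriv_chartSymmDeriv hy _).symm.trans
    ((congrArg (chartDeriv (E := E) x₀ ((extChartAt 𝓘(ℝ, E) x₀).symm y)) h3).trans
      (chartDeriv_chartSymmDeriv hy _))

/-- If the flipped structure is Kähler, then the manifold is locally a product of two
Kähler–Einstein manifolds. -/
theorem isLocallyProduct (hF : IsFlip g J lam mu J') (hJ : IsKahler g J)
    (hRic : ∀ (x : M) (r : ℝ), IsRicciEigenvalue g r x ↔ r = lam ∨ r = mu)
    (hJ' : IsKahler g J') : IsLocallyProductKahlerEinstein g lam mu := by
  intro x
  set U := (extChartAt 𝓘(ℝ, E) x).target with hU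
  set G := chartBilin g.inner x with hGdef
  have hG : IsMetricOn G U := isMetricOn_chartBilin g x
  have hH := isHermitianOn_chart hJ.almostKahler.almostComplex x
  have hH' := isHermitianOn_chart hJ'.almostKahler.almostComplex x
  have hcomm := fun y (hy : y ∈ U) => hF.chartEndo_comm hJ hRic x hy
  have hpos : ∀ y ∈ U, ∀ v, v ≠ 0 → 0 < G y v v := by
    intro y hy v hv
    rw [hGdef, chartBilin_apply]
    refine g.pos _ _ fun h => hv ?_
    rw [← chartDeriv_chartSymmDeriv hy v]
    exact (congrArg (chartDeriv (E := E) x ((extChartAt 𝓘(ℝ, E) x).symm y)) h).trans (map_zero _)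
  let T : E → E →L[ℝ] E := fun y => (chartEndo J' x y).comp (chartEndo J x y)
  -- T is −1 on E_λ and 1 on E_μ, so Q is the projection onto E_λ along E_μ.
  let Q : E → E →L[ℝ] E := fun y => (1 / 2 : ℝ) • (1 - T y)
  have hTs : ContDiffOn ℝ ∞ T U := hH'.contDiffOn.clm_comp hH.contDiffOn
  have hTd : ∀ y ∈ U, DifferentiableAt ℝ T y := fun y hy =>
    (hTs.contDiffAt (hG.isOpen.mem_nhds hy)).differentiableAt (by simp)
  have hQs : ContDiffOn ℝ ∞ Q U := (contDiffOn_const.sub hTs).const_smul _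
  have hTT : ∀ y ∈ U, ∀ v, T y (T y v) = v := by
    intro y hy v
    change chartEndo J' x y (chartEndo J x y (chartEndo J' x y (chartEndo J x y v))) = v
    rw [hcomm y hy, hH.sq y hy, map_neg, map_neg, hH'.sq y hy, neg_neg]
  have hQa : ∀ y v, Q y v = (1 / 2 : ℝ) • (v - T y v) := fun y v => rfl
  have hQQ : ∀ y ∈ U, Q y * Q y = Q y := by
    intro y hy
    ext v
    change Q y (Q y v) = Q y v
    simp only [hQa, map_smul, map_sub, hTT y hy]
    module
  have hTp : ∀ y ∈ U, ∀ u, covDeriv G T y u = 0 := by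
    intro y hy u
    rw [covDeriv_comp (hH'.differentiableAt hG hy) (hH.differentiableAt hG hy),
      hJ.covDeriv_eq_zero x hy, hJ'.covDeriv_eq_zero x hy]
    simp
  have hQd : ∀ y ∈ U, ∀ u, fderiv ℝ Q y u = -((1 / 2 : ℝ) • fderiv ℝ T y u) := by
    intro y hy u
    have h1 := ((hTd y hy).hasFDerivAt.const_sub 1).const_smul (1 / 2 : ℝ)
    have h2 : HasFDerivAt Q _ y := h1
    rw [h2.fderiv]
    simp
  have hQp : ∀ y ∈ U, ∀ u, covDeriv G Q y u = 0 := by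
    intro y hy u
    ext v
    have h1 := congrArg (fun L => L v) (hTp y hy u)
    simp only [covDeriv, add_apply, sub_apply, ContinuousLinearMap.comp_apply, zero_apply] at h1
    simp only [covDeriv, add_apply, sub_apply, ContinuousLinearMap.comp_apply, zero_apply,
      hQd y hy, neg_apply, hQa, map_smul, map_sub, FunLike.coe_smul, Pi.smul_apply]
    refine Eq.trans ?_ ((congrArg (fun z => (-(1 / 2 : ℝ)) • z) h1).trans (smul_zero _))
    module
  have hQp' : ∀ y ∈ U, ∀ u,
      fderiv ℝ Q y u = Q y * christoffel G y u - christoffel G y u * Q y := by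
    intro y hy u
    have h1 := hQp y hy u
    rw [covDeriv, add_sub_assoc, add_eq_zero_iff_eq_neg, neg_sub] at h1
    exact h1
  have hTG : ∀ y ∈ U, ∀ v w, G y (T y v) w = G y v (T y w) := by
    intro y hy v w
    change G y (chartEndo J' x y (chartEndo J x y v)) w
      = G y v (chartEndo J' x y (chartEndo J x y w))
    rw [hH'.skew hy, hH.skew hy, neg_neg, hcomm y hy]
  have hQG : ∀ y ∈ U, ∀ v w, G y (Q y v) w = G y v (Q y w) := by
    intro y hy v w
    simp only [hQa, map_smul, map_sub, sub_apply, FunLike.coe_smul, Pi.smul_apply, hTG y hy]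
  have hQJ : ∀ y ∈ U, ∀ v, chartEndo J x y (Q y v) = Q y (chartEndo J x y v) := by
    intro y hy v
    simp only [hQa, map_smul, map_sub]
    congr 2
    exact hcomm y hy _
  have hR : ∀ y ∈ U, ∀ v w,
      localRicci G y v w = mu * G y v w - (mu - lam) * G y (Q y v) w := by
    intro y hy v w
    -- Inserting −Jv removes J on the right and yields 2 Ric = (λ+μ)g + (μ−λ)g(T·,·), which is then
    -- rewritten with T = 1 − 2Q.
    have h1 := hF.chart_apply hJ hRic x hy (-chartEndo J x y v) w
    have h0 : chartEndo J x y (-chartEndo J x y v) = v := by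
      rw [map_neg, hH.sq y hy, neg_neg]
    rw [h0, map_neg] at h1
    have h2 : chartEndo J' x y (chartEndo J x y v) = T y v := rfl
    rw [h2, map_neg] at h1
    simp only [hQa, map_smul, map_sub, sub_apply, neg_apply, FunLike.coe_smul, Pi.smul_apply,
      smul_eq_mul] at h1 ⊢
    linarith
  obtain ⟨p, q, τ, hτs, hxτ, hτU, hτ, hτ', hτQ⟩ := exists_product_coordinates hG.isOpen
    (mem_extChartAt_target (I := 𝓘(ℝ, E)) x) hQs hQQ
    (fun y hy => hG.christoffel_symm hy) hQp'
  have hmem : ∀ z, τ z ∈ τ.target := fun z => τ.map_source (hτs ▸ trivial)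
  have hτb : ∀ z, Function.Bijective (fderiv ℝ τ z) := by
    intro z
    have h1 := fderiv_openPartialHomeomorph_symm τ (hmem z)
      (hτ.differentiable (by simp) _)
      ((hτ'.contDiffAt (τ.open_target.mem_nhds (hmem z))).differentiableAt (by simp))
    rw [τ.left_inv (hτs ▸ trivial)] at h1
    exact Function.bijective_iff_has_inverse.2 ⟨_, h1.2, h1.1⟩
  obtain ⟨G₁, J₁, G₂, J₂, h₁, h₂, hGτ⟩ := exists_kahlerEinstein_factors (lam := lam) (mu := mu) hG
    hpos hH (fun y hy => hJ.covDeriv_eq_zero x hy)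
    (fun y hy => (hQs.contDiffAt (hG.isOpen.mem_nhds hy)).differentiableAt (by simp)) hQp hQG hQJ
    hR hτ (fun z => hτU (hmem z)) hτb hτQ
  obtain ⟨g₁, hg₁, hk₁, he₁⟩ := h₁.exists_riemMetric
  obtain ⟨g₂, hg₂, hk₂, he₂⟩ := h₂.exists_riemMetric
  refine ⟨p, q, EuclideanSpace ℝ (Fin p), inferInstance, inferInstance, inferInstance,
    inferInstance, inferInstance, EuclideanSpace ℝ (Fin q), inferInstance, inferInstance,
    inferInstance, inferInstance, inferInstance, g₁, J₁, g₂, J₂, (chartAt E x).trans τ.symm,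
    hk₁, he₁, hk₂, he₂, ?_, ?_⟩
  · rw [OpenPartialHomeomorph.trans_source]
    exact ⟨mem_chart_source E x, hxτ⟩
  · exact isLocalProductIsometry_of_coordinates x hτs hτU hτ hτ' fun z v w =>
      (hGτ z v w).trans (congrArg₂ (· + ·) (hg₁ _ _ _).symm (hg₂ _ _ _).symm)

end IsFlip

end Flip

end KahlerGeometry

open KahlerGeometry in
theorem lemma1
    {E : Type*} [NormedAddCommGroup E] [NormedSpace ℝ E] [FiniteDimensional ℝ E]
    {M : Type*} [TopologicalSpace M] [T2Space M] [SecondCountableTopology M]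
    [ChartedSpace E M] [IsManifold 𝓘(ℝ, E) ∞ M]
    (g : RiemMetric E M) (J : EndoField E M) (hJ : IsKahler g J)
    (lam mu : ℝ) (hlt : lam < mu)
    (hRic : ∀ (x : M) (r : ℝ), IsRicciEigenvalue g r x ↔ r = lam ∨ r = mu) :
    (∀ x : M, (∀ v ∈ ricciEigenspace g lam x, J x v ∈ ricciEigenspace g lam x) ∧
      (∀ v ∈ ricciEigenspace g mu x, J x v ∈ ricciEigenspace g mu x)) ∧
    (∃! J' : EndoField E M, IsFlip g J lam mu J') ∧
    ∀ J' : EndoField E M, IsFlip g J lam mu J' →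
      IsOrthogonalAlmostComplex g J' ∧
      (∀ (x : M) (v : TangentSpace 𝓘(ℝ, E) x), J x (J' x v) = J' x (J x v)) ∧
      IsAlmostKahler g J' ∧
      (IsKahler g J' ↔ IsIntegrable J') ∧
      (IsIntegrable J' ↔ IsLocallyProductKahlerEinstein g lam mu) := by
  have hne := hlt.ne
  refine ⟨fun x => ⟨fun v hv => hJ.mem_ricciEigenspace hv, fun v hv => hJ.mem_ricciEigenspace hv⟩,
    existsUnique_isFlip J hne hRic, fun J' hF => ?_⟩
  have hk := hF.isAlmostKahler hJ hne hRic
  exact ⟨hF.isOrthogonalAlmostComplex hJ hne hRic, hF.comm hJ hRic, hk,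
    ⟨fun h => h.integrable, fun h => ⟨hk, h⟩⟩,
    fun h => hF.isLocallyProduct hJ hRic ⟨hk, h⟩,
    hF.isIntegrable_of_locallyProduct hJ hne hRic⟩
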